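/- Let $\mathfrak g$ be a finite-dimensional simple complex Lie algebra with Cartan subalgebra $\mathfrak h$, positive roots $\Delta_+=\{\beta_1,\dots,\beta_s\}$ (in a fixed order), simple coroots $H_i$, and root vectors $e_\alpha\in\mathfrak g_\alpha$ with $(e_\alpha|e_{-\alpha})=1$ for the Killing form. In the coordinates $x=(x^\alpha)_{\alpha\in\Delta_+}\mapsto \exp(x^{\beta_1}e_{\beta_1})\cdots\exp(x^{\beta_s}e_{\beta_s})$ on the unipotent group $N_+$, let $\sum_{\beta}S_\alpha^\beta(x)\,\partial/\partial x^\beta$, $S_\alpha^\beta\in\mathbb C[x]$, be the vector field of the infinitesimal action of $e_\alpha$ coming from left translations, $(n\cdot f)(a)=f(n^{-1}a)$. The ghosts $\beta_\alpha(z)=\sum_{m\in\mathbb Z}z^{-m-1}\beta_\alpha[m]$ and $\gamma^\alpha(z)=\sum_{m\in\mathbb Z}z^{-m}\gamma^\alpha[m]$ ($\alpha\in\Delta_+$), with $[\beta_\alpha[m],\gamma^{\alpha'}[n]]=\delta_{\alpha,\alpha'}\delta_{m+n,0}$ and all other commutators zero, act on the Fock space $\mathcal F$ generated by a vacuum that is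 annihilated by $\beta_\alpha[m]$, $m\ge 0$, and $\gamma^\alpha[m]$, $m>0$. Put $$\mathcal S_\alpha(t)=\sum_{\beta\in\Delta_+}{:}S_\alpha^\beta(\gamma(t))\beta_\beta(t){:},\quad T(z)=\sum_{\alpha\in\Delta_+}{:}\partial\gamma^\alpha(z)\beta_\alpha(z){:}=\sum_m z^{-m-2}T[m],\quad H(z)=-\sum_{\alpha\in\Delta_+}\alpha(H){:}\gamma^\alpha(z)\beta_\alpha(z){:}=\sum_m z^{-m-1}H[m]$$ for $H\in\mathfrak h$. For $P_1,\dots,P_n\in\mathbb C[x]$ and $\alpha(1),\dots,\alpha(m)\in\Delta_+$ let $$\langle P_1(\gamma(z_1))\cdots P_n(\gamma(z_n))\,\mathcal S_{\alpha(1)}(t_1)\cdots\mathcal S_{\alpha(m)}(t_m)\rangle_{q,H}=\operatorname{Tr}_{\mathcal F}\bigl(P_1(\gamma(z_1))\cdots P_n(\gamma(z_n))\,\mathcal S_{\alpha(1)}(t_1)\cdots\mathcal S_{\alpha(m)}(t_m)\,q^{T[0]}e^{H[0]}\bigr),$$ and let $\operatorname{ch}(q,H)=\langle 1\rangle_{q,H}$.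 This trace converges absolutely (as a sum over the modes of the fields and the basis vectors of $\mathcal F$) if $0<|q|<|e^{-\alpha(H)}|<1$ for all $\alpha\in\Delta_+$ and $|q|<|t_m|<\cdots<|t_1|<|z_n|<\cdots<|z_1|<1$, and it continues to a holomorphic function of $(q,H,z,t)$ on the region where $0<|q|<1$, $e^{\alpha(H)}\notin q^{\mathbb Z}$ for all $\alpha\in\Delta_+$, all $z_a,t_i$ are nonzero, $z_a\notin q^{\mathbb Z}t_i$ for all $a,i$, and $t_i\notin q^{\mathbb Z}t_j$ for $i\ne j$. Throughout this region $\operatorname{ch}(q,H)\neq0$ and $$\frac{\langle P_1(\gamma(z_1))\cdots P_n(\gamma(z_n))\,\mathcal S_{\alpha(1)}(t_1)\cdots\mathcal S_{\alpha(m)}(t_m)\rangle_{q,H}}{\operatorname{ch}(q,H)}=\sum_{I_1\sqcup\cdots\sqcup I_n=\{1,\dots,m\}}\ \prod_{a=1}^n\frac{\langle P_a(\gamma(z_a))\prod_{i\in I_a}\mathcal S_{\alpha(i)}(t_i)\rangle_{q,H}}{\operatorname{ch}(q,H)},$$ where the sum is over all ordered decompositions of $\{1,\dots,m\}$ into $n$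 disjoint, possibly empty, subsets, and the products over $i\in I_a$ are taken in increasing order. -/

import Mathlib

/-!
Bosonic ghosts attached to a simple Lie algebra, screening currents and their one-loop correlators.
-/

noncomputable section

namespace GhostSystem

open MvPolynomial

open Classical in
/-- The decompositions `I_1 ⊔ ⋯ ⊔ I_n` of the index set of the currents into `n` disjoint, possibly
empty, subsets. -/
def indexPartitions (n m : ℕ) : Finset (Fin n → Finset (Fin m)) :=
  {I | ∀ i, ∃! j, i ∈ I j}

/-! ### The ghost Fock space and the ghost fields -/

section Ghosts

variable {ι : Type*}

/-- The Fock space of ghosts `β_α[m]`, `γ^α[m]` (`α : ι`, `m : ℤ`), realised as the polynomial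
ring in the creation operators: the variable `(α, m)` stands for `γ^α[-m]` if `0 ≤ m` and for
`β_α[m]` if `m < 0`. The vacuum is `1`; the monomials form a basis. -/
abbrev Fock (ι : Type*) := MvPolynomial (ι × ℤ) ℂ

/-- The basis vector of the Fock space with occupation numbers `d`. -/
def basisVec (d : ι × ℤ →₀ ℕ) : Fock ι := monomial d 1

/-- The mode `β_α[m]`: a creation operator for `m < 0`, an annihilation operator for `0 ≤ m`. -/
def betaMode (α : ι) (m : ℤ) : Module.End ℂ (Fock ι) :=
  if m < 0 then LinearMap.mulLeft ℂ (X (α, m)) else (pderiv (α, m)).toLinearMap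

/-- The mode `γ^α[m]`: a creation operator for `m ≤ 0`, an annihilation operator for `0 < m`. -/
def gammaMode (α : ι) (m : ℤ) : Module.End ℂ (Fock ι) :=
  if m ≤ 0 then LinearMap.mulLeft ℂ (X (α, -m)) else -(pderiv (α, -m)).toLinearMap

theorem betaMode_vacuum (α : ι) {m : ℤ} (hm : 0 ≤ m) : betaMode α m 1 = 0 := by
  simp [betaMode, not_lt.mpr hm]

theorem gammaMode_vacuum (α : ι) {m : ℤ} (hm : 0 < m) : gammaMode α m 1 = 0 := by
  simp [gammaMode, not_le.mpr hm]

open Classical in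
/-- The canonical commutation relations `[β_α[m], γ^α'[n]] = δ_{α,α'} δ_{m+n,0}`. -/
theorem betaMode_gammaMode (α α' : ι) (m n : ℤ) :
    ⁅betaMode α m, gammaMode α' n⁆ = if α = α' ∧ m + n = 0 then 1 else 0 := by
  have key : (α', -n) = (α, m) ↔ (α = α' ∧ m + n = 0) := by
    rw [Prod.mk.injEq]
    constructor
    · rintro ⟨h1, h2⟩; exact ⟨h1.symm, by omega⟩
    · rintro ⟨h1, h2⟩; exact ⟨h1.symm, by omega⟩
  have key' : (α, m) = (α', -n) ↔ (α = α' ∧ m + n = 0) := by rw [eq_comm, key]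
  refine LinearMap.ext fun v => ?_
  rw [Ring.lie_def]
  by_cases hm : m < 0 <;> by_cases hn : n ≤ 0
  · have : ¬ (α = α' ∧ m + n = 0) := fun h => by omega
    simp [betaMode, gammaMode, hm, hn, this]; ring
  · by_cases h : α = α' ∧ m + n = 0
    · have h' : m = -n := by have := h.2; omega
      have hn' : 0 < n := by omega
      simp [betaMode, gammaMode, hn', hn, h, h', mul_comm]
    · simp [betaMode, gammaMode, hm, hn, h, pderiv_X, key', mul_comm]
  · by_cases h : α = α' ∧ m + n = 0
    · have h' : -n = m := by have := h.2; omega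
      simp [betaMode, gammaMode, hm, hn, h, h', pderiv_X, mul_comm]
    · simp [betaMode, gammaMode, hm, hn, h, pderiv_X, key, mul_comm]
  · have h : ¬ (α = α' ∧ m + n = 0) := fun h => by omega
    have hc : ⁅pderiv (R := ℂ) (α', -n), pderiv (R := ℂ) (α, m)⁆ = 0 := by
      refine MvPolynomial.derivation_ext fun i => ?_
      simp [Derivation.commutator_apply, pderiv_X, Pi.single_apply, apply_ite]
    have hv := DFunLike.congr_fun hc v
    simp only [Derivation.commutator_apply, Derivation.coe_zero, Pi.zero_apply] at hv
    simpa [betaMode, gammaMode, hm, hn, h, sub_eq_add_neg, add_comm] using hv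

/-- The sum `∑_k A k` of a locally finite family of operators (on each basis vector only finitely
many `A k` are nonzero), defined on the basis and extended linearly. -/
def modeSum (A : ℤ → Module.End ℂ (Fock ι)) : Module.End ℂ (Fock ι) :=
  (basisMonomials (ι × ℤ) ℂ).constr ℂ fun d => ∑ᶠ k : ℤ, A k (basisVec d)

/-- The coefficient of `z^{-n}` in the product `γ^{α_1}(z) ⋯ γ^{α_r}(z)`,
where `γ^α(z) = ∑_m z^{-m} γ^α[m]`. -/
def gammaProdMode : List ι → ℤ → Module.End ℂ (Fock ι)
  | [], n => if n = 0 then 1 else 0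
  | α :: l, n => modeSum fun k => gammaMode α k * gammaProdMode l (n - k)

/-- The coefficient of `z^{-n}` in `P(γ(z))`. The `γ`'s commute with each other, so the order in
which the factors of a monomial are listed plays no role. -/
def polyMode (P : MvPolynomial ι ℂ) (n : ℤ) : Module.End ℂ (Fock ι) :=
  ∑ e ∈ P.support, P.coeff e • gammaProdMode (Finsupp.toMultiset e).toList n

/-- The coefficient of `z^{-n-1}` in the normally ordered product `:Q(γ(z)) β_α(z):`,
where `β_α(z) = ∑_m z^{-m-1} β_α[m]`. -/
def currentMode (Q : MvPolynomial ι ℂ) (α : ι) (n : ℤ) : Module.End ℂ (Fock ι) :=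
  modeSum fun m => if m < 0 then betaMode α m * polyMode Q (n - m)
    else polyMode Q (n - m) * betaMode α m

/-- For a vector field `D = ∑_β S_β(x) ∂/∂x^β`, the coefficient of `z^{-n-1}` in its bosonization
`∑_β :S_β(γ(z)) β_β(z):`. -/
def fieldMode [Fintype ι] (S : ι → MvPolynomial ι ℂ) (n : ℤ) : Module.End ℂ (Fock ι) :=
  ∑ β, currentMode (S β) β n

/-! ### The zero modes `T[0]`, `H[0]` and the trace -/

/-- `:γ^α[m] β_α[-m]:`. -/
def pairMode (α : ι) (m : ℤ) : Module.End ℂ (Fock ι) :=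
  if 0 < m then betaMode α (-m) * gammaMode α m else gammaMode α m * betaMode α (-m)

/-- The zero mode `T[0]` of `T(z) = ∑_α :∂γ^α(z) β_α(z): = ∑_m z^{-m-2} T[m]`. -/
def zeroModeT [Fintype ι] : Module.End ℂ (Fock ι) :=
  ∑ α, modeSum fun m => (-(m : ℂ)) • pairMode α m

/-- The zero mode `H[0]` of `H(z) = -∑_α α(H) :γ^α(z) β_α(z): = ∑_m z^{-m-1} H[m]`, where
`c α` is the number `α(H)`. -/
def zeroModeH [Fintype ι] (c : ι → ℂ) : Module.End ℂ (Fock ι) :=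
  -∑ α, c α • modeSum fun m => pairMode α m

/-- The eigenvalue of `T[0]` on a basis vector. -/
def energy (d : ι × ℤ →₀ ℕ) : ℕ := d.sum fun p r => r * p.2.natAbs

/-- The eigenvalue of `H[0]` on a basis vector: `γ^α` has charge `-α(H)`, `β_α` charge `α(H)`. -/
def charge (c : ι → ℂ) (d : ι × ℤ →₀ ℕ) : ℂ :=
  d.sum fun p r => (r : ℂ) * (if p.2 < 0 then c p.1 else -c p.1)

theorem pairMode_basisVec (α : ι) (m : ℤ) (d : ι × ℤ →₀ ℕ) :
    pairMode α m (basisVec d) =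
      ((d (α, -m) : ℂ) * (if 0 < m then -1 else 1)) • basisVec d := by
  have h := X_mul_pderiv_monomial (R := ℂ) (i := (α, -m)) (m := d) (r := 1)
  by_cases hm : 0 < m
  · have h1 : -m < 0 := by omega
    have h2 : ¬ m ≤ 0 := by omega
    simp only [pairMode, betaMode, gammaMode, basisVec, hm, h1, h2, if_true, if_false,
      Module.End.mul_apply, LinearMap.neg_apply, LinearMap.mulLeft_apply,
      Derivation.coeFn_coe, mul_neg, mul_one, h, neg_smul, Nat.cast_smul_eq_nsmul]
  · have h1 : ¬ -m < 0 := by omega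
    have h2 : m ≤ 0 := by omega
    simp only [pairMode, betaMode, gammaMode, basisVec, hm, h1, h2, if_true, if_false,
      Module.End.mul_apply, LinearMap.mulLeft_apply,
      Derivation.coeFn_coe, mul_one, h, Nat.cast_smul_eq_nsmul]

theorem sum_modeSum_pairMode [Fintype ι] (c : ι → ℤ → ℂ) (d : ι × ℤ →₀ ℕ) :
    (∑ α, modeSum fun m => c α m • pairMode α m) (basisVec d) =
      (d.sum fun p r => (r : ℂ) * (c p.1 (-p.2) * (if p.2 < 0 then -1 else 1))) • basisVec d := by
  classical
  have hf : ∀ α : ι, (modeSum fun m => c α m • pairMode α m) (basisVec d) =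
      (∑ k ∈ d.support.image (fun p => p.2),
        (d (α, k) : ℂ) * (c α (-k) * (if k < 0 then -1 else 1))) • basisVec d := by
    intro α
    have h0 : basisVec d = basisMonomials (ι × ℤ) ℂ d := by simp [basisVec]
    conv_lhs => rw [h0, modeSum, Module.Basis.constr_basis]
    rw [← finsum_comp_equiv (Equiv.neg ℤ)]
    simp only [Equiv.neg_apply, LinearMap.smul_apply, pairMode_basisVec, neg_neg, smul_smul,
      Left.neg_pos_iff]
    rw [finsum_eq_sum_of_support_subset (s := d.support.image (fun p => p.2)), Finset.sum_smul]
    · refine Finset.sum_congr rfl fun k _ => ?_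
      congr 1; ring
    · intro k hk
      simp only [Function.mem_support] at hk
      simp only [Finset.coe_image, Set.mem_image, Finset.mem_coe, Finsupp.mem_support_iff]
      refine ⟨(α, k), fun h => hk ?_, rfl⟩
      simp [h]
  rw [LinearMap.sum_apply, Finset.sum_congr rfl fun α _ => hf α, ← Finset.sum_smul,
    ← Finset.sum_product', Finsupp.sum]
  congr 1
  symm
  refine Finset.sum_subset (fun p hp => ?_) fun p _ hp => ?_
  · exact Finset.mem_product.2 ⟨Finset.mem_univ _, Finset.mem_image_of_mem _ hp⟩
  · simp [Finsupp.notMem_support_iff.1 hp]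

theorem zeroModeT_basisVec [Fintype ι] (d : ι × ℤ →₀ ℕ) :
    zeroModeT (basisVec d) = (energy d : ℂ) • basisVec d := by
  rw [zeroModeT, sum_modeSum_pairMode (fun _ m => -(m : ℂ)), energy, Finsupp.sum, Finsupp.sum]
  push_cast
  congr 1
  refine Finset.sum_congr rfl fun p _ => ?_
  congr 1
  by_cases h : p.2 < 0
  · have h2 := Int.ofNat_natAbs_of_nonpos h.le
    have h3 : ((p.2.natAbs : ℤ) : ℂ) = ((-p.2 : ℤ) : ℂ) := by rw [h2]
    push_cast at h3
    simp only [h, if_true]; rw [← h3]; simp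
  · have h2 := Int.natAbs_of_nonneg (not_lt.1 h)
    have h3 : ((p.2.natAbs : ℤ) : ℂ) = (p.2 : ℂ) := by rw [h2]
    simp only [h, if_false]; simp [← h3]

theorem zeroModeH_basisVec [Fintype ι] (c : ι → ℂ) (d : ι × ℤ →₀ ℕ) :
    zeroModeH c (basisVec d) = charge c d • basisVec d := by
  have h0 : zeroModeH c = ∑ α, modeSum fun m => (-c α) • pairMode α m := by
    rw [zeroModeH, ← Finset.sum_neg_distrib]
    refine Finset.sum_congr rfl fun α _ => ?_
    refine (basisMonomials (ι × ℤ) ℂ).ext fun d => ?_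
    rw [LinearMap.neg_apply, LinearMap.smul_apply, modeSum, modeSum, Module.Basis.constr_basis,
      Module.Basis.constr_basis, ← neg_smul, smul_finsum]
    simp
  rw [h0, sum_modeSum_pairMode (fun α _ => -c α), charge]
  congr 1
  refine Finsupp.sum_congr fun p _ => ?_
  split_ifs <;> simp

/-- The operator `q^{T[0]} e^{H[0]}`, diagonal in the monomial basis. -/
def boltzmann (q : ℂ) (c : ι → ℂ) : Module.End ℂ (Fock ι) :=
  (basisMonomials (ι × ℤ) ℂ).constr ℂ fun d =>
    (q ^ energy d * Complex.exp (charge c d)) • basisVec d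

/-- The terms of the one-loop correlator
`Tr (P_1(γ(z_1)) ⋯ P_n(γ(z_n)) S_1(t_1) ⋯ S_m(t_m) q^{T[0]} e^{H[0]})`, where `S_i(t)` is the
bosonization of the vector field `S i`. All fields are expanded into their modes (`k a` is the mode
of the `a`-th polynomial, `l i` that of the `i`-th current) and the trace is taken over the basis
vectors `d` of the Fock space. -/
def traceTerm [Fintype ι] {n m : ℕ} (P : Fin n → MvPolynomial ι ℂ)
    (S : Fin m → ι → MvPolynomial ι ℂ) (q : ℂ) (c : ι → ℂ) (z : Fin n → ℂ) (t : Fin m → ℂ) :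
    (Fin n → ℤ) × (Fin m → ℤ) × (ι × ℤ →₀ ℕ) → ℂ
  | (k, l, d) => (∏ a, z a ^ (-k a)) * (∏ i, t i ^ (-l i - 1)) *
      coeff d (((List.ofFn fun a => polyMode (P a) (k a)).prod *
        (List.ofFn fun i => fieldMode (S i) (l i)).prod * boltzmann q c) (basisVec d))

end Ghosts

/-! ### The Lie algebra data and the screening currents -/

section LieData

open LieAlgebra LieAlgebra.IsKilling

variable {𝔤 : Type*} [LieRing 𝔤] [LieAlgebra ℂ 𝔤] [FiniteDimensional ℂ 𝔤] [LieAlgebra.IsSimple ℂ 𝔤]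

/-- The choices made for a simple Lie algebra with a Cartan subalgebra: simple roots, root vectors
`e_α ∈ 𝔤_α` with `(e_α | e_{-α}) = 1`, and an enumeration `β_1, …, β_s` of the positive roots. -/
structure RootFrame (𝔥 : LieSubalgebra ℂ 𝔤) [𝔥.IsCartanSubalgebra] where
  base : (rootSystem 𝔥).Base
  rootVec : LieModule.Weight ℂ 𝔥 𝔤 → 𝔤
  rootVec_mem : ∀ α : LieModule.Weight ℂ 𝔥 𝔤, α.IsNonZero → rootVec α ∈ rootSpace 𝔥 α
  rootVec_pairing : ∀ α : LieModule.Weight ℂ 𝔥 𝔤, α.IsNonZero →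
    killingForm ℂ 𝔤 (rootVec α) (rootVec (-α)) = 1
  card : ℕ
  enum : Fin card ≃ {α : 𝔥.root // base.IsPos α}

namespace RootFrame

variable {𝔥 : LieSubalgebra ℂ 𝔤} [𝔥.IsCartanSubalgebra] (fr : RootFrame 𝔥)

/-- The set of positive roots. -/
abbrev PosRoot : Type _ := {α : 𝔥.root // fr.base.IsPos α}

instance : Fintype fr.PosRoot := Fintype.ofEquiv _ fr.enum

/-- The root vector `e_α` of a positive root. -/
def posVec (α : fr.PosRoot) : 𝔤 := fr.rootVec α.1.1

/-- The coefficient of `e_γ` in an element `Y` of `𝔫₊ = ⨁_{α > 0} ℂ e_α`, which is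
`(Y | e_{-γ})`. -/
def posCoeff (γ : fr.PosRoot) (Y : 𝔤) : ℂ := killingForm ℂ 𝔤 Y (fr.rootVec (-γ.1.1))

/-- The matrix of `ad e_β` on `𝔫₊` in the basis `(e_α)`. -/
def adMatrix (β : fr.PosRoot) : Matrix fr.PosRoot fr.PosRoot ℂ :=
  Matrix.of fun γ δ => fr.posCoeff γ ⁅fr.posVec β, fr.posVec δ⁆

open Classical in
/-- The matrix of `Ad (exp (x^β e_β)) = exp (x^β ad e_β)` on `𝔫₊`, with entries in `ℂ[x]`. -/
def AdExp (β : fr.PosRoot) : Matrix fr.PosRoot fr.PosRoot (MvPolynomial fr.PosRoot ℂ) :=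
  IsNilpotent.exp ((X β : MvPolynomial fr.PosRoot ℂ) • (fr.adMatrix β).map C)

open Classical in
/-- For `g(x) = exp (x^{β_1} e_{β_1}) ⋯ exp (x^{β_s} e_{β_s})`, the column `β = β_k` of this matrix
is the element `∂g/∂x^β · g⁻¹ = Ad (exp (x^{β_1} e_{β_1}) ⋯ exp (x^{β_{k-1}} e_{β_{k-1}})) e_{β_k}`
of `𝔫₊ ⊗ ℂ[x]`, expressed in the basis `(e_α)`. -/
def maurerCartan : Matrix fr.PosRoot fr.PosRoot (MvPolynomial fr.PosRoot ℂ) :=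
  Matrix.of fun γ β =>
    (((List.ofFn fun j => fr.AdExp (fr.enum j)).take (fr.enum.symm β : ℕ)).prod) γ β

open Classical in
/-- The vector field `∑_β S_α^β(x) ∂/∂x^β` of the infinitesimal action of `e_α` on functions on
`N₊` coming from left translations, `(n · f)(a) = f(n⁻¹ a)`, in the coordinates `a = g(x)`. Along
it `g` changes by `-e_α g`, that is, `∑_β S_α^β ∂g/∂x^β · g⁻¹ = -e_α`; the matrix `maurerCartan` is
invertible over `ℂ[x]`. -/
def leftField (α β : fr.PosRoot) : MvPolynomial fr.PosRoot ℂ := -(fr.maurerCartan⁻¹ β α)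

/-- The element `H = ∑_i a_i H_i` of the Cartan subalgebra, `H_i` the simple coroots. -/
def cartan (a : fr.base.support → ℂ) : 𝔥 := ∑ i, a i • (rootSystem 𝔥).coroot i.1

/-- `α ↦ α(H)` for `H = ∑_i a_i H_i`. -/
def rootEval (a : fr.base.support → ℂ) (α : fr.PosRoot) : ℂ := (rootSystem 𝔥).root α.1 (fr.cartan a)

/-- The parameters `(q, H, z, t)` of a correlator with `n + m` insertions, `H` being given by its
coordinates with respect to the simple coroots. -/
abbrev Params (n m : ℕ) : Type _ := ℂ × (fr.base.support → ℂ) × (Fin n → ℂ) × (Fin m → ℂ)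

/-- The region where the trace over the Fock space converges: `|q| < |e^{-α(H)}| < 1` for all
positive roots, and `|q| < |t_m| < ⋯ < |t_1| < |z_n| < ⋯ < |z_1| < 1`. -/
def traceRegion (n m : ℕ) : Set (fr.Params n m) :=
  {x | match x with
    | (q, a, z, t) => 0 < ‖q‖ ∧ ‖q‖ < 1 ∧
        (∀ α, ‖q‖ < ‖Complex.exp (-fr.rootEval a α)‖ ∧ ‖Complex.exp (-fr.rootEval a α)‖ < 1) ∧
        (∀ j, ‖q‖ < ‖z j‖ ∧ ‖z j‖ < 1) ∧ (∀ i, ‖q‖ < ‖t i‖ ∧ ‖t i‖ < 1) ∧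
        (StrictAnti fun j => ‖z j‖) ∧ (StrictAnti fun i => ‖t i‖) ∧ ∀ j i, ‖t i‖ < ‖z j‖}

/-- The region where the correlators are holomorphic: `0 < |q| < 1`, `e^{α(H)} ∉ q^ℤ` for all
positive roots, the points are nonzero, and on the elliptic curve `ℂˣ/q^ℤ` the points `t_i` are
different from each other and from the `z_a`. -/
def regularRegion (n m : ℕ) : Set (fr.Params n m) :=
  {x | match x with
    | (q, a, z, t) => 0 < ‖q‖ ∧ ‖q‖ < 1 ∧
        (∀ α, ∀ k : ℤ, Complex.exp (fr.rootEval a α) ≠ q ^ k) ∧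
        (∀ j, z j ≠ 0) ∧ (∀ i, t i ≠ 0) ∧ (∀ j i, ∀ k : ℤ, z j ≠ q ^ k * t i) ∧
        ∀ i i', i ≠ i' → ∀ k : ℤ, t i ≠ q ^ k * t i'}

/-- `F` is the one-loop correlator
`⟨P_1(γ(z_1)) ⋯ P_n(γ(z_n)) S_{α(1)}(t_1) ⋯ S_{α(m)}(t_m)⟩_{q,H}`: in the region of convergence it
is the (absolutely convergent) trace over the ghost Fock space, and outside it is the holomorphic
continuation of this trace. -/
def IsCorrelator {n m : ℕ} (P : Fin n → MvPolynomial fr.PosRoot ℂ) (α : Fin m → fr.PosRoot)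
    (F : fr.Params n m → ℂ) : Prop :=
  DifferentiableOn ℂ F (fr.regularRegion n m) ∧
    ∀ q a z t, (q, a, z, t) ∈ fr.traceRegion n m →
      HasSum (traceTerm P (fun i => fr.leftField (α i)) q (fr.rootEval a) z t) (F (q, a, z, t))

/-- The one-loop correlator `⟨P_1(γ(z_1)) ⋯ P_n(γ(z_n)) S_{α(1)}(t_1) ⋯ S_{α(m)}(t_m)⟩_{q,H}` as a
function of `(q, H, z, t)`; only its values on `regularRegion` are meaningful. -/
def correlator {n m : ℕ} (P : Fin n → MvPolynomial fr.PosRoot ℂ) (α : Fin m → fr.PosRoot) :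
    fr.Params n m → ℂ :=
  Classical.epsilon (fr.IsCorrelator P α)

/-- The character `⟨1⟩_{q,H}` of the ghost Fock space. -/
def character (q : ℂ) (a : fr.base.support → ℂ) : ℂ :=
  fr.correlator (n := 0) (m := 0) ![] ![] (q, a, ![], ![])

/-- The correlator `⟨P(γ(z)) ∏_{i ∈ I} S_{α(i)}(t_i)⟩_{q,H}` with a single polynomial, the
currents being multiplied in increasing order of the indices `i ∈ I`. -/
def singleCorrelator {m : ℕ} (P : MvPolynomial fr.PosRoot ℂ) (α : Fin m → fr.PosRoot)
    (I : Finset (Fin m)) (q : ℂ) (a : fr.base.support → ℂ) (z : ℂ) (t : Fin m → ℂ) : ℂ :=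
  fr.correlator ![P] (fun i => α (I.orderEmbOfFin rfl i))
    (q, a, ![z], fun i => t (I.orderEmbOfFin rfl i))

end RootFrame

end LieData

end GhostSystem

end

noncomputable section

namespace GhostSystem
open Filter Topology Metric

/-! ### Series and products depending holomorphically on several variables -/

/-! The ghosts are free fields, so the trace is given by Wick's theorem at positive temperature.
Moving a mode β_b[m] once around the trace costs a factor w^{±1}, where w is the Boltzmann weight of
its oscillator, together with commutator terms. Solving the resulting linear equation replaces
β_b[m] by a sum over the polynomials of the word, one of them being differentiated by ∂_b
(`tsum_diagTerm_beta`, iterated by `wick_expansion`). When no β is left, only the constant terms of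
the polynomials contribute, because every γ mode raises the ghost number.

Summed over the modes, the propagator of β_b(t) and γ^b(x) becomes t⁻¹ K(q, e^{-b(H)}, x/t) with K =
`kronecker`: the thermal factors for a γ to the right and to the left of β are the Laurent
coefficients of this one function on the annuli |q| < |x/t| < 1 and 1 < |x/t| < 1/|q|. Hence the
correlator is the character times a finite sum over diagrams (b, f). The β of the i-th current has
index b i and is contracted with a γ at the vertex f i, which is some P_a or a current, and every
vertex contributes a derivative of its polynomial at 0 (`hasSum_traceTerm`).

The Lie algebra enters only through a grading. By homogeneity of the Maurer-Cartan matrix, S_α^β has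
weighted degree ht β - ht α, so it involves only coordinates of height less than ht β
(`ht_lt_of_coeff_leftField_ne_zero`). Therefore no current is contracted with itself, and a
contraction of the current i with a γ of the current i' forces ht (b i) < ht (b i'). The arrows i →
f i have no cycles, and following them leads from each current to exactly one P_a. Sorting the
currents by this endpoint gives the decomposition I_1 ⊔ ... ⊔ I_n, and the value of a diagram is the
product of its values on the blocks (`wickTerm_glue`, `sum_wickTerm_eq`).

Absolute convergence comes from a majorant: the sign of the annihilating γ modes is changed to +1
and the coefficients of the polynomials are replaced by their absolute values. All matrix elements
are then nonnegative, and the same recursion holds as an inequality for finite partial sums.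

The continuation is unique because, for fixed q, a complex line from any regular point to a point of
the region of convergence leaves the regular region only in a countable set, whose complement in ℂ
is connected. So `correlator` agrees with the closed form on the regular region. -/

theorem differentiableOn_tsum_of_norm_le {E : Type*} [NormedAddCommGroup E] [NormedSpace ℂ E]
    {F : ℕ → E → ℂ} {u : ℕ → ℝ} {s : Set E} (hu : Summable u) (hs : IsOpen s)
    (hF : ∀ n, DifferentiableOn ℂ (F n) s) (hb : ∀ n, ∀ x ∈ s, ‖F n x‖ ≤ u n) :
    DifferentiableOn ℂ (fun x => ∑' n, F n x) s := by
  intro x hx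
  obtain ⟨r, hr, hrs⟩ := Metric.isOpen_iff.1 hs x hx
  have hr2 : 0 < r / 2 := by positivity
  have hsub : ∀ y ∈ ball x (r / 2), ball y (r / 2) ⊆ s := fun y hy z hz => hrs (by
    rw [mem_ball] at *
    linarith [dist_triangle z y x])
  have hsub' : ball x (r / 2) ⊆ s := fun y hy => hsub y hy (mem_ball_self hr2)
  refine DifferentiableAt.differentiableWithinAt (HasFDerivAt.differentiableAt
    (hasFDerivAt_tsum_of_isPreconnected (u := fun n => 2 * u n / (r / 2)) (f := F)
      (f' := fun n => fderiv ℂ (F n)) (s := ball x (r / 2)) (x₀ := x)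
      ((hu.mul_left 2).div_const _) isOpen_ball (convex_ball x _).isPreconnected ?_ ?_
      (mem_ball_self hr2) ?_ (mem_ball_self hr2)))
  · intro n y hy
    exact ((hF n).differentiableAt (hs.mem_nhds (hsub' hy))).hasFDerivAt
  · intro n y hy
    -- Cauchy estimate on the ball of radius r / 2 about y: there F n differs from F n y by at most
    -- 2 * u n, so the derivatives are summably bounded.
    refine Complex.norm_fderiv_le_div_of_mapsTo_ball ((hF n).mono (hsub y hy)) ?_ hr2
    intro z hz
    rw [mem_closedBall, dist_eq_norm]
    have h1 := hb n z (hsub y hy hz)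
    have h2 := hb n y (hsub' hy)
    linarith [norm_sub_le (F n z) (F n y)]
  · exact Summable.of_norm_bounded hu fun n => hb n x hx

theorem differentiableAt_fun_div {E : Type*} [NormedAddCommGroup E] [NormedSpace ℂ E]
    {f g : E → ℂ} {x : E} (hf : DifferentiableAt ℂ f x) (hg : DifferentiableAt ℂ g x)
    (h : g x ≠ 0) : DifferentiableAt ℂ (fun x => f x / g x) x := by
  simp only [div_eq_mul_inv]
  exact hf.fun_mul (hg.fun_inv h)

/-- An induction principle for statements about functions of `(u, y)` invariant under
`(u, y) ↦ (u q, y q)`. -/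
theorem shift_induction {q : ℂ} (hq : ‖q‖ < 1) {p : ℂ → ℂ → Prop}
    (small : ∀ u y, ‖u‖ < 1 / 2 → ‖y‖ < 1 / 2 → p u y)
    (step : ∀ u y, p (u * q) (y * q) → p u y) (u y : ℂ) : p u y := by
  have key : ∀ N : ℕ, ∀ u y : ℂ, ‖u * q ^ N‖ < 1 / 2 → ‖y * q ^ N‖ < 1 / 2 → p u y := by
    intro N
    induction N with
    | zero => intro u y h1 h2; exact small u y (by simpa using h1) (by simpa using h2)
    | succ N ih =>
      intro u y h1 h2
      refine step u y (ih _ _ ?_ ?_)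
      · rwa [mul_assoc, ← pow_succ']
      · rwa [mul_assoc, ← pow_succ']
  have ht : ∀ w : ℂ, ∀ᶠ N : ℕ in atTop, ‖w * q ^ N‖ < 1 / 2 := fun w => by
    have := ((tendsto_pow_atTop_nhds_zero_of_norm_lt_one hq).const_mul w).norm
    simp only [mul_zero, norm_zero] at this
    exact this.eventually_lt_const (by norm_num)
  obtain ⟨N, h1, h2⟩ := ((ht u).and (ht y)).exists
  exact key N u y h1 h2

theorem norm_mul_pow_lt_half {q y : ℂ} (hq : ‖q‖ < 1) (hy : ‖y‖ < 1 / 2) (n : ℕ) :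
    ‖y * q ^ n‖ < 1 / 2 := by
  rw [norm_mul, norm_pow]
  have := pow_le_one₀ (n := n) (norm_nonneg q) hq.le
  nlinarith [norm_nonneg y, pow_nonneg (norm_nonneg q) n]

theorem half_lt_norm_one_sub {w : ℂ} (hw : ‖w‖ < 1 / 2) : 1 / 2 < ‖1 - w‖ := by
  have := norm_sub_norm_le (1 : ℂ) w
  rw [norm_one] at this
  linarith

theorem one_sub_ne_zero_of_norm_lt {w : ℂ} (hw : ‖w‖ < 1) : 1 - w ≠ 0 := by
  rintro h
  rw [sub_eq_zero] at h
  rw [← h, norm_one] at hw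
  exact lt_irrefl _ hw

/-! ### The `q`-Pochhammer symbol -/

/-- `(y; q)_∞ = ∏_{n ≥ 0} (1 - y q ^ n)`. -/
def qPoch (q y : ℂ) : ℂ := ∏' n : ℕ, (1 - y * q ^ n)

theorem summable_norm_mul_pow {q : ℂ} (hq : ‖q‖ < 1) (y : ℂ) :
    Summable fun n : ℕ => ‖-(y * q ^ n)‖ := by
  simp only [norm_neg, norm_mul, norm_pow]
  exact (summable_geometric_of_lt_one (norm_nonneg _) hq).mul_left _

theorem multipliable_qPoch {q : ℂ} (hq : ‖q‖ < 1) (y : ℂ) :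
    Multipliable fun n : ℕ => (1 - y * q ^ n) := by
  simpa only [← sub_eq_add_neg] using multipliable_one_add_of_summable (summable_norm_mul_pow hq y)

theorem tendsto_qPoch {q : ℂ} (hq : ‖q‖ < 1) (y : ℂ) :
    Tendsto (fun N => ∏ n ∈ Finset.range N, (1 - y * q ^ n)) atTop (𝓝 (qPoch q y)) :=
  (multipliable_qPoch hq y).hasProd.tendsto_prod_nat

theorem qPoch_ne_zero {q y : ℂ} (hq : ‖q‖ < 1) (hy : ∀ n : ℕ, y * q ^ n ≠ 1) :
    qPoch q y ≠ 0 := by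
  have := tprod_one_add_ne_zero_of_summable (f := fun n : ℕ => -(y * q ^ n))
    (fun n => by rw [← sub_eq_add_neg, sub_ne_zero]; exact (hy n).symm)
    (summable_norm_mul_pow hq y)
  simpa only [← sub_eq_add_neg, qPoch] using this

theorem qPoch_step {q : ℂ} (hq : ‖q‖ < 1) (y : ℂ) :
    qPoch q y = (1 - y) * qPoch q (y * q) := by
  have h1 := (tendsto_qPoch hq (y * q)).const_mul (1 - y)
  have h2 := (tendsto_add_atTop_iff_nat 1).2 (tendsto_qPoch hq y)
  refine tendsto_nhds_unique h2 (h1.congr fun N => ?_)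
  rw [Finset.prod_range_succ']
  simp only [pow_succ', pow_zero, mul_one, mul_assoc, mul_comm (1 - y)]

/-- For ‖y‖ < 1/2 the product is the exponential of a locally uniformly convergent series of
logarithms; `qPoch_step` carries the statement from y * q back to y. -/
theorem differentiableAt_qPoch {q : ℂ} (hq : ‖q‖ < 1) (y : ℂ) :
    DifferentiableAt ℂ (fun p : ℂ × ℂ => qPoch p.1 p.2) (q, y) := by
  refine shift_induction hq
    (p := fun _ y => DifferentiableAt ℂ (fun p : ℂ × ℂ => qPoch p.1 p.2) (q, y)) ?_ ?_ 0 y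
  · intro _ y _ hy
    obtain ⟨r, hr1, hr2⟩ := exists_between hq
    set s : Set (ℂ × ℂ) := {p | ‖p.1‖ < r ∧ ‖p.2‖ < 1 / 2} with hs
    have hso : IsOpen s := by
      simp only [hs, Set.ofPred_and]
      exact (isOpen_lt (by fun_prop) (by fun_prop)).inter (isOpen_lt (by fun_prop) (by fun_prop))
    have hsm : (q, y) ∈ s := ⟨hr1, hy⟩
    have hlt : ∀ p ∈ s, ∀ n : ℕ, ‖p.2 * p.1 ^ n‖ < 1 / 2 := fun p hp n =>
      norm_mul_pow_lt_half (hp.1.trans hr2) hp.2 n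
    -- On the disc of radius 1/2 one has |log (1 - w)| ≤ (3/2) |w|, and (3/2) * (1/2) ≤ 1.
    have hle : ∀ n : ℕ, ∀ p ∈ s, ‖Complex.log (1 - p.2 * p.1 ^ n)‖ ≤ r ^ n := fun n p hp => by
      have h1 := Complex.norm_log_one_add_half_le_self (z := -(p.2 * p.1 ^ n))
        (by rw [norm_neg]; exact (hlt p hp n).le)
      rw [← sub_eq_add_neg, norm_neg, norm_mul, norm_pow] at h1
      have h3 := pow_le_pow_left₀ (norm_nonneg _) hp.1.le n
      have h4 : ‖p.2‖ < 1 / 2 := hp.2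
      nlinarith [norm_nonneg p.2, pow_nonneg (norm_nonneg p.1) n,
        mul_le_mul h4.le h3 (pow_nonneg (norm_nonneg p.1) n) (by norm_num)]
    have hr0 : 0 ≤ r := (norm_nonneg q).trans hr1.le
    have hsum := summable_geometric_of_lt_one hr0 hr2
    have hd := differentiableOn_tsum_of_norm_le (F := fun n (p : ℂ × ℂ) =>
      Complex.log (1 - p.2 * p.1 ^ n)) hsum hso (fun n p hp => by
        refine DifferentiableAt.differentiableWithinAt (DifferentiableAt.clog (by fun_prop) ?_)
        have := mem_ball.1 (show -(p.2 * p.1 ^ n) ∈ ball (0 : ℂ) 1 by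
          rw [mem_ball_zero_iff, norm_neg]; linarith [hlt p hp n])
        rw [sub_eq_add_neg]
        exact Complex.mem_slitPlane_of_norm_lt_one (by simpa using this)) hle
    refine (hd.cexp.differentiableAt (hso.mem_nhds hsm)).congr_of_eventuallyEq ?_
    filter_upwards [hso.mem_nhds hsm] with p hp
    exact (Complex.cexp_tsum_eq_tprod
      (fun n => one_sub_ne_zero_of_norm_lt (by linarith [hlt p hp n]))
      (Summable.of_norm_bounded hsum fun n => hle n p hp)).symm
  · intro _ y h
    have h1 : DifferentiableAt ℂ (fun p : ℂ × ℂ => (1 - p.2) * qPoch p.1 (p.2 * p.1)) (q, y) := by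
      refine DifferentiableAt.fun_mul (by fun_prop) ?_
      exact DifferentiableAt.comp (g := fun p : ℂ × ℂ => qPoch p.1 p.2)
        (f := fun p : ℂ × ℂ => (p.1, p.2 * p.1)) (q, y) h (by fun_prop)
    refine h1.congr_of_eventuallyEq ?_
    have : {p : ℂ × ℂ | ‖p.1‖ < 1} ∈ 𝓝 (q, y) :=
      (isOpen_lt (by fun_prop) (by fun_prop)).mem_nhds hq
    filter_upwards [this] with p hp
    exact qPoch_step hp p.2

/-! ### A Lambert series and its continuation -/

/-- These are the terms produced by iterating the functional equation `lambert_step`: the product of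
q * (u q^k) * (y q^k) over k < n is q^(n²) (u y)^n. The resulting series converges for all u, y,
with poles only where u or y lies in q^(-ℕ). -/
def lambertTerm (q u y : ℂ) (n : ℕ) : ℂ :=
  q ^ (n ^ 2) * (u * y) ^ n * (1 - u * y * q ^ (2 * n)) / ((1 - u * q ^ n) * (1 - y * q ^ n))

/-- The continuation of `∑_{m ≥ 0} u ^ m / (1 - y q ^ m)` to all `u`, `y`. -/
def lambert (q u y : ℂ) : ℂ := ∑' n, lambertTerm q u y n

theorem lambertTerm_succ (q u y : ℂ) (n : ℕ) :
    lambertTerm q u y (n + 1) = q * u * y * lambertTerm q (u * q) (y * q) n := by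
  simp only [lambertTerm]
  rw [← mul_div_assoc]
  congr 1 <;> ring

theorem norm_lambertTerm_le {q u y : ℂ} (hq : ‖q‖ < 1) (hu : ‖u‖ < 1 / 2) (hy : ‖y‖ < 1 / 2)
    (n : ℕ) : ‖lambertTerm q u y n‖ ≤ 8 * (1 / 4) ^ n := by
  have hu' := (half_lt_norm_one_sub (norm_mul_pow_lt_half hq hu n)).le
  have hy' := (half_lt_norm_one_sub (norm_mul_pow_lt_half hq hy n)).le
  have huy : ‖u * y‖ ≤ 1 / 4 := by
    rw [norm_mul]
    nlinarith [norm_nonneg u, norm_nonneg y]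
  have h1 : ‖q ^ (n ^ 2)‖ ≤ 1 := by
    rw [norm_pow]; exact pow_le_one₀ (norm_nonneg q) hq.le
  have h2 : ‖(u * y) ^ n‖ ≤ (1 / 4) ^ n := by
    rw [norm_pow]; exact pow_le_pow_left₀ (norm_nonneg _) huy n
  have h3 : ‖1 - u * y * q ^ (2 * n)‖ ≤ 2 := by
    refine (norm_sub_le _ _).trans ?_
    rw [norm_one, norm_mul, norm_pow]
    have := pow_le_one₀ (n := 2 * n) (norm_nonneg q) hq.le
    nlinarith [norm_nonneg (u * y), pow_nonneg (norm_nonneg q) (2 * n)]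
  rw [lambertTerm, norm_div, norm_mul, norm_mul, norm_mul (1 - u * q ^ n)]
  have h4 : (1 / 4 : ℝ) ≤ ‖1 - u * q ^ n‖ * ‖1 - y * q ^ n‖ := by nlinarith
  have h5 : ‖q ^ (n ^ 2)‖ * ‖(u * y) ^ n‖ * ‖1 - u * y * q ^ (2 * n)‖ ≤ 1 * (1 / 4) ^ n * 2 := by
    gcongr
  rw [div_le_iff₀ (by linarith)]
  have h6 : (0 : ℝ) < (1 / 4) ^ n := by positivity
  nlinarith

theorem summable_geometric_quarter : Summable fun n : ℕ => (8 : ℝ) * (1 / 4) ^ n :=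
  (summable_geometric_of_lt_one (by norm_num) (by norm_num)).mul_left 8

theorem summable_lambertTerm {q : ℂ} (hq : ‖q‖ < 1) (u y : ℂ) : Summable (lambertTerm q u y) := by
  refine shift_induction hq (p := fun u y => Summable (lambertTerm q u y)) ?_ ?_ u y
  · intro u y hu hy
    exact Summable.of_norm_bounded summable_geometric_quarter fun n => norm_lambertTerm_le hq hu hy n
  · intro u y h
    rw [← summable_nat_add_iff 1]
    simp only [lambertTerm_succ]
    exact h.mul_left _

theorem lambert_step {q : ℂ} (hq : ‖q‖ < 1) (u y : ℂ) :
    lambert q u y =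
      (1 - u * y) / ((1 - u) * (1 - y)) + q * u * y * lambert q (u * q) (y * q) := by
  rw [lambert, (summable_lambertTerm hq u y).tsum_eq_zero_add]
  simp only [lambertTerm_succ]
  rw [tsum_mul_left]
  simp [lambertTerm, lambert]

theorem differentiableAt_lambert {q u y : ℂ} (hq : ‖q‖ < 1) (hu : ∀ n : ℕ, u * q ^ n ≠ 1)
    (hy : ∀ n : ℕ, y * q ^ n ≠ 1) :
    DifferentiableAt ℂ (fun p : ℂ × ℂ × ℂ => lambert p.1 p.2.1 p.2.2) (q, u, y) := by
  refine shift_induction hq (p := fun u y => (∀ n : ℕ, u * q ^ n ≠ 1) → (∀ n : ℕ, y * q ^ n ≠ 1) →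
    DifferentiableAt ℂ (fun p : ℂ × ℂ × ℂ => lambert p.1 p.2.1 p.2.2) (q, u, y)) ?_ ?_ u y hu hy
  · intro u y hu hy _ _
    set s : Set (ℂ × ℂ × ℂ) := {p | ‖p.1‖ < 1 ∧ ‖p.2.1‖ < 1 / 2 ∧ ‖p.2.2‖ < 1 / 2} with hs
    have hso : IsOpen s := by
      simp only [hs, Set.ofPred_and]
      exact (isOpen_lt (by fun_prop) (by fun_prop)).inter
        ((isOpen_lt (by fun_prop) (by fun_prop)).inter (isOpen_lt (by fun_prop) (by fun_prop)))
    have hsm : (q, u, y) ∈ s := ⟨hq, hu, hy⟩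
    refine (differentiableOn_tsum_of_norm_le (F := fun n (p : ℂ × ℂ × ℂ) =>
      lambertTerm p.1 p.2.1 p.2.2 n) summable_geometric_quarter hso (fun n p hp => ?_)
      fun n p hp => norm_lambertTerm_le hp.1 hp.2.1 hp.2.2 n).differentiableAt (hso.mem_nhds hsm)
    refine DifferentiableAt.differentiableWithinAt (differentiableAt_fun_div (by fun_prop)
      (by fun_prop) (mul_ne_zero ?_ ?_))
    · exact one_sub_ne_zero_of_norm_lt (by linarith [norm_mul_pow_lt_half hp.1 hp.2.1 n])
    · exact one_sub_ne_zero_of_norm_lt (by linarith [norm_mul_pow_lt_half hp.1 hp.2.2 n])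
  · intro u y ih hu hy
    have h := ih (fun n => by rw [mul_assoc, ← pow_succ']; exact hu _)
      (fun n => by rw [mul_assoc, ← pow_succ']; exact hy _)
    have h1 : DifferentiableAt ℂ (fun p : ℂ × ℂ × ℂ =>
        (1 - p.2.1 * p.2.2) / ((1 - p.2.1) * (1 - p.2.2)) +
          p.1 * p.2.1 * p.2.2 * lambert p.1 (p.2.1 * p.1) (p.2.2 * p.1)) (q, u, y) := by
      refine DifferentiableAt.fun_add (differentiableAt_fun_div (by fun_prop) (by fun_prop) ?_)
        (DifferentiableAt.fun_mul (by fun_prop) ?_)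
      · refine mul_ne_zero ?_ ?_
        · rw [sub_ne_zero]; simpa using (hu 0).symm
        · rw [sub_ne_zero]; simpa using (hy 0).symm
      · exact DifferentiableAt.comp (g := fun p : ℂ × ℂ × ℂ => lambert p.1 p.2.1 p.2.2)
          (f := fun p : ℂ × ℂ × ℂ => (p.1, p.2.1 * p.1, p.2.2 * p.1)) (q, u, y) h (by fun_prop)
    refine h1.congr_of_eventuallyEq ?_
    have : {p : ℂ × ℂ × ℂ | ‖p.1‖ < 1} ∈ 𝓝 (q, u, y) :=
      (isOpen_lt (by fun_prop) (by fun_prop)).mem_nhds hq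
    filter_upwards [this] with p hp
    exact lambert_step hp p.2.1 p.2.2

/-- The original series obeys the functional equation of `lambert`: for m ≥ 1 one writes 1 / (1 - y
q^m) = 1 + y q^m / (1 - y q^m); the summands 1 give a geometric series, the remaining ones the
series at (u q, y q). -/
theorem hasSum_lambert_shift {q u y a : ℂ} (hu : ‖u‖ < 1) (hy : ∀ n : ℕ, y * q ^ n ≠ 1)
    (h : HasSum (fun m : ℕ => (u * q) ^ m / (1 - y * q * q ^ m)) a) :
    HasSum (fun m : ℕ => u ^ m / (1 - y * q ^ m))
      ((1 - u * y) / ((1 - u) * (1 - y)) + q * u * y * a) := by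
  have hu1 := one_sub_ne_zero_of_norm_lt hu
  have hy1 : 1 - y ≠ 0 := by rw [sub_ne_zero]; simpa using (hy 0).symm
  rw [← hasSum_nat_add_iff' 1]
  convert! (h.mul_left (q * u * y)).add ((hasSum_geometric_of_norm_lt_one hu).mul_left u) using 1
  · funext m
    have : 1 - y * q ^ (m + 1) ≠ 0 := by rw [sub_ne_zero]; exact (hy _).symm
    rw [show y * q * q ^ m = y * q ^ (m + 1) by ring]
    field_simp
    ring
  · simp only [Finset.range_one, Finset.sum_singleton, pow_zero, mul_one]
    field_simp
    ring

/-- Both sides satisfy the same functional equation. Their difference D is bounded for ‖u‖, ‖y‖ <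
1/2 and satisfies D(u, y) = q u y D(u q, y q) there, so iteration forces D = 0; the general case
follows by shifting. -/
theorem hasSum_lambert {q u y : ℂ} (hq : ‖q‖ < 1) (hu : ‖u‖ < 1) (hy : ∀ n : ℕ, y * q ^ n ≠ 1) :
    HasSum (fun m : ℕ => u ^ m / (1 - y * q ^ m)) (lambert q u y) := by
  refine shift_induction hq (p := fun u y => ‖u‖ < 1 → (∀ n : ℕ, y * q ^ n ≠ 1) →
    HasSum (fun m : ℕ => u ^ m / (1 - y * q ^ m)) (lambert q u y)) ?_ ?_ u y hu hy
  · have hne : ∀ y : ℂ, ‖y‖ < 1 / 2 → ∀ n : ℕ, y * q ^ n ≠ 1 := fun y hy n h => by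
      have := norm_mul_pow_lt_half hq hy n
      rw [h, norm_one] at this
      norm_num at this
    have hb : ∀ u y : ℂ, ‖u‖ < 1 / 2 → ‖y‖ < 1 / 2 → ∀ m : ℕ,
        ‖u ^ m / (1 - y * q ^ m)‖ ≤ 2 * (1 / 2) ^ m := by
      intro u y hu hy m
      have hy' := half_lt_norm_one_sub (norm_mul_pow_lt_half hq hy m)
      rw [norm_div, norm_pow, div_le_iff₀ (by linarith)]
      have := pow_le_pow_left₀ (norm_nonneg u) hu.le m
      have h6 : (0 : ℝ) < (1 / 2) ^ m := by positivity
      nlinarith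
    have hs2 : Summable fun m : ℕ => (2 : ℝ) * (1 / 2) ^ m :=
      (summable_geometric_of_lt_one (by norm_num) (by norm_num)).mul_left 2
    have hsum : ∀ u y : ℂ, ‖u‖ < 1 / 2 → ‖y‖ < 1 / 2 →
        Summable fun m : ℕ => u ^ m / (1 - y * q ^ m) := fun u y hu hy =>
      Summable.of_norm_bounded hs2 (hb u y hu hy)
    set D : ℂ → ℂ → ℂ := fun u y => (∑' m : ℕ, u ^ m / (1 - y * q ^ m)) - lambert q u y with hD
    have hsmall : ∀ u : ℂ, ‖u‖ < 1 / 2 → ‖u * q‖ < 1 / 2 := fun u hu => by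
      simpa using norm_mul_pow_lt_half hq hu 1
    have hDstep : ∀ u y : ℂ, ‖u‖ < 1 / 2 → ‖y‖ < 1 / 2 → D u y = q * u * y * D (u * q) (y * q) := by
      intro u y hu hy
      have := (hasSum_lambert_shift (by linarith) (hne y hy)
        (hsum (u * q) (y * q) (hsmall u hu) (hsmall y hy)).hasSum).tsum_eq
      simp only [hD]
      rw [this, lambert_step hq u y]
      ring
    have hDb : ∀ u y : ℂ, ‖u‖ < 1 / 2 → ‖y‖ < 1 / 2 →
        ‖D u y‖ ≤ (∑' m : ℕ, (2 : ℝ) * (1 / 2) ^ m) + ∑' m : ℕ, (8 : ℝ) * (1 / 4) ^ m := by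
      intro u y hu hy
      refine (norm_sub_le _ _).trans (add_le_add ?_ ?_)
      · exact tsum_of_norm_bounded hs2.hasSum (hb u y hu hy)
      · exact tsum_of_norm_bounded summable_geometric_quarter.hasSum
          fun n => norm_lambertTerm_le hq hu hy n
    set K : ℝ := (∑' m : ℕ, (2 : ℝ) * (1 / 2) ^ m) + ∑' m : ℕ, (8 : ℝ) * (1 / 4) ^ m
    have hDN : ∀ N : ℕ, ∀ u y : ℂ, ‖u‖ < 1 / 2 → ‖y‖ < 1 / 2 → ‖D u y‖ ≤ (1 / 2) ^ N * K := by
      intro N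
      induction N with
      | zero => simpa using hDb
      | succ N ih =>
        intro u y hu hy
        have h1 := ih _ _ (hsmall u hu) (hsmall y hy)
        rw [hDstep u y hu hy, norm_mul, norm_mul, norm_mul, pow_succ', mul_assoc (1 / 2 : ℝ)]
        refine mul_le_mul ?_ h1 (norm_nonneg _) (by norm_num)
        have h2 : ‖q‖ * ‖u‖ ≤ 1 * (1 / 2) := by gcongr
        nlinarith [norm_nonneg y, mul_nonneg (norm_nonneg q) (norm_nonneg u)]
    intro u y hu hy _ _
    have hD0 : D u y = 0 := by
      rw [← norm_le_zero_iff]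
      have ht : Tendsto (fun N : ℕ => (1 / 2 : ℝ) ^ N * K) atTop (𝓝 (0 * K)) :=
        (tendsto_pow_atTop_nhds_zero_of_lt_one (by norm_num) (by norm_num)).mul_const K
      rw [zero_mul] at ht
      exact ge_of_tendsto' ht fun N => hDN N u y hu hy
    rw [hD, sub_eq_zero] at hD0
    rw [← hD0]
    exact (hsum u y hu hy).hasSum
  · intro u y ih hu hy
    rw [lambert_step hq]
    refine hasSum_lambert_shift hu hy (ih ?_ fun n => ?_)
    · rw [norm_mul]; nlinarith [norm_nonneg u, norm_nonneg q]
    · rw [mul_assoc, ← pow_succ']; exact hy _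

/-- For ‖u‖ < 1 this is the termwise identity u^m (1 - y q^m) / (1 - y q^m) = u^m. The point is that
only ‖u * q‖ < 1 is required: `lambert_step` replaces the divergent series at u by one at u * q. -/
theorem lambert_sub_mul {q u y : ℂ} (hq : ‖q‖ < 1) (hu : ‖u * q‖ < 1) (hu1 : u ≠ 1)
    (hy : ∀ n : ℕ, y * q ^ n ≠ 1) :
    lambert q u y - y * lambert q (u * q) y = 1 / (1 - u) := by
  have h1 := hasSum_lambert (y := y * q) hq hu
    (fun n => by rw [mul_assoc, ← pow_succ']; exact hy _)
  have h2 := hasSum_lambert hq hu hy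
  rw [← hasSum_nat_add_iff' 1] at h2
  have h3 : HasSum (fun m : ℕ => (u * q) ^ (m + 1) / (1 - y * q ^ (m + 1)))
      (u * q * lambert q (u * q) (y * q)) := by
    convert! h1.mul_left (u * q) using 1
    funext m
    rw [show y * q * q ^ m = y * q ^ (m + 1) by ring]
    ring
  have h4 := h2.unique h3
  have hy1 : 1 - y ≠ 0 := by rw [sub_ne_zero]; simpa using (hy 0).symm
  have hu2 : 1 - u ≠ 0 := sub_ne_zero.2 hu1.symm
  simp at h4
  rw [lambert_step hq, show q * u * y * lambert q (u * q) (y * q) =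
    y * (u * q * lambert q (u * q) (y * q)) by ring, ← h4]
  field_simp
  ring

/-- The continuation of the bilateral series `∑_{m ∈ ℤ} v ^ m / (1 - y q ^ m)`. -/
def kronecker (q y v : ℂ) : ℂ := lambert q v y - q / (v * y) * lambert q (q / v) (q / y)

theorem mul_pow_ne_one_of_norm_lt {q y : ℂ} (hq : ‖q‖ < 1) (hy : ‖y‖ < 1) (n : ℕ) :
    y * q ^ n ≠ 1 := fun h => by
  have h1 : ‖y * q ^ n‖ = 1 := by rw [h, norm_one]
  rw [norm_mul, norm_pow] at h1
  have := pow_le_one₀ (n := n) (norm_nonneg q) hq.le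
  nlinarith [norm_nonneg y, pow_nonneg (norm_nonneg q) n]

theorem norm_div_lt_one {q y : ℂ} (h : ‖q‖ < ‖y‖) : ‖q / y‖ < 1 := by
  rw [norm_div, div_lt_one ((norm_nonneg q).trans_lt h)]
  exact h

theorem hasSum_kronecker {q y v : ℂ} (hq0 : q ≠ 0) (hqy : ‖q‖ < ‖y‖) (hy : ‖y‖ < 1)
    (hqv : ‖q‖ < ‖v‖) (hv : ‖v‖ < 1) :
    HasSum (fun m : ℤ => v ^ m / (1 - y * q ^ m)) (kronecker q y v) := by
  have hq := hqy.trans hy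
  have hy0 : y ≠ 0 := norm_pos_iff.1 ((norm_nonneg q).trans_lt hqy)
  have hv0 : v ≠ 0 := norm_pos_iff.1 ((norm_nonneg q).trans_lt hqv)
  have h1 := hasSum_lambert hq hv (mul_pow_ne_one_of_norm_lt hq hy)
  have h2 := (hasSum_lambert hq (norm_div_lt_one hqv)
    (mul_pow_ne_one_of_norm_lt hq (norm_div_lt_one hqy))).mul_left (-(q / (v * y)))
  -- The negative half of the bilateral series is again a Lambert series, since v^(-n-1) / (1 - y
  -- q^(-n-1)) = -(q / (v y)) (q / v)^n / (1 - (q / y) q^n).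
  have h3 := HasSum.of_nat_of_neg_add_one (f := fun m : ℤ => v ^ m / (1 - y * q ^ m))
    (by simpa using h1) (m' := -(q / (v * y)) * lambert q (q / v) (q / y)) (by
      convert! h2 using 1
      funext n
      have e1 : 1 - q / y * q ^ n ≠ 0 := by
        rw [sub_ne_zero]
        exact (mul_pow_ne_one_of_norm_lt hq (norm_div_lt_one hqy) n).symm
      have e2 : 1 - y * (q ^ (n + 1))⁻¹ ≠ 0 := by
        intro h
        apply e1
        field_simp at h ⊢
        linear_combination -h
      rw [show (-((n : ℤ) + 1)) = -((n + 1 : ℕ) : ℤ) by push_cast; ring, zpow_neg, zpow_neg,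
        zpow_natCast, zpow_natCast]
      rw [neg_mul, ← neg_div_neg_eq, div_eq_iff (neg_ne_zero.2 e2)]
      have e3 : -(1 - y * (q ^ (n + 1))⁻¹) = y * (q ^ (n + 1))⁻¹ * (1 - q / y * q ^ n) := by
        field_simp
        ring
      rw [e3]
      field_simp
      rw [div_pow]
      have e4 : y - q * q ^ n ≠ 0 := fun h => e1 (by field_simp; linear_combination h)
      field_simp
      ring)
  rw [kronecker, sub_eq_add_neg, ← neg_mul]
  exact h3

/-- Quasi-periodicity in v. It relates the annulus 1 < ‖v‖ < 1/‖q‖ to ‖q‖ < ‖v‖ < 1, where the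
bilateral series converges. The two geometric contributions 1 / (1 - v) coming from
`lambert_sub_mul` match up. -/
theorem kronecker_mul {q y v : ℂ} (hq0 : q ≠ 0) (hqy : ‖q‖ < ‖y‖) (hy : ‖y‖ < 1) (hv : 1 < ‖v‖)
    (hqv : ‖v * q‖ < 1) : y * kronecker q y (v * q) = kronecker q y v := by
  have hq := hqy.trans hy
  have hy0 : y ≠ 0 := norm_pos_iff.1 ((norm_nonneg q).trans_lt hqy)
  have hv0 : v ≠ 0 := norm_pos_iff.1 (by linarith)
  have h1 := lambert_sub_mul hq hqv (by rintro rfl; simp at hv) (mul_pow_ne_one_of_norm_lt hq hy)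
  have h2 := lambert_sub_mul (u := 1 / v) hq (by
      rw [norm_mul, norm_div, norm_one]
      have : 1 / ‖v‖ < 1 := by rw [div_lt_one (by linarith)]; exact hv
      have h' : 0 ≤ 1 / ‖v‖ := by positivity
      nlinarith [norm_nonneg q]) (by
      intro h
      have : v = 1 := by field_simp at h; exact h.symm
      simp [this] at hv) (mul_pow_ne_one_of_norm_lt hq (norm_div_lt_one hqy))
  have e1 : q / (v * q) = 1 / v := by field_simp
  have e2 : (1 / v) * q = q / v := by ring
  rw [e2] at h2
  have hv1 : 1 - v ≠ 0 := sub_ne_zero.2 (by rintro rfl; simp at hv)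
  have hv2 : 1 - 1 / v ≠ 0 := by
    intro h
    apply hv1
    field_simp at h
    linear_combination -h
  have h3 : lambert q (1 / v) (q / y) = 1 / (1 - 1 / v) + q / y * lambert q (q / v) (q / y) := by
    rw [← h2]; ring
  have h4 : lambert q v y = 1 / (1 - v) + y * lambert q (v * q) y := by rw [← h1]; ring
  rw [kronecker, kronecker, e1, h3, h4]
  have e5 : 1 / (1 - 1 / v) = -v / (1 - v) := by
    rw [div_eq_div_iff hv2 hv1]; field_simp; ring
  rw [e5]
  field_simp
  ring

/-- The second Laurent expansion of the same function. Its coefficients differ from those of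
`hasSum_kronecker` by 1, which reflects the commutator of β and γ and the pole at v = 1. -/
theorem hasSum_kronecker' {q y v : ℂ} (hq0 : q ≠ 0) (hqy : ‖q‖ < ‖y‖) (hy : ‖y‖ < 1)
    (hv : 1 < ‖v‖) (hqv : ‖v * q‖ < 1) :
    HasSum (fun m : ℤ => v ^ m * (y * q ^ m / (1 - y * q ^ m))) (kronecker q y v) := by
  have hqq : ‖q‖ < ‖v * q‖ := by
    rw [norm_mul]; nlinarith [norm_pos_iff.2 hq0]
  rw [← kronecker_mul hq0 hqy hy hv hqv]
  convert! (hasSum_kronecker hq0 hqy hy hqq hqv).mul_left y using 1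
  funext m
  rw [mul_zpow]
  ring

theorem differentiableAt_kronecker {q y v : ℂ} (hq0 : q ≠ 0) (hq : ‖q‖ < 1) (hy0 : y ≠ 0)
    (hv0 : v ≠ 0) (hy : ∀ k : ℤ, y ≠ q ^ k) (hv : ∀ k : ℤ, v ≠ q ^ k) :
    DifferentiableAt ℂ (fun p : ℂ × ℂ × ℂ => kronecker p.1 p.2.1 p.2.2) (q, y, v) := by
  have a1 : ∀ w : ℂ, (∀ k : ℤ, w ≠ q ^ k) → ∀ n : ℕ, w * q ^ n ≠ 1 := fun w hw n h => by
    apply hw (-n)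
    rw [zpow_neg, zpow_natCast, eq_inv_of_mul_eq_one_left h]
  have a2 : ∀ w : ℂ, w ≠ 0 → (∀ k : ℤ, w ≠ q ^ k) → ∀ n : ℕ, q / w * q ^ n ≠ 1 := fun w h0 hw n h => by
    apply hw (n + 1)
    rw [zpow_add_one₀ hq0, zpow_natCast]
    field_simp at h
    rw [← h, mul_comm]
  refine DifferentiableAt.fun_sub ?_ (DifferentiableAt.fun_mul ?_ ?_)
  · exact DifferentiableAt.comp (g := fun p : ℂ × ℂ × ℂ => lambert p.1 p.2.1 p.2.2)
      (f := fun p : ℂ × ℂ × ℂ => (p.1, p.2.2, p.2.1)) (q, y, v)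
      (differentiableAt_lambert hq (a1 v hv) (a1 y hy))
      (DifferentiableAt.prodMk (by fun_prop) (DifferentiableAt.prodMk (by fun_prop) (by fun_prop)))
  · exact differentiableAt_fun_div (by fun_prop) (by fun_prop) (mul_ne_zero hv0 hy0)
  · exact DifferentiableAt.comp (g := fun p : ℂ × ℂ × ℂ => lambert p.1 p.2.1 p.2.2)
      (f := fun p : ℂ × ℂ × ℂ => (p.1, p.1 / p.2.2, p.1 / p.2.1)) (q, y, v)
      (differentiableAt_lambert hq (a2 v hv0 hv) (a2 y hy0 hy))
      (DifferentiableAt.prodMk (by fun_prop) (DifferentiableAt.prodMk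
        (differentiableAt_fun_div (by fun_prop) (by fun_prop) hv0)
        (differentiableAt_fun_div (by fun_prop) (by fun_prop) hy0)))

end GhostSystem

namespace GhostSystem
open MvPolynomial

/-! ### Locally finite families of operators -/

section Modes

variable {ι : Type*}

/-- On every vector, only finitely many members of the family are nonzero. -/
def LocFin {κ : Type*} (A : κ → Module.End ℂ (Fock ι)) : Prop :=
  ∀ v, {k | A k v ≠ 0}.Finite

theorem LocFin.exists_finset {κ : Type*} {A : κ → Module.End ℂ (Fock ι)} (hA : LocFin A)
    (v : Fock ι) : ∃ s : Finset κ, ∀ k ∉ s, A k v = 0 :=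
  ⟨(hA v).toFinset, fun k hk => by simpa using hk⟩

theorem finsum_eq_sum_of_zero {κ M : Type*} [AddCommMonoid M] {f : κ → M} {s : Finset κ}
    (h : ∀ k ∉ s, f k = 0) : ∑ᶠ k, f k = ∑ k ∈ s, f k :=
  finsum_eq_sum_of_support_subset f fun k hk => by
    by_contra h'
    exact hk (h k h')

/-- `modeSum` is defined by its values on monomials; local finiteness makes the pointwise sum
linear, so the same formula holds on every vector. -/
theorem modeSum_apply {A : ℤ → Module.End ℂ (Fock ι)} (hA : LocFin A) (v : Fock ι) :
    modeSum A v = ∑ᶠ k, A k v := by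
  classical
  let S : Module.End ℂ (Fock ι) :=
    { toFun := fun v => ∑ᶠ k, A k v
      map_add' := fun v w => by
        obtain ⟨s, hs⟩ := hA.exists_finset v
        obtain ⟨t, ht⟩ := hA.exists_finset w
        rw [finsum_eq_sum_of_zero (s := s ∪ t) (f := fun k => A k v) fun k hk => hs k (by grind),
          finsum_eq_sum_of_zero (s := s ∪ t) (f := fun k => A k w) fun k hk => ht k (by grind),
          finsum_eq_sum_of_zero (s := s ∪ t) (f := fun k => A k (v + w)) fun k hk => by
            rw [map_add, hs k (by grind), ht k (by grind), add_zero],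
          ← Finset.sum_add_distrib]
        simp
      map_smul' := fun c v => by
        simp only [map_smul, RingHom.id_apply]
        rw [smul_finsum] }
  have h : modeSum A = S := by
    refine (basisMonomials (ι × ℤ) ℂ).ext fun d => ?_
    rw [modeSum, Module.Basis.constr_basis]
    simp [S, basisVec]
  rw [h]
  rfl

theorem modeSum_apply_eq_sum {A : ℤ → Module.End ℂ (Fock ι)} (hA : LocFin A) {v : Fock ι}
    {s : Finset ℤ} (h : ∀ k ∉ s, A k v = 0) : modeSum A v = ∑ k ∈ s, A k v := by
  rw [modeSum_apply hA, finsum_eq_sum_of_zero h]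

theorem commute_modeSum {A : ℤ → Module.End ℂ (Fock ι)} {T : Module.End ℂ (Fock ι)}
    (hA : LocFin A) (h : ∀ k, Commute T (A k)) : Commute T (modeSum A) := by
  refine LinearMap.ext fun v => ?_
  have h' : ∀ k v, T (A k v) = A k (T v) := fun k v => LinearMap.congr_fun (h k) v
  obtain ⟨s, hs⟩ := hA.exists_finset v
  rw [Module.End.mul_apply, Module.End.mul_apply, modeSum_apply_eq_sum hA hs,
    modeSum_apply_eq_sum hA (s := s) fun k hk => by rw [← h', hs k hk, map_zero], map_sum]
  exact Finset.sum_congr rfl fun k _ => h' k v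

/-! ### The ghost modes with a sign -/

/-- `γ^α[m]` with the sign of the annihilation operators replaced by `ε`: for `ε = -1` this is
`γ^α[m]`, for `ε = 1` it has nonnegative matrix elements. -/
def signedGamma (ε : ℂ) (α : ι) (m : ℤ) : Module.End ℂ (Fock ι) :=
  if m ≤ 0 then LinearMap.mulLeft ℂ (X (α, -m)) else ε • (pderiv (α, -m)).toLinearMap

theorem signedGamma_neg_one (α : ι) (m : ℤ) : signedGamma (-1) α m = gammaMode α m := by
  rw [signedGamma, gammaMode]
  split_ifs
  · rfl
  · exact LinearMap.ext fun v => by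
      rw [LinearMap.smul_apply, LinearMap.neg_apply]; exact neg_one_smul ℂ _

theorem pderiv_comm (i j : ι × ℤ) (v : Fock ι) :
    pderiv i (pderiv j v) = pderiv j (pderiv i v) := by
  classical
  have hc : ⁅pderiv (R := ℂ) i, pderiv (R := ℂ) j⁆ = 0 := by
    refine MvPolynomial.derivation_ext fun k => ?_
    simp [Derivation.commutator_apply, pderiv_X, Pi.single_apply, apply_ite]
  have hv := DFunLike.congr_fun hc v
  simpa [Derivation.commutator_apply, sub_eq_zero] using hv

theorem commute_signedGamma (ε : ℂ) (a b : ι) (m n : ℤ) :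
    Commute (signedGamma ε a m) (signedGamma ε b n) := by
  classical
  refine LinearMap.ext fun v => ?_
  by_cases hm : m ≤ 0 <;> by_cases hn : n ≤ 0
  · simp [signedGamma, hm, hn, mul_left_comm]
  · have : (a, -m) ≠ (b, -n) := fun h => by
      have := (Prod.mk.inj h).2; omega
    simp [signedGamma, hm, hn, pderiv_X_of_ne this]
  · have : (b, -n) ≠ (a, -m) := fun h => by
      have := (Prod.mk.inj h).2; omega
    simp [signedGamma, hm, hn, pderiv_X_of_ne this]
  · simp [signedGamma, hm, hn, pderiv_comm (a, -m)]

theorem exists_pderiv_eq_zero (v : Fock ι) :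
    ∃ N : ℤ, ∀ (a : ι) (k : ℤ), N < |k| → pderiv (a, k) v = 0 := by
  refine ⟨∑ p ∈ v.vars, |p.2|, fun a k hk => pderiv_eq_zero_of_notMem_vars fun h => ?_⟩
  exact absurd (Finset.single_le_sum (f := fun p : ι × ℤ => |p.2|) (fun _ _ => abs_nonneg _) h)
    (not_le.2 hk)

theorem exists_signedGamma_eq_zero (ε : ℂ) (v : Fock ι) :
    ∃ N : ℤ, ∀ (a : ι) (k : ℤ), N < k → signedGamma ε a k v = 0 := by
  obtain ⟨N, hN⟩ := exists_pderiv_eq_zero v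
  refine ⟨max N 0, fun a k hk => ?_⟩
  have h1 : ¬ k ≤ 0 := not_le.2 ((le_max_right _ _).trans_lt hk)
  have h2 := hN a (-k) (by rw [abs_neg]; exact (le_max_left _ _).trans_lt (hk.trans_le (le_abs_self k)))
  simp [signedGamma, h1, h2]

/-- The sign in the commutator of `β_b[m]` with `signedGamma`. -/
def modeSign (ε : ℂ) (m : ℤ) : ℂ := if 0 ≤ m then 1 else -ε

open Classical in
theorem betaMode_signedGamma (ε : ℂ) (b a : ι) (m k : ℤ) (v : Fock ι) :
    betaMode b m (signedGamma ε a k v) = signedGamma ε a k (betaMode b m v) +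
      (if b = a ∧ k = -m then modeSign ε m else 0) • v := by
  by_cases hm : m < 0 <;> by_cases hk : k ≤ 0
  · have : ¬ (b = a ∧ k = -m) := fun h => by omega
    simp [betaMode, signedGamma, hm, hk, this, mul_left_comm]
  · by_cases h : b = a ∧ k = -m
    · obtain ⟨rfl, rfl⟩ := h
      have hm' : ¬ (0 ≤ m) := by omega
      have hm'' : 0 < -m := by omega
      simp [betaMode, signedGamma, hm, modeSign, hm']
    · have h' : (b, m) ≠ (a, -k) := fun h' => h (by
        have := Prod.mk.inj h'
        exact ⟨this.1, by omega⟩)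
      simp [betaMode, signedGamma, hm, hk, h, pderiv_X_of_ne h']
  · have hm' : 0 ≤ m := by omega
    by_cases h : b = a ∧ k = -m
    · obtain ⟨rfl, rfl⟩ := h
      simp [betaMode, signedGamma, hm, hk, modeSign, hm']
    · have h' : (a, -k) ≠ (b, m) := fun h' => h (by
        have := Prod.mk.inj h'
        exact ⟨this.1.symm, by omega⟩)
      simp [betaMode, signedGamma, hm, hk, h, pderiv_X_of_ne h']
  · have : ¬ (b = a ∧ k = -m) := fun h => by omega
    simp [betaMode, signedGamma, hm, hk, this, pderiv_comm (b, m)]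

/-! ### Products of ghost fields -/

/-- The modes of a product of the fields `signedGamma ε`. -/
def gammaProd (ε : ℂ) : List ι → ℤ → Module.End ℂ (Fock ι)
  | [], n => if n = 0 then 1 else 0
  | a :: l, n => modeSum fun k => signedGamma ε a k * gammaProd ε l (n - k)

theorem gammaProd_neg_one (l : List ι) (n : ℤ) : gammaProd (-1) l n = gammaProdMode l n := by
  induction l generalizing n with
  | nil => rfl
  | cons a l ih => simp only [gammaProd, gammaProdMode, signedGamma_neg_one, ih]

/-- A sequence of operators that behaves like the modes of a field generated by the `γ`. -/
structure IsGammaField (ε : ℂ) (B : ℤ → Module.End ℂ (Fock ι)) : Prop where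
  commute : ∀ a k n, Commute (signedGamma ε a k) (B n)
  bounded : ∀ v, ∃ N : ℤ, ∀ n, N < n → B n v = 0

/-- Since the γ mode commutes with B n, both indices are bounded above by constants depending on v
only. In a convolution with k + n fixed this leaves finitely many terms. -/
theorem IsGammaField.exists_bounds {ε : ℂ} {B : ℤ → Module.End ℂ (Fock ι)} (hB : IsGammaField ε B)
    (v : Fock ι) : ∃ M N : ℤ, ∀ a k n, signedGamma ε a k (B n v) ≠ 0 → k ≤ M ∧ n ≤ N := by
  obtain ⟨N, hN⟩ := hB.bounded v
  obtain ⟨M, hM⟩ := exists_signedGamma_eq_zero ε v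
  refine ⟨M, N, fun a k n h => ⟨?_, ?_⟩⟩
  · by_contra! h'
    refine h ?_
    have := LinearMap.congr_fun (hB.commute a k n) v
    rw [Module.End.mul_apply, Module.End.mul_apply] at this
    rw [this, hM a k h', map_zero]
  · by_contra! h'
    exact h (by rw [hN n h', map_zero])

theorem IsGammaField.locFin {ε : ℂ} {B : ℤ → Module.End ℂ (Fock ι)} (hB : IsGammaField ε B)
    (a : ι) (n : ℤ) : LocFin fun k => signedGamma ε a k * B (n - k) := by
  intro v
  obtain ⟨M, N, h⟩ := hB.exists_bounds v
  refine (Set.finite_Icc (n - N) M).subset fun k hk => ?_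
  have := h a k (n - k) hk
  constructor <;> linarith

theorem IsGammaField.cons {ε : ℂ} {B : ℤ → Module.End ℂ (Fock ι)} (hB : IsGammaField ε B) (a : ι) :
    IsGammaField ε fun n => modeSum fun k => signedGamma ε a k * B (n - k) where
  commute b j n := commute_modeSum (hB.locFin a n) fun k =>
    (commute_signedGamma ε b a j k).mul_right (hB.commute b j (n - k))
  bounded v := by
    obtain ⟨M, N, h⟩ := hB.exists_bounds v
    refine ⟨M + N, fun n hn => ?_⟩
    rw [modeSum_apply_eq_sum (hB.locFin a n) (s := ∅)]
    · simp
    · intro k _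
      by_contra h'
      have := h a k (n - k) h'
      linarith [this.1, this.2]

theorem isGammaField_gammaProd (ε : ℂ) (l : List ι) : IsGammaField ε (gammaProd ε l) := by
  induction l with
  | nil =>
    refine ⟨fun a k n => ?_, fun v => ⟨0, fun n hn => ?_⟩⟩
    · simp only [gammaProd]
      split_ifs
      exacts [Commute.one_right _, Commute.zero_right _]
    · simp [gammaProd, hn.ne']
  | cons a l ih => exact ih.cons a

/-- The convolution is a double sum which, on a given vector, is supported in a finite box: each
index is bounded above after commuting its mode to the right, hence also below. The two sums may
then be exchanged. -/
theorem gammaProd_swap (ε : ℂ) (a b : ι) (l : List ι) (n : ℤ) :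
    gammaProd ε (a :: b :: l) n = gammaProd ε (b :: a :: l) n := by
  have hl := isGammaField_gammaProd ε l
  refine LinearMap.ext fun v => ?_
  obtain ⟨Ma, hMa⟩ := exists_signedGamma_eq_zero ε v
  obtain ⟨N, hN⟩ := hl.bounded v
  have key : ∀ a b : ι, ∀ k j, signedGamma ε a k (signedGamma ε b j (gammaProd ε l (n - k - j) v)) ≠ 0 →
      k ∈ Finset.Icc (n - N - Ma) Ma ∧ j ∈ Finset.Icc (n - N - Ma) Ma := by
    intro a b k j h
    have c1 := LinearMap.congr_fun (hl.commute b j (n - k - j)) v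
    have c2 := LinearMap.congr_fun (hl.commute a k (n - k - j)) v
    have c3 := fun w => LinearMap.congr_fun (commute_signedGamma ε a b k j) w
    simp only [Module.End.mul_apply] at c1 c2 c3
    have h1 : k ≤ Ma := by
      by_contra! h'
      rw [c3, c2, hMa a k h', map_zero, map_zero] at h
      exact h rfl
    have h2 : j ≤ Ma := by
      by_contra! h'
      rw [c1, hMa b j h', map_zero, map_zero] at h
      exact h rfl
    have h3 : n - k - j ≤ N := by
      by_contra! h'
      rw [hN _ h', map_zero, map_zero] at h
      exact h rfl
    simp only [Finset.mem_Icc]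
    omega
  have expand : ∀ a b : ι, gammaProd ε (a :: b :: l) n v =
      ∑ k ∈ Finset.Icc (n - N - Ma) Ma, ∑ j ∈ Finset.Icc (n - N - Ma) Ma,
        signedGamma ε a k (signedGamma ε b j (gammaProd ε l (n - k - j) v)) := by
    intro a b
    have inner : ∀ k, signedGamma ε a k (gammaProd ε (b :: l) (n - k) v) =
        ∑ j ∈ Finset.Icc (n - N - Ma) Ma,
          signedGamma ε a k (signedGamma ε b j (gammaProd ε l (n - k - j) v)) := by
      intro k
      rw [gammaProd, modeSum_apply (hl.locFin b (n - k))]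
      obtain ⟨s, hs⟩ := (hl.locFin b (n - k)).exists_finset v
      rw [finsum_eq_sum_of_zero (s := s ∪ Finset.Icc (n - N - Ma) Ma)
        fun j hj => hs j (fun h => hj (Finset.mem_union_left _ h)), map_sum]
      symm
      refine Finset.sum_subset Finset.subset_union_right fun j _ hj => ?_
      by_contra h
      exact hj (key a b k j h).2
    rw [gammaProd, modeSum_apply_eq_sum ((isGammaField_gammaProd ε (b :: l)).locFin a n)
      (s := Finset.Icc (n - N - Ma) Ma)]
    · exact Finset.sum_congr rfl fun k _ => inner k
    · intro k hk
      rw [Module.End.mul_apply, inner]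
      refine Finset.sum_eq_zero fun j _ => ?_
      by_contra h
      exact hk (key a b k j h).1
  rw [expand a b, expand b a, Finset.sum_comm]
  refine Finset.sum_congr rfl fun k _ => Finset.sum_congr rfl fun j _ => ?_
  rw [show n - j - k = n - k - j by ring]
  exact LinearMap.congr_fun (commute_signedGamma ε a b j k) _

theorem gammaProd_perm (ε : ℂ) {l l' : List ι} (h : l.Perm l') (n : ℤ) :
    gammaProd ε l n = gammaProd ε l' n := by
  induction h generalizing n with
  | nil => rfl
  | cons a _ ih => simp only [gammaProd, ih]
  | swap a b l => exact gammaProd_swap ε b a l n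
  | trans _ _ ih1 ih2 => rw [ih1, ih2]

/-! ### Polynomials in the ghost fields -/

/-- The modes of `P` evaluated on the fields `signedGamma ε`. -/
def polyOp (ε : ℂ) (P : MvPolynomial ι ℂ) (n : ℤ) : Module.End ℂ (Fock ι) :=
  ∑ e ∈ P.support, P.coeff e • gammaProd ε (Finsupp.toMultiset e).toList n

theorem polyOp_neg_one (P : MvPolynomial ι ℂ) (n : ℤ) : polyOp (-1) P n = polyMode P n := by
  simp only [polyOp, polyMode, gammaProd_neg_one]

theorem polyOp_eq_sum (ε : ℂ) {P : MvPolynomial ι ℂ} {s : Finset (ι →₀ ℕ)} (h : P.support ⊆ s)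
    (n : ℤ) : polyOp ε P n = ∑ e ∈ s, P.coeff e • gammaProd ε (Finsupp.toMultiset e).toList n :=
  Finset.sum_subset h fun e _ he => by rw [notMem_support_iff.1 he, zero_smul]

theorem polyOp_add (ε : ℂ) (P Q : MvPolynomial ι ℂ) (n : ℤ) :
    polyOp ε (P + Q) n = polyOp ε P n + polyOp ε Q n := by
  classical
  rw [polyOp_eq_sum ε (support_add (p := P) (q := Q)),
    polyOp_eq_sum ε (Finset.subset_union_left (s₁ := P.support) (s₂ := Q.support)),
    polyOp_eq_sum ε (Finset.subset_union_right (s₁ := P.support) (s₂ := Q.support)),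
    ← Finset.sum_add_distrib]
  simp only [coeff_add, add_smul]

theorem polyOp_monomial (ε : ℂ) (e : ι →₀ ℕ) (c : ℂ) (n : ℤ) :
    polyOp ε (monomial e c) n = c • gammaProd ε (Finsupp.toMultiset e).toList n := by
  classical
  rw [polyOp_eq_sum ε (support_monomial_subset (s := e) (a := c)), Finset.sum_singleton,
    coeff_monomial, if_pos rfl]

theorem polyOp_C (ε : ℂ) (c : ℂ) (n : ℤ) :
    polyOp ε (C c : MvPolynomial ι ℂ) n = if n = 0 then c • 1 else 0 := by
  rw [C_apply, polyOp_monomial]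
  simp only [map_zero, Multiset.toList_zero, gammaProd]
  split_ifs <;> simp

theorem polyOp_zero (ε : ℂ) (n : ℤ) : polyOp ε (0 : MvPolynomial ι ℂ) n = 0 := by
  simp [polyOp]

theorem isGammaField_polyOp (ε : ℂ) (P : MvPolynomial ι ℂ) : IsGammaField ε (polyOp ε P) where
  commute a k n := Commute.sum_right _ _ _ fun e _ =>
    ((isGammaField_gammaProd ε _).commute a k n).smul_right _
  bounded v := by
    choose N hN using fun e : ι →₀ ℕ =>
      (isGammaField_gammaProd ε (Finsupp.toMultiset e).toList).bounded v
    refine ⟨∑ e ∈ P.support, |N e|, fun n hn => ?_⟩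
    rw [polyOp, LinearMap.sum_apply]
    refine Finset.sum_eq_zero fun e he => ?_
    rw [LinearMap.smul_apply, hN e n, smul_zero]
    exact ((le_abs_self _).trans (Finset.single_le_sum (f := fun e => |N e|)
      (fun _ _ => abs_nonneg _) he)).trans_lt hn

/-- The list of factors of a monomial is chosen arbitrarily, so invariance under permutations is
what makes this recursion available; it permits induction on P. -/
theorem polyOp_mul_X (ε : ℂ) (P : MvPolynomial ι ℂ) (a : ι) (n : ℤ) :
    polyOp ε (P * X a) n = modeSum fun k => signedGamma ε a k * polyOp ε P (n - k) := by
  classical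
  induction P using MvPolynomial.induction_on' generalizing n with
  | monomial e c =>
    have hp : (Finsupp.toMultiset (e + Finsupp.single a 1)).toList.Perm
        (a :: (Finsupp.toMultiset e).toList) := by
      rw [← Multiset.coe_eq_coe, Multiset.coe_toList, ← Multiset.cons_coe, Multiset.coe_toList]
      simp [← Multiset.singleton_add, add_comm]
    have h1 : monomial e c * X a = monomial (e + Finsupp.single a 1) c := by
      rw [X, monomial_mul, mul_one]
    rw [h1, polyOp_monomial, gammaProd_perm ε hp, gammaProd]
    refine LinearMap.ext fun v => ?_
    rw [LinearMap.smul_apply, modeSum_apply ((isGammaField_gammaProd ε _).locFin a n),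
      modeSum_apply ((isGammaField_polyOp ε _).locFin a n), smul_finsum]
    simp [polyOp_monomial]
  | add P Q hP hQ =>
    rw [add_mul, polyOp_add, hP, hQ]
    refine LinearMap.ext fun v => ?_
    obtain ⟨s, hs⟩ := ((isGammaField_polyOp ε P).locFin a n).exists_finset v
    obtain ⟨t, ht⟩ := ((isGammaField_polyOp ε Q).locFin a n).exists_finset v
    rw [LinearMap.add_apply, modeSum_apply_eq_sum ((isGammaField_polyOp ε P).locFin a n)
      (s := s ∪ t) fun k hk => hs k (by grind),
      modeSum_apply_eq_sum ((isGammaField_polyOp ε Q).locFin a n) (s := s ∪ t)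
      fun k hk => ht k (by grind), modeSum_apply_eq_sum ((isGammaField_polyOp ε (P + Q)).locFin a n)
      (s := s ∪ t), ← Finset.sum_add_distrib]
    · simp [polyOp_add]
    · intro k hk
      have h1 := hs k (by grind)
      have h2 := ht k (by grind)
      simp only [Module.End.mul_apply] at h1 h2
      simp [polyOp_add, h1, h2]

/-- The adjoint action of β_b[m] on polynomials in the γ is the derivation ∂_b with a shift of the
mode by m. For ε = 1 the sign depends on whether β_b[m] creates or annihilates. -/
theorem betaMode_polyOp (ε : ℂ) (b : ι) (m : ℤ) (P : MvPolynomial ι ℂ) (n : ℤ) (v : Fock ι) :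
    betaMode b m (polyOp ε P n v) =
      polyOp ε P n (betaMode b m v) + modeSign ε m • polyOp ε (pderiv b P) (n + m) v := by
  classical
  induction P using MvPolynomial.induction_on generalizing n v with
  | C c =>
    rw [polyOp_C, pderiv_C, polyOp_zero]
    split_ifs <;> simp
  | add P Q hP hQ =>
    simp only [polyOp_add, map_add, LinearMap.add_apply, hP, hQ, smul_add]
    abel
  | mul_X P a ih =>
    have hP := (isGammaField_polyOp ε P).locFin a
    have hP' := (isGammaField_polyOp ε (pderiv b P)).locFin a
    obtain ⟨s1, hs1⟩ := (hP n).exists_finset v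
    obtain ⟨s2, hs2⟩ := (hP n).exists_finset (betaMode b m v)
    obtain ⟨s3, hs3⟩ := (hP' (n + m)).exists_finset v
    set s := s1 ∪ s2 ∪ s3 ∪ {-m} with hs
    have hd : pderiv b (P * X a) = pderiv b P * X a + if b = a then P else 0 := by
      rw [Derivation.leibniz, pderiv_X]
      by_cases h : b = a
      · subst h; simp; ring
      · simp [h, Ne.symm h]; ring
    have h0 : polyOp ε (if b = a then P else 0) (n + m) =
        if b = a then polyOp ε P (n + m) else 0 := by
      split_ifs <;> simp [polyOp_zero]
    rw [hd, polyOp_add, h0, polyOp_mul_X, polyOp_mul_X,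
      modeSum_apply_eq_sum (s := s) (hP n) fun k hk => hs1 k (by grind),
      modeSum_apply_eq_sum (s := s) (hP n) fun k hk => hs2 k (by grind), LinearMap.add_apply,
      modeSum_apply_eq_sum (s := s) (hP' _) fun k hk => hs3 k (by grind), map_sum]
    have h1 : ∀ k ∈ s, betaMode b m ((signedGamma ε a k * polyOp ε P (n - k)) v) =
        (signedGamma ε a k * polyOp ε P (n - k)) (betaMode b m v) +
        modeSign ε m • (signedGamma ε a k * polyOp ε (pderiv b P) (n + m - k)) v +
        if k = -m then (if b = a then modeSign ε m • polyOp ε P (n + m) v else 0) else 0 := by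
      intro k _
      rw [Module.End.mul_apply, betaMode_signedGamma, ih, map_add, map_smul, Module.End.mul_apply,
        Module.End.mul_apply, show n - k + m = n + m - k by ring]
      congr 1
      by_cases h : b = a
      · by_cases hk : k = -m
        · subst hk; simp [h]
        · simp [hk]
      · simp [h]
    rw [Finset.sum_congr rfl h1, Finset.sum_add_distrib, Finset.sum_add_distrib, ← Finset.smul_sum,
      Finset.sum_ite_eq', if_pos (by grind), smul_add, add_assoc]
    congr 2
    split_ifs <;> simp

/-! ### Domination by operators with nonnegative matrix elements -/

/-- The matrix elements of `A` are bounded by those of `B`, which are nonnegative. -/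
def Dominated (A B : Module.End ℂ (Fock ι)) : Prop :=
  ∀ d d', ∃ r : ℝ, coeff d' (B (basisVec d)) = r ∧ ‖coeff d' (A (basisVec d))‖ ≤ r

theorem eq_sum_basisVec {v : Fock ι} {s : Finset (ι × ℤ →₀ ℕ)} (h : v.support ⊆ s) :
    v = ∑ d ∈ s, coeff d v • basisVec d := by
  conv_lhs => rw [v.as_sum]
  rw [Finset.sum_subset h fun d _ hd => by rw [notMem_support_iff.1 hd, monomial_zero]]
  simp [basisVec, smul_monomial]

theorem coeff_basisVec (d d' : ι × ℤ →₀ ℕ) [Decidable (d = d')] :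
    coeff d' (basisVec d : Fock ι) = if d = d' then 1 else 0 := by
  classical
  rw [basisVec, coeff_monomial]
  congr

theorem coeff_mul_basisVec {s : Finset (ι × ℤ →₀ ℕ)} {A B : Module.End ℂ (Fock ι)}
    {d : ι × ℤ →₀ ℕ} (h : (B (basisVec d)).support ⊆ s) (d' : ι × ℤ →₀ ℕ) :
    coeff d' ((A * B) (basisVec d)) =
      ∑ c ∈ s, coeff c (B (basisVec d)) * coeff d' (A (basisVec c)) := by
  rw [Module.End.mul_apply, eq_sum_basisVec h, map_sum, coeff_sum]
  simp [← eq_sum_basisVec h]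

theorem Dominated.mul {A A' B B' : Module.End ℂ (Fock ι)} (hA : Dominated A A')
    (hB : Dominated B B') : Dominated (A * B) (A' * B') := by
  classical
  intro d d'
  choose f hf hf' using hB d
  choose g hg hg' using fun c => hA c d'
  set s := (B (basisVec d)).support ∪ (B' (basisVec d)).support
  refine ⟨∑ c ∈ s, f c * g c, ?_, ?_⟩
  · rw [coeff_mul_basisVec (s := s) Finset.subset_union_right]
    push_cast
    simp only [hf, hg]
  · rw [coeff_mul_basisVec (s := s) Finset.subset_union_left]
    refine (norm_sum_le _ _).trans (Finset.sum_le_sum fun c _ => ?_)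
    rw [norm_mul]
    exact mul_le_mul (hf' c) (hg' c) (norm_nonneg _) ((norm_nonneg _).trans (hf' c))

theorem Dominated.sum {κ : Type*} {s : Finset κ} {A B : κ → Module.End ℂ (Fock ι)}
    (h : ∀ k ∈ s, Dominated (A k) (B k)) : Dominated (∑ k ∈ s, A k) (∑ k ∈ s, B k) := by
  intro d d'
  have h' : ∀ k, ∃ r : ℝ, k ∈ s → coeff d' (B k (basisVec d)) = r ∧
      ‖coeff d' (A k (basisVec d))‖ ≤ r := fun k => by
    by_cases hk : k ∈ s
    · obtain ⟨r, hr⟩ := h k hk d d'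
      exact ⟨r, fun _ => hr⟩
    · exact ⟨0, fun h => absurd h hk⟩
  choose f hf using h'
  refine ⟨∑ k ∈ s, f k, ?_, ?_⟩
  · rw [LinearMap.sum_apply, coeff_sum]
    push_cast
    exact Finset.sum_congr rfl fun k hk => (hf k hk).1
  · rw [LinearMap.sum_apply, coeff_sum]
    exact (norm_sum_le _ _).trans (Finset.sum_le_sum fun k hk => (hf k hk).2)

theorem Dominated.smul {A B : Module.End ℂ (Fock ι)} (h : Dominated A B) {c : ℂ} {r : ℝ}
    (hc : ‖c‖ ≤ r) : Dominated (c • A) ((r : ℂ) • B) := by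
  intro d d'
  obtain ⟨x, h1, h2⟩ := h d d'
  refine ⟨r * x, by simp [h1], ?_⟩
  rw [LinearMap.smul_apply, coeff_smul, smul_eq_mul, norm_mul]
  exact mul_le_mul hc h2 (norm_nonneg _) ((norm_nonneg _).trans hc)

theorem dominated_one : Dominated (1 : Module.End ℂ (Fock ι)) 1 := by
  classical
  intro d d'
  refine ⟨if d = d' then 1 else 0, ?_, ?_⟩ <;> rw [Module.End.one_apply, coeff_basisVec]
  · split_ifs <;> simp
  · split_ifs <;> simp

theorem dominated_zero : Dominated (0 : Module.End ℂ (Fock ι)) 0 := fun d d' =>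
  ⟨0, by simp, by simp⟩

theorem dominated_modeSum {A B : ℤ → Module.End ℂ (Fock ι)} (hA : LocFin A) (hB : LocFin B)
    (h : ∀ k, Dominated (A k) (B k)) : Dominated (modeSum A) (modeSum B) := by
  intro d d'
  obtain ⟨s, hs⟩ := hA.exists_finset (basisVec d)
  obtain ⟨t, ht⟩ := hB.exists_finset (basisVec d)
  have := Dominated.sum (s := s ∪ t) (fun k _ => h k) d d'
  rwa [LinearMap.sum_apply, LinearMap.sum_apply,
    ← modeSum_apply_eq_sum hA fun k hk => hs k (by grind),
    ← modeSum_apply_eq_sum hB fun k hk => ht k (by grind)] at this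

theorem coeff_mul_X_basisVec (p : ι × ℤ) (d d' : ι × ℤ →₀ ℕ) [Decidable (d + Finsupp.single p 1 = d')] :
    coeff d' (X p * basisVec d : Fock ι) = if d + Finsupp.single p 1 = d' then 1 else 0 := by
  classical
  rw [basisVec, X, monomial_mul, one_mul, add_comm, coeff_monomial]
  congr

theorem dominated_mulLeft_X (p : ι × ℤ) :
    Dominated (LinearMap.mulLeft ℂ (X p : Fock ι)) (LinearMap.mulLeft ℂ (X p)) := by
  classical
  intro d d'
  refine ⟨if d + Finsupp.single p 1 = d' then 1 else 0, ?_, ?_⟩ <;>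
    rw [LinearMap.mulLeft_apply, coeff_mul_X_basisVec]
  · split_ifs <;> simp
  · split_ifs <;> simp

theorem dominated_pderiv (p : ι × ℤ) : Dominated (pderiv p : Derivation ℂ (Fock ι) (Fock ι)).toLinearMap
    (pderiv p : Derivation ℂ (Fock ι) (Fock ι)).toLinearMap := by
  classical
  intro d d'
  refine ⟨(if d = d' + Finsupp.single p 1 then 1 else 0) * (d' p + 1), ?_, ?_⟩ <;>
    rw [Derivation.coeFn_coe, coeff_pderiv, coeff_basisVec]
  · split_ifs <;> simp
  · split_ifs
    · rw [one_mul, one_mul]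
      exact le_of_eq (by exact_mod_cast Complex.norm_natCast (d' p + 1))
    · simp

theorem dominated_betaMode (b : ι) (m : ℤ) : Dominated (betaMode b m) (betaMode b m) := by
  rw [betaMode]
  split_ifs
  exacts [dominated_mulLeft_X _, dominated_pderiv _]

theorem dominated_signedGamma {ε : ℂ} (hε : ‖ε‖ ≤ 1) (a : ι) (m : ℤ) :
    Dominated (signedGamma ε a m) (signedGamma 1 a m) := by
  rw [signedGamma, signedGamma]
  split_ifs
  · exact dominated_mulLeft_X _
  · simpa using (dominated_pderiv (a, -m)).smul (r := 1) hε

theorem dominated_gammaProd {ε : ℂ} (hε : ‖ε‖ ≤ 1) (l : List ι) (n : ℤ) :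
    Dominated (gammaProd ε l n) (gammaProd 1 l n) := by
  induction l generalizing n with
  | nil =>
    simp only [gammaProd]
    split_ifs
    exacts [dominated_one, dominated_zero]
  | cons a l ih =>
    exact dominated_modeSum ((isGammaField_gammaProd ε l).locFin a n)
      ((isGammaField_gammaProd 1 l).locFin a n) fun k => (dominated_signedGamma hε a k).mul (ih _)

/-- The polynomial whose coefficients are the absolute values of those of `P`. -/
def normPoly (P : MvPolynomial ι ℂ) : MvPolynomial ι ℂ :=
  ∑ e ∈ P.support, monomial e (‖P.coeff e‖ : ℂ)

theorem coeff_normPoly (P : MvPolynomial ι ℂ) (e : ι →₀ ℕ) :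
    (normPoly P).coeff e = (‖P.coeff e‖ : ℂ) := by
  classical
  rw [normPoly, coeff_sum]
  simp only [coeff_monomial]
  rw [Finset.sum_ite_eq']
  split_ifs with h
  · rfl
  · simp [notMem_support_iff.1 h]

theorem dominated_polyOp {ε : ℂ} (hε : ‖ε‖ ≤ 1) (P : MvPolynomial ι ℂ) (n : ℤ) :
    Dominated (polyOp ε P n) (polyOp 1 (normPoly P) n) := by
  rw [polyOp_eq_sum 1 (P := normPoly P) (s := P.support)]
  · refine Dominated.sum fun e _ => ?_
    rw [coeff_normPoly]
    exact (dominated_gammaProd hε _ n).smul le_rfl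
  · intro e he
    rw [mem_support_iff, coeff_normPoly] at he
    rw [mem_support_iff]
    rintro h
    simp [h] at he

theorem normPoly_pderiv (P : MvPolynomial ι ℂ) (b : ι) :
    normPoly (pderiv b P) = pderiv b (normPoly P) := by
  ext e
  rw [coeff_normPoly, coeff_pderiv, coeff_pderiv, coeff_normPoly, norm_mul]
  push_cast
  congr 1
  exact_mod_cast congrArg ((↑) : ℝ → ℂ) (Complex.norm_natCast (e b + 1))

theorem normPoly_normPoly (P : MvPolynomial ι ℂ) : normPoly (normPoly P) = normPoly P := by
  ext e
  simp [coeff_normPoly]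

end Modes

end GhostSystem

namespace GhostSystem
open MvPolynomial
open scoped ComplexOrder

/-! ### An abstract Wick expansion -/

/-- Iterating a rule that removes the letters `inr i` from a word over `J ⊕ M` one by one, at the cost
of applying `D i` to the data attached to one of the letters `inl j`. The relation `r` is an
equality or an inequality. -/
theorem wick_expansion {J M Data S N : Type*} [Fintype J] [DecidableEq J] [CommSemiring S]
    [AddCommMonoid N] (r : S → S → Prop) (hrefl : ∀ a, r a a)
    (htrans : ∀ a b c, r a b → r b c → r a c) (hadd : ∀ a b c d, r a b → r c d → r (a + c) (b + d))
    (C : M → J → S) (hmul : ∀ i j a b, r a b → r (C i j * a) (C i j * b))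
    (T : (J → Data) → List (J ⊕ M) → S) (D : M → Data → Data) (δ : M → N) (v : Data → N → S)
    (hv : ∀ i x s, v (D i x) s = v x (δ i + s)) (V : S) (Good : List (J ⊕ M) → Prop)
    (hnd : ∀ L, Good L → L.Nodup)
    (hgood : ∀ L₁ i L₂, Good (L₁ ++ Sum.inr i :: L₂) → Good (L₁ ++ L₂))
    (hstep : ∀ σ L₁ i L₂, Good (L₁ ++ Sum.inr i :: L₂) → r (T σ (L₁ ++ Sum.inr i :: L₂))
      (∑ j, C i j * T (Function.update σ j (D i (σ j))) (L₁ ++ L₂)))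
    (hbase : ∀ σ L, Good L → (∀ i, Sum.inr i ∉ L) → r (T σ L) (V * ∏ j, v (σ j) 0))
    {m : ℕ} (e : Fin m → M) (he : Function.Injective e) (σ : J → Data) (L : List (J ⊕ M))
    (hL : Good L) (hLe : ∀ i, Sum.inr i ∈ L ↔ i ∈ Set.range e) :
    r (T σ L) (∑ f : Fin m → J, (∏ i, C (e i) (f i)) *
      (V * ∏ j, v (σ j) (∑ i, if f i = j then δ (e i) else 0))) := by
  have hsum : ∀ (s : Finset J) (a b : J → S), (∀ j, r (a j) (b j)) →
      r (∑ j ∈ s, a j) (∑ j ∈ s, b j) := by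
    intro s a b h
    induction s using Finset.induction_on with
    | empty => simpa using hrefl 0
    | insert j s hj ih => rw [Finset.sum_insert hj, Finset.sum_insert hj]; exact hadd _ _ _ _ (h j) ih
  induction m generalizing σ L with
  | zero =>
    have := hbase σ L hL fun i hi => by simpa using (hLe i).1 hi
    simpa using this
  | succ m ih =>
    obtain ⟨L₁, L₂, rfl⟩ := List.append_of_mem ((hLe (e 0)).2 ⟨0, rfl⟩)
    have hn := hnd _ hL
    have hr : ∀ i, Sum.inr i ∈ L₁ ++ L₂ ↔ i ∈ Set.range (e ∘ Fin.succ) := by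
      intro i
      have h1 := hLe i
      have h2 : Sum.inr (e 0) ∉ L₁ ++ L₂ := (List.nodup_middle.1 hn).notMem
      simp only [List.mem_append, List.mem_cons, Sum.inr.injEq, Set.mem_range] at h1 h2 ⊢
      rw [Fin.exists_fin_succ] at h1
      constructor
      · intro h
        rcases h1.1 (by tauto) with h3 | h3
        · subst h3; exact absurd h h2
        · exact h3
      · rintro ⟨k, hk⟩
        rcases h1.2 (Or.inr ⟨k, hk⟩) with h3 | h3 | h3
        · exact Or.inl h3
        · rw [h3] at hk
          exact absurd (he hk) (Fin.succ_ne_zero k)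
        · exact Or.inr h3
    refine htrans _ _ _ (hstep σ L₁ (e 0) L₂ hL) ?_
    have key : ∀ j, r (C (e 0) j * T (Function.update σ j (D (e 0) (σ j))) (L₁ ++ L₂))
        (C (e 0) j * ∑ f : Fin m → J, (∏ i, C (e i.succ) (f i)) * (V * ∏ j',
          v (σ j') (∑ i, if (Fin.cons j f : Fin (m + 1) → J) i = j' then δ (e i) else 0))) := by
      intro j
      refine hmul _ _ _ _ ?_
      have := ih (e ∘ Fin.succ) (he.comp (Fin.succ_injective m))
        (Function.update σ j (D (e 0) (σ j))) _ (hgood _ _ _ hL) hr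
      -- Contracting the letter e 0 with j changes the data at j by D (e 0); by `hv` this is
      -- recorded instead as an additional summand δ (e 0) in the argument of v, as prescribed by
      -- the map Fin.cons j f.
      have h2 : ∀ (f : Fin m → J) j', v (σ j') (∑ i, if (Fin.cons j f : Fin (m + 1) → J) i = j' then
          δ (e i) else 0) = v (Function.update σ j (D (e 0) (σ j)) j')
            (∑ i, if f i = j' then δ ((e ∘ Fin.succ) i) else 0) := by
        intro f j'
        rw [Fin.sum_univ_succ]
        by_cases h : j = j'
        · subst h
          simp [hv]
        · simp [h, Function.update_of_ne (Ne.symm h)]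
      simp only [h2]
      exact this
    refine htrans _ _ _ (hsum _ _ _ key) ?_
    convert hrefl _ using 1
    rw [← (Fin.consEquiv fun _ => J).sum_comp, Fintype.sum_prod_type]
    refine Finset.sum_congr rfl fun j _ => ?_
    rw [Finset.mul_sum]
    refine Finset.sum_congr rfl fun f _ => ?_
    rw [Fin.prod_univ_succ]
    simp only [Fin.consEquiv, Equiv.coe_fn_mk, Fin.cons_zero, Fin.cons_succ, mul_assoc]
    rfl

section Trace

variable {ι : Type*}

/-! ### Diagonal matrix elements and cyclicity of the trace -/

/-- The contribution of a basis vector to the trace of `A` times the diagonal operator with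
eigenvalues `W`. -/
def diagTerm (W : (ι × ℤ →₀ ℕ) → ℂ) (A : Module.End ℂ (Fock ι)) (d : ι × ℤ →₀ ℕ) : ℂ :=
  coeff d (A (basisVec d)) * W d

theorem diagTerm_add (W : (ι × ℤ →₀ ℕ) → ℂ) (A B : Module.End ℂ (Fock ι)) (d : ι × ℤ →₀ ℕ) :
    diagTerm W (A + B) d = diagTerm W A d + diagTerm W B d := by
  simp [diagTerm, add_mul]

theorem diagTerm_smul (W : (ι × ℤ →₀ ℕ) → ℂ) (c : ℂ) (A : Module.End ℂ (Fock ι))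
    (d : ι × ℤ →₀ ℕ) : diagTerm W (c • A) d = c * diagTerm W A d := by
  simp [diagTerm, mul_assoc]

theorem diagTerm_sum (W : (ι × ℤ →₀ ℕ) → ℂ) {κ : Type*} (s : Finset κ)
    (A : κ → Module.End ℂ (Fock ι)) (d : ι × ℤ →₀ ℕ) :
    diagTerm W (∑ k ∈ s, A k) d = ∑ k ∈ s, diagTerm W (A k) d := by
  simp [diagTerm, coeff_sum, Finset.sum_mul]

/-- `∏_p w_p ^ d_p`. -/
def weight (w : ι × ℤ → ℂ) (d : ι × ℤ →₀ ℕ) : ℂ := d.prod fun p r => w p ^ r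

theorem weight_add_single (w : ι × ℤ → ℂ) (d : ι × ℤ →₀ ℕ) (p : ι × ℤ) :
    weight w (d + Finsupp.single p 1) = w p * weight w d := by
  classical
  rw [weight, Finsupp.prod_add_index' (by simp) (by simp [pow_add])]
  simp [weight, mul_comm]

theorem pderiv_basisVec_add_single (p : ι × ℤ) (d : ι × ℤ →₀ ℕ) :
    pderiv p (basisVec (d + Finsupp.single p 1) : Fock ι) = ((d p : ℂ) + 1) • basisVec d := by
  rw [basisVec, pderiv_monomial]
  simp [basisVec, smul_monomial]

/-- Cyclicity of the trace for one annihilation operator, in a form valid for each basis vector: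
moving ∂_p past the diagonal operator multiplies by w p and shifts the occupation number of p by
one. -/
theorem diagTerm_mul_pderiv (w : ι × ℤ → ℂ) (A : Module.End ℂ (Fock ι)) (p : ι × ℤ)
    (d : ι × ℤ →₀ ℕ) :
    diagTerm (weight w) (A * (pderiv p : Derivation ℂ (Fock ι) (Fock ι)).toLinearMap)
      (d + Finsupp.single p 1) =
    w p * diagTerm (weight w) ((pderiv p : Derivation ℂ (Fock ι) (Fock ι)).toLinearMap * A) d := by
  rw [diagTerm, diagTerm, Module.End.mul_apply, Module.End.mul_apply, weight_add_single,
    Derivation.coeFn_coe, pderiv_basisVec_add_single, map_smul, coeff_smul, coeff_pderiv,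
    smul_eq_mul]
  ring

theorem diagTerm_mul_pderiv_eq_zero (w : ι × ℤ → ℂ) (A : Module.End ℂ (Fock ι)) (p : ι × ℤ)
    (d : ι × ℤ →₀ ℕ) (h : d p = 0) :
    diagTerm (weight w) (A * (pderiv p : Derivation ℂ (Fock ι) (Fock ι)).toLinearMap) d = 0 := by
  rw [diagTerm, Module.End.mul_apply, Derivation.coeFn_coe, basisVec, pderiv_monomial, h]
  simp

theorem diagTerm_mulLeft (w : ι × ℤ → ℂ) (A : Module.End ℂ (Fock ι)) (p : ι × ℤ)
    (d : ι × ℤ →₀ ℕ) :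
    diagTerm (weight w) (LinearMap.mulLeft ℂ (X p) * A) (d + Finsupp.single p 1) =
    w p * diagTerm (weight w) (A * LinearMap.mulLeft ℂ (X p)) d := by
  have : X p * basisVec d = (basisVec (d + Finsupp.single p 1) : Fock ι) := by
    rw [basisVec, basisVec, X, monomial_mul, one_mul, add_comm]
  rw [diagTerm, diagTerm, Module.End.mul_apply, Module.End.mul_apply, weight_add_single,
    LinearMap.mulLeft_apply, LinearMap.mulLeft_apply, this, add_comm d, coeff_X_mul]
  ring

theorem diagTerm_mulLeft_eq_zero (w : ι × ℤ → ℂ) (A : Module.End ℂ (Fock ι)) (p : ι × ℤ)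
    (d : ι × ℤ →₀ ℕ) (h : d p = 0) :
    diagTerm (weight w) (LinearMap.mulLeft ℂ (X p) * A) d = 0 := by
  classical
  rw [diagTerm, Module.End.mul_apply, LinearMap.mulLeft_apply, coeff_X_mul', if_neg (by simpa using h),
    zero_mul]

theorem exists_eq_add_single {p : ι × ℤ} {d : ι × ℤ →₀ ℕ} (h : d p ≠ 0) :
    ∃ d', d = d' + Finsupp.single p 1 :=
  ⟨d - Finsupp.single p 1, by
    rw [tsub_add_cancel_of_le]
    rw [Finsupp.single_le_iff]
    omega⟩

theorem tsum_shift {u v : (ι × ℤ →₀ ℕ) → ℂ} {p : ι × ℤ} {c : ℂ}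
    (h : ∀ d, u (d + Finsupp.single p 1) = c * v d) (h0 : ∀ d, d p = 0 → u d = 0) :
    ∑' d, u d = c * ∑' d, v d := by
  rw [← tsum_mul_left, ← (add_left_injective (Finsupp.single p 1)).tsum_eq (f := u)]
  · simp only [h]
  · intro d hd
    obtain ⟨d', rfl⟩ := exists_eq_add_single (d := d) (p := p) fun h' => hd (h0 d h')
    exact ⟨d', rfl⟩

/-- Truncated form of `tsum_shift`: for a set closed under removing a quantum the shift loses only
nonnegative terms, so that cyclicity survives as an inequality. -/
theorem sum_shift_le {u v : (ι × ℤ →₀ ℕ) → ℂ} {p : ι × ℤ} {c : ℂ} (hc : 0 ≤ c)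
    (hv : ∀ d, 0 ≤ v d) (h : ∀ d, u (d + Finsupp.single p 1) = c * v d)
    (h0 : ∀ d, d p = 0 → u d = 0) {s : Finset (ι × ℤ →₀ ℕ)}
    (hs : ∀ d, d + Finsupp.single p 1 ∈ s → d ∈ s) : ∑ d ∈ s, u d ≤ c * ∑ d ∈ s, v d := by
  classical
  set s' := s.filter fun d => d + Finsupp.single p 1 ∈ s
  have h1 : ∑ d ∈ s, u d = ∑ d ∈ s', u (d + Finsupp.single p 1) := by
    rw [← Finset.sum_image (f := u) (g := fun d => d + Finsupp.single p 1)
      fun d _ d' _ hd => add_left_injective (Finsupp.single p 1) hd]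
    symm
    refine Finset.sum_subset (fun d hd => ?_) fun d hd hd' => ?_
    · obtain ⟨d', h1, rfl⟩ := Finset.mem_image.1 hd
      exact (Finset.mem_filter.1 h1).2
    · by_contra h'
      obtain ⟨d', rfl⟩ := exists_eq_add_single (d := d) (p := p) fun h2 => h' (h0 d h2)
      exact hd' (Finset.mem_image.2 ⟨d', Finset.mem_filter.2 ⟨hs d' hd, hd⟩, rfl⟩)
  rw [h1]
  simp only [h]
  rw [← Finset.mul_sum]
  exact mul_le_mul_of_nonneg_left
    (Finset.sum_le_sum_of_subset_of_nonneg (Finset.filter_subset _ _) fun d _ _ => hv d) hc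

theorem Dominated.diagTerm_nonneg {A B : Module.End ℂ (Fock ι)} (h : Dominated A B)
    {W : (ι × ℤ →₀ ℕ) → ℂ} (hW : ∀ d, 0 ≤ W d) (d : ι × ℤ →₀ ℕ) : 0 ≤ diagTerm W B d := by
  obtain ⟨r, h1, h2⟩ := h d d
  rw [diagTerm, h1]
  exact mul_nonneg (by exact_mod_cast (norm_nonneg _).trans h2) (hW d)

/-! ### Removing one `β` -/

/-- The contraction of `β[m]` with a `γ` to its right, `w` being the weight of the oscillator. -/
def contractRight (ε : ℂ) (m : ℤ) (w : ℂ) : ℂ := if 0 ≤ m then (1 - w)⁻¹ else ε * w * (1 - w)⁻¹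

/-- The contraction of `β[m]` with a `γ` to its left. -/
def contractLeft (ε : ℂ) (m : ℤ) (w : ℂ) : ℂ := if 0 ≤ m then w * (1 - w)⁻¹ else ε * (1 - w)⁻¹

variable {w : ι × ℤ → ℂ} {b : ι} {m : ℤ} {A B A' B' : Module.End ℂ (Fock ι)} {ε : ℂ}

/-- Let X be the trace of A β B. Commuting β through B and through A expresses the traces of A B β
and β A B by X and contraction terms, and cyclicity relates these two traces by the factor w. This
linear equation for X is solvable as w ≠ 1. -/
theorem tsum_diagTerm_beta (hw : w (b, m) ≠ 1)
    (hA : betaMode b m * A = A * betaMode b m + modeSign ε m • A')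
    (hB : betaMode b m * B = B * betaMode b m + modeSign ε m • B')
    (s0 : Summable (diagTerm (weight w) (A * (betaMode b m * B))))
    (s1 : Summable (diagTerm (weight w) (A' * B))) (s2 : Summable (diagTerm (weight w) (A * B'))) :
    ∑' d, diagTerm (weight w) (A * (betaMode b m * B)) d =
      contractLeft ε m (w (b, m)) * ∑' d, diagTerm (weight w) (A' * B) d +
      contractRight ε m (w (b, m)) * ∑' d, diagTerm (weight w) (A * B') d := by
  have hw1 : 1 - w (b, m) ≠ 0 := sub_ne_zero.2 hw.symm
  have e1 : A * (betaMode b m * B) = A * B * betaMode b m + modeSign ε m • (A * B') := by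
    rw [hB, mul_add, mul_smul_comm, mul_assoc]
  have e2 : betaMode b m * (A * B) = A * (betaMode b m * B) + modeSign ε m • (A' * B) := by
    rw [← mul_assoc, hA, add_mul, mul_assoc, smul_mul_assoc]
  have t1 : ∑' d, diagTerm (weight w) (A * B * betaMode b m) d =
      ∑' d, diagTerm (weight w) (A * (betaMode b m * B)) d +
        -modeSign ε m * ∑' d, diagTerm (weight w) (A * B') d := by
    rw [← tsum_mul_left, ← s0.tsum_add (s2.mul_left _), e1]
    refine tsum_congr fun d => ?_
    rw [diagTerm_add, diagTerm_smul]
    ring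
  have t2 : ∑' d, diagTerm (weight w) (betaMode b m * (A * B)) d =
      ∑' d, diagTerm (weight w) (A * (betaMode b m * B)) d +
        modeSign ε m * ∑' d, diagTerm (weight w) (A' * B) d := by
    rw [← tsum_mul_left, ← s0.tsum_add (s1.mul_left _), e2]
    simp only [diagTerm_add, diagTerm_smul]
  by_cases hm : 0 ≤ m
  · have hm' : ¬ m < 0 := not_lt.2 hm
    have t3 : ∑' d, diagTerm (weight w) (A * B * betaMode b m) d =
        w (b, m) * ∑' d, diagTerm (weight w) (betaMode b m * (A * B)) d := by
      simp only [betaMode, hm', if_false]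
      exact tsum_shift (diagTerm_mul_pderiv w (A * B) (b, m))
        (diagTerm_mul_pderiv_eq_zero w (A * B) (b, m))
    rw [t1, t2] at t3
    simp only [modeSign, hm, if_true, contractLeft, contractRight] at t3 ⊢
    field_simp
    linear_combination t3
  · have hm' : m < 0 := not_le.1 hm
    have t3 : ∑' d, diagTerm (weight w) (betaMode b m * (A * B)) d =
        w (b, m) * ∑' d, diagTerm (weight w) (A * B * betaMode b m) d := by
      simp only [betaMode, hm', if_true]
      exact tsum_shift (diagTerm_mulLeft w (A * B) (b, m))
        (diagTerm_mulLeft_eq_zero w (A * B) (b, m))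
    rw [t1, t2] at t3
    simp only [modeSign, hm, if_false, contractLeft, contractRight] at t3 ⊢
    field_simp
    linear_combination t3

theorem le_of_cyclic_bound {c x y z a a' : ℂ} (hc1 : c < 1) (h1 : x = y + a)
    (h2 : y ≤ c * z) (h3 : z = x + a') : x ≤ c * (1 - c)⁻¹ * a' + (1 - c)⁻¹ * a := by
  have hp : 0 < 1 - c := sub_pos.2 hc1
  have hne : 1 - c ≠ 0 := hp.ne'
  have h4 : (1 - c) * x ≤ c * a' + a := by
    have : x ≤ c * z + a := h1 ▸ add_le_add_left h2 a
    rw [h3] at this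
    rw [← sub_nonneg] at this ⊢
    convert! this using 1
    ring
  have h5 := mul_le_mul_of_nonneg_left h4 (inv_nonneg.2 hp.le)
  rw [inv_mul_cancel_left₀ hne] at h5
  refine h5.trans (le_of_eq ?_)
  ring

/-- The argument of `tsum_diagTerm_beta` for partial sums, where no convergence is needed. It works
for ε = 1: both contraction coefficients are then nonnegative for m ≥ 0 and for m < 0, and all
matrix elements are nonnegative. -/
theorem sum_diagTerm_beta_le (hw : ∀ p, 0 ≤ w p) (hw1 : w (b, m) < 1)
    (hA : betaMode b m * A = A * betaMode b m + modeSign 1 m • A')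
    (hB : betaMode b m * B = B * betaMode b m + modeSign 1 m • B')
    (pA : Dominated A A) (pB : Dominated B B) {s : Finset (ι × ℤ →₀ ℕ)}
    (hs : ∀ d, d + Finsupp.single (b, m) 1 ∈ s → d ∈ s) :
    ∑ d ∈ s, diagTerm (weight w) (A * (betaMode b m * B)) d ≤
      contractLeft 1 m (w (b, m)) * ∑ d ∈ s, diagTerm (weight w) (A' * B) d +
      contractRight 1 m (w (b, m)) * ∑ d ∈ s, diagTerm (weight w) (A * B') d := by
  have hW : ∀ d, 0 ≤ weight w d := fun d => Finset.prod_nonneg fun p _ => pow_nonneg (hw p) _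
  have e1 : A * (betaMode b m * B) = A * B * betaMode b m + modeSign 1 m • (A * B') := by
    rw [hB, mul_add, mul_smul_comm, mul_assoc]
  have e2 : betaMode b m * (A * B) = A * (betaMode b m * B) + modeSign 1 m • (A' * B) := by
    rw [← mul_assoc, hA, add_mul, mul_assoc, smul_mul_assoc]
  have t1 : ∑ d ∈ s, diagTerm (weight w) (A * (betaMode b m * B)) d =
      ∑ d ∈ s, diagTerm (weight w) (A * B * betaMode b m) d +
        modeSign 1 m * ∑ d ∈ s, diagTerm (weight w) (A * B') d := by
    rw [Finset.mul_sum, ← Finset.sum_add_distrib, e1]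
    simp only [diagTerm_add, diagTerm_smul]
  have t2 : ∑ d ∈ s, diagTerm (weight w) (betaMode b m * (A * B)) d =
      ∑ d ∈ s, diagTerm (weight w) (A * (betaMode b m * B)) d +
        modeSign 1 m * ∑ d ∈ s, diagTerm (weight w) (A' * B) d := by
    rw [Finset.mul_sum, ← Finset.sum_add_distrib, e2]
    simp only [diagTerm_add, diagTerm_smul]
  have pβ := dominated_betaMode b m
  by_cases hm : 0 ≤ m
  · have hm' : ¬ m < 0 := not_lt.2 hm
    have t3 : ∑ d ∈ s, diagTerm (weight w) (A * B * betaMode b m) d ≤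
        w (b, m) * ∑ d ∈ s, diagTerm (weight w) (betaMode b m * (A * B)) d := by
      refine sum_shift_le (hw _) (fun d => (pβ.mul (pA.mul pB)).diagTerm_nonneg hW d) ?_ ?_ hs
      · simp only [betaMode, hm', if_false]
        exact diagTerm_mul_pderiv w (A * B) (b, m)
      · simp only [betaMode, hm', if_false]
        exact diagTerm_mul_pderiv_eq_zero w (A * B) (b, m)
    simp only [modeSign, hm, if_true, contractLeft, contractRight, one_mul] at t1 t2 ⊢
    exact le_of_cyclic_bound hw1 t1 t3 t2
  · have hm' : m < 0 := not_le.1 hm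
    have t3 : ∑ d ∈ s, diagTerm (weight w) (betaMode b m * (A * B)) d ≤
        w (b, m) * ∑ d ∈ s, diagTerm (weight w) (A * B * betaMode b m) d := by
      refine sum_shift_le (hw _) (fun d => ((pA.mul pB).mul pβ).diagTerm_nonneg hW d) ?_ ?_ hs
      · simp only [betaMode, hm', if_true]
        exact diagTerm_mulLeft w (A * B) (b, m)
      · simp only [betaMode, hm', if_true]
        exact diagTerm_mulLeft_eq_zero w (A * B) (b, m)
    simp only [modeSign, hm, if_false, contractLeft, contractRight, one_mul] at t1 t2 ⊢
    refine (le_of_cyclic_bound hw1 (x := ∑ d ∈ s, diagTerm (weight w) (A * (betaMode b m * B)) d)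
      (z := ∑ d ∈ s, diagTerm (weight w) (A * B * betaMode b m) d)
      (a := ∑ d ∈ s, diagTerm (weight w) (A' * B) d)
      (a' := ∑ d ∈ s, diagTerm (weight w) (A * B') d) ?_ t3 ?_).trans (le_of_eq ?_)
    · rw [t2]; ring
    · rw [t1]; ring
    · ring

/-! ### Words in the ghost fields -/

variable {J M : Type*}

/-- The operator of a letter: `inl j` stands for a mode of a polynomial in the `γ`, `inr i` for a
mode of a `β`. -/
def letterOp (ε : ℂ) (β : M → ι × ℤ) (σ : J → MvPolynomial ι ℂ × ℤ) :
    J ⊕ M → Module.End ℂ (Fock ι)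
  | .inl j => polyOp ε (σ j).1 (σ j).2
  | .inr i => betaMode (β i).1 (β i).2

def wordOp (ε : ℂ) (β : M → ι × ℤ) (σ : J → MvPolynomial ι ℂ × ℤ) (L : List (J ⊕ M)) :
    Module.End ℂ (Fock ι) := (L.map (letterOp ε β σ)).prod

/-- The effect of a contraction with `β_b[m]` on a mode of a polynomial in the `γ`. -/
def contractData (p : ι × ℤ) (x : MvPolynomial ι ℂ × ℤ) : MvPolynomial ι ℂ × ℤ :=
  (pderiv p.1 x.1, x.2 + p.2)

theorem wordOp_append (ε : ℂ) (β : M → ι × ℤ) (σ : J → MvPolynomial ι ℂ × ℤ) (L₁ L₂ : List (J ⊕ M)) :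
    wordOp ε β σ (L₁ ++ L₂) = wordOp ε β σ L₁ * wordOp ε β σ L₂ := by
  simp [wordOp]

theorem wordOp_cons (ε : ℂ) (β : M → ι × ℤ) (σ : J → MvPolynomial ι ℂ × ℤ) (x : J ⊕ M)
    (L : List (J ⊕ M)) : wordOp ε β σ (x :: L) = letterOp ε β σ x * wordOp ε β σ L := by
  simp [wordOp]

theorem wordOp_update [DecidableEq J] (ε : ℂ) (β : M → ι × ℤ) (σ : J → MvPolynomial ι ℂ × ℤ)
    {L : List (J ⊕ M)} {j : J} (hj : Sum.inl j ∉ L) (x : MvPolynomial ι ℂ × ℤ) :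
    wordOp ε β (Function.update σ j x) L = wordOp ε β σ L := by
  rw [wordOp, wordOp]
  congr 1
  refine List.map_congr_left fun y hy => ?_
  cases y with
  | inl k => rw [letterOp, letterOp, Function.update_of_ne (by rintro rfl; exact hj hy)]
  | inr i => rfl

theorem betaMode_mul_betaMode (b b' : ι) (m m' : ℤ) :
    betaMode b m * betaMode b' m' = betaMode b' m' * betaMode b m := by
  refine LinearMap.ext fun v => ?_
  by_cases hm : m < 0 <;> by_cases hm' : m' < 0
  · simp [betaMode, hm, hm', mul_left_comm]
  · have : (b, m) ≠ (b', m') := fun h => by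
      have := (Prod.mk.inj h).2; omega
    simp [betaMode, hm, hm', pderiv_X_of_ne this]
  · have : (b', m') ≠ (b, m) := fun h => by
      have := (Prod.mk.inj h).2; omega
    simp [betaMode, hm, hm', pderiv_X_of_ne this]
  · simp [betaMode, hm, hm', pderiv_comm (b, m)]

-- Leibniz rule for the commutator with β. As the word has no repeated letters, differentiating one
-- factor is the same as updating the data σ at one index.
open Classical in
theorem betaMode_mul_wordOp [Fintype J] [DecidableEq J] (ε : ℂ) (β : M → ι × ℤ) (σ : J → MvPolynomial ι ℂ × ℤ)
    (p : ι × ℤ) (L : List (J ⊕ M)) (hL : L.Nodup) :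
    betaMode p.1 p.2 * wordOp ε β σ L = wordOp ε β σ L * betaMode p.1 p.2 + modeSign ε p.2 •
      ∑ j, if Sum.inl j ∈ L then
        wordOp ε β (Function.update σ j (contractData p (σ j))) L else 0 := by
  induction L with
  | nil => simp [wordOp]
  | cons x L ih =>
    rw [List.nodup_cons] at hL
    rw [wordOp_cons, ← mul_assoc]
    cases x with
    | inl k =>
      have h1 : betaMode p.1 p.2 * letterOp ε β σ (Sum.inl k) =
          letterOp ε β σ (Sum.inl k) * betaMode p.1 p.2 +
          modeSign ε p.2 • polyOp ε (contractData p (σ k)).1 (contractData p (σ k)).2 :=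
        LinearMap.ext fun v => betaMode_polyOp ε p.1 p.2 (σ k).1 (σ k).2 v
      have h2 : ∀ j, (if Sum.inl j ∈ Sum.inl k :: L then wordOp ε β
          (Function.update σ j (contractData p (σ j))) (Sum.inl k :: L) else 0) =
          (if j = k then polyOp ε (contractData p (σ k)).1 (contractData p (σ k)).2 * wordOp ε β σ L
            else 0) + letterOp ε β σ (Sum.inl k) * (if Sum.inl j ∈ L then wordOp ε β
          (Function.update σ j (contractData p (σ j))) L else 0) := by
        intro j
        by_cases hj : j = k
        · subst hj
          rw [if_pos (List.mem_cons_self), if_pos rfl, if_neg hL.1, mul_zero, add_zero,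
            wordOp_cons, wordOp_update ε β σ hL.1]
          simp [letterOp]
        · rw [if_neg hj, zero_add, wordOp_cons]
          simp only [List.mem_cons, Sum.inl.injEq, hj, false_or]
          split_ifs
          · simp [letterOp, Function.update_of_ne (Ne.symm hj)]
          · simp
      rw [h1, add_mul, mul_assoc, ih hL.2, Finset.sum_congr rfl fun j _ => h2 j,
        Finset.sum_add_distrib, Finset.sum_ite_eq' Finset.univ k, if_pos (Finset.mem_univ k),
        ← Finset.mul_sum, mul_add, mul_smul_comm, smul_mul_assoc, smul_add, mul_assoc]
      abel
    | inr i =>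
      have h1 : betaMode p.1 p.2 * letterOp ε β σ (Sum.inr i) =
          letterOp ε β σ (Sum.inr i) * betaMode p.1 p.2 := betaMode_mul_betaMode _ _ _ _
      rw [h1, mul_assoc, ih hL.2, mul_add, mul_smul_comm, Finset.mul_sum, mul_assoc]
      congr 2
      refine Finset.sum_congr rfl fun j _ => ?_
      simp only [List.mem_cons, reduceCtorEq, false_or]
      split_ifs
      · rw [wordOp_cons]; rfl
      · simp

/-! ### Words without `β` -/

/-- The number of quanta of `γ` minus the number of quanta of `β`. -/
def ghostNumber (d : ι × ℤ →₀ ℕ) : ℤ := d.sum fun p r => (r : ℤ) * (if p.2 < 0 then -1 else 1)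

theorem ghostNumber_add_single (d : ι × ℤ →₀ ℕ) (p : ι × ℤ) :
    ghostNumber (d + Finsupp.single p 1) = ghostNumber d + if p.2 < 0 then -1 else 1 := by
  classical
  rw [ghostNumber, Finsupp.sum_add_index' (by simp) (by intros; push_cast; ring)]
  simp [ghostNumber]

/-- The operator `A` increases the ghost number by at least `k`. -/
def Raises (k : ℤ) (A : Module.End ℂ (Fock ι)) : Prop :=
  ∀ d d', coeff d' (A (basisVec d)) ≠ 0 → ghostNumber d + k ≤ ghostNumber d'

theorem Raises.mono {k l : ℤ} (hA : Raises k A) (h : l ≤ k) : Raises l A := fun d d' hd =>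
  (add_le_add_right h _).trans (hA d d' hd)

theorem Raises.mul {k l : ℤ} (hA : Raises k A) (hB : Raises l B) : Raises (k + l) (A * B) := by
  intro d d' hd
  rw [coeff_mul_basisVec (s := (B (basisVec d)).support) subset_rfl] at hd
  obtain ⟨c, _, hc⟩ := Finset.exists_ne_zero_of_sum_ne_zero hd
  have h1 := hB d c (left_ne_zero_of_mul hc)
  have h2 := hA c d' (right_ne_zero_of_mul hc)
  linarith

theorem Raises.add {k : ℤ} (hA : Raises k A) (hB : Raises k B) : Raises k (A + B) := by
  intro d d' hd
  rw [LinearMap.add_apply, coeff_add] at hd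
  by_cases h : coeff d' (A (basisVec d)) = 0
  · exact hB d d' (by simpa [h] using hd)
  · exact hA d d' h

theorem Raises.smul {k : ℤ} (hA : Raises k A) (c : ℂ) : Raises k (c • A) := by
  intro d d' hd
  rw [LinearMap.smul_apply, coeff_smul, smul_eq_mul] at hd
  exact hA d d' (right_ne_zero_of_mul hd)

theorem raises_one : Raises 0 (1 : Module.End ℂ (Fock ι)) := by
  classical
  intro d d' hd
  rw [Module.End.one_apply, coeff_basisVec] at hd
  have : d = d' := by by_contra h; exact hd (if_neg h)
  simp [this]

theorem raises_zero (k : ℤ) : Raises k (0 : Module.End ℂ (Fock ι)) := fun d d' hd => by simp at hd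

theorem raises_modeSum {k : ℤ} {A : ℤ → Module.End ℂ (Fock ι)} (h : LocFin A)
    (hA : ∀ n, Raises k (A n)) : Raises k (modeSum A) := by
  intro d d' hd
  obtain ⟨s, hs⟩ := h.exists_finset (basisVec d)
  rw [modeSum_apply_eq_sum h hs, coeff_sum] at hd
  obtain ⟨c, _, hc⟩ := Finset.exists_ne_zero_of_sum_ne_zero hd
  exact hA c d d' hc

/-- A creating γ mode adds a quantum of γ, an annihilating one removes a quantum of β; both raise
the ghost number by one. -/
theorem raises_signedGamma (ε : ℂ) (a : ι) (m : ℤ) : Raises 1 (signedGamma ε a m) := by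
  classical
  intro d d' hd
  by_cases hm : m ≤ 0
  · simp only [signedGamma, hm, if_true] at hd
    rw [LinearMap.mulLeft_apply, coeff_mul_X_basisVec] at hd
    have : d + Finsupp.single (a, -m) 1 = d' := by by_contra h; exact hd (if_neg h)
    rw [← this, ghostNumber_add_single, if_neg (by simpa using hm)]
  · simp only [signedGamma, hm, if_false] at hd
    rw [LinearMap.smul_apply, Derivation.coeFn_coe, coeff_smul, coeff_pderiv, coeff_basisVec] at hd
    have : d = d' + Finsupp.single (a, -m) 1 := by by_contra h; exact hd (by simp [h])
    rw [this, ghostNumber_add_single, if_pos (by simpa using hm)]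
    linarith

theorem raises_gammaProd (ε : ℂ) (l : List ι) (n : ℤ) : Raises l.length (gammaProd ε l n) := by
  induction l generalizing n with
  | nil =>
    simp only [gammaProd]
    split_ifs
    exacts [raises_one, raises_zero _]
  | cons a l ih =>
    refine raises_modeSum ((isGammaField_gammaProd ε l).locFin a n) fun k => ?_
    rw [List.length_cons, Nat.cast_succ, add_comm]
    exact (raises_signedGamma ε a k).mul (ih _)

/-- The vacuum expectation of a mode of a polynomial in the `γ` after derivatives of order `e.1` and
a shift of the mode by `e.2`. -/
def dataValue (x : MvPolynomial ι ℂ × ℤ) (e : (ι →₀ ℕ) × ℤ) : ℂ :=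
  if x.2 + e.2 = 0 then x.1.coeff e.1 * (e.1.prod fun _ r => (r.factorial : ℂ)) else 0

/-- Taylor coefficients: the factor e_b + 1 from differentiating a monomial turns the factorial of
e_b into that of e_b + 1. -/
theorem dataValue_contractData (p : ι × ℤ) (x : MvPolynomial ι ℂ × ℤ) (e : (ι →₀ ℕ) × ℤ) :
    dataValue (contractData p x) e = dataValue x ((Finsupp.single p.1 1, p.2) + e) := by
  classical
  change (if x.2 + p.2 + e.2 = 0 then _ else _) = if x.2 + (p.2 + e.2) = 0 then _ else _
  rw [add_assoc]
  refine if_congr Iff.rfl ?_ rfl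
  · change (pderiv p.1 x.1).coeff e.1 * _ =
      x.1.coeff (Finsupp.single p.1 1 + e.1) * ((Finsupp.single p.1 1 + e.1).prod _)
    rw [coeff_pderiv, mul_assoc, add_comm (Finsupp.single p.1 1)]
    congr 1
    have h1 : ∀ e : ι →₀ ℕ, ∀ s : Finset ι, e.support ⊆ s →
        (e.prod fun _ r => (r.factorial : ℂ)) = ∏ x ∈ s, ((e x).factorial : ℂ) := fun e s hs =>
      Finsupp.prod_of_support_subset e hs _ (by simp)
    set s := insert p.1 e.1.support
    have hs : p.1 ∈ s := Finset.mem_insert_self _ _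
    rw [h1 e.1 s (Finset.subset_insert _ _), h1 (e.1 + Finsupp.single p.1 1) s,
      ← Finset.mul_prod_erase s _ hs, ← Finset.mul_prod_erase s _ hs, ← mul_assoc]
    · congr 1
      · simp [Nat.factorial_succ]
      · refine Finset.prod_congr rfl fun x hx => ?_
        simp [(Finset.ne_of_mem_erase hx).symm]
    · refine Finsupp.support_add.trans (Finset.union_subset (Finset.subset_insert _ _) ?_)
      refine Finsupp.support_single_subset.trans (by simp [s])

theorem exists_polyOp_eq (ε : ℂ) (x : MvPolynomial ι ℂ × ℤ) :
    ∃ R, Raises 1 R ∧ polyOp ε x.1 x.2 = dataValue x 0 • 1 + R := by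
  obtain ⟨P, n⟩ := x
  induction P using MvPolynomial.induction_on' with
  | monomial e c =>
    rw [polyOp_monomial]
    by_cases he : e = 0
    · subst he
      refine ⟨0, raises_zero _, ?_⟩
      simp only [map_zero, Multiset.toList_zero, gammaProd, dataValue, Prod.snd_zero, add_zero,
        Prod.fst_zero, Finsupp.prod_zero_index, mul_one]
      split_ifs <;> simp
    · refine ⟨_, ((raises_gammaProd ε (Finsupp.toMultiset e).toList n).smul c).mono ?_, ?_⟩
      · rw [Multiset.length_toList]
        have : 0 < (Finsupp.toMultiset e).card := by
          rw [Multiset.card_pos]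
          exact fun h => he (by classical simpa using congrArg Multiset.toFinsupp h)
        exact_mod_cast this
      · classical
        simp [dataValue, coeff_monomial, he]
  | add P Q hP hQ =>
    obtain ⟨R, hR, h1⟩ := hP
    obtain ⟨S, hS, h2⟩ := hQ
    refine ⟨R + S, hR.add hS, ?_⟩
    simp only at h1 h2
    rw [polyOp_add, h1, h2]
    have : dataValue (P + Q, n) 0 = dataValue (P, n) 0 + dataValue (Q, n) 0 := by
      simp only [dataValue, coeff_add]
      split_ifs <;> simp
    rw [this, add_smul]
    abel

theorem exists_wordOp_eq (ε : ℂ) (β : M → ι × ℤ) (σ : J → MvPolynomial ι ℂ × ℤ)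
    (L : List (J ⊕ M)) (hL : ∀ i, Sum.inr i ∉ L) :
    ∃ R, Raises 1 R ∧ wordOp ε β σ L =
      ((L.map (Sum.elim (fun j => dataValue (σ j) 0) fun _ => 1)).prod) • 1 + R := by
  induction L with
  | nil => exact ⟨0, raises_zero _, by simp [wordOp]⟩
  | cons x L ih =>
    cases x with
    | inr i => exact absurd List.mem_cons_self (hL i)
    | inl j =>
      obtain ⟨R, hR, h⟩ := ih fun i hi => hL i (List.mem_cons_of_mem _ hi)
      obtain ⟨S, hS, h'⟩ := exists_polyOp_eq ε (σ j)
      rw [wordOp_cons, h, letterOp, h']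
      set c := (L.map (Sum.elim (fun j => dataValue (σ j) 0) fun _ => 1)).prod
      refine ⟨dataValue (σ j) 0 • R + (c • S + S * R),
        (hR.smul _).add ((hS.smul _).add ((hS.mul hR).mono (by norm_num))), ?_⟩
      rw [List.map_cons, List.prod_cons, Sum.elim_inl]
      simp only [add_mul, mul_add, smul_mul_assoc, mul_smul_comm, one_mul, mul_one, mul_smul,
        smul_add]
      rw [smul_comm c]
      abel

/-- Each polynomial is its constant term plus an operator that strictly raises the ghost number. The
latter never contributes to a diagonal matrix element. -/
theorem diagTerm_wordOp [Fintype J] (W : (ι × ℤ →₀ ℕ) → ℂ) (ε : ℂ) (β : M → ι × ℤ)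
    (σ : J → MvPolynomial ι ℂ × ℤ) (L : List (J ⊕ M)) (hL : ∀ i, Sum.inr i ∉ L)
    (hn : L.Nodup) (hJ : ∀ j, Sum.inl j ∈ L) (d : ι × ℤ →₀ ℕ) :
    diagTerm W (wordOp ε β σ L) d = W d * ∏ j, dataValue (σ j) 0 := by
  classical
  obtain ⟨R, hR, h⟩ := exists_wordOp_eq ε β σ L hL
  have hR0 : coeff d (R (basisVec d)) = 0 := by
    by_contra h
    linarith [hR d d h]
  have h1 : (L.map (Sum.elim (fun j => dataValue (σ j) 0) fun _ => 1)).prod =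
      ∏ j, dataValue (σ j) 0 := by
    rw [← List.prod_toFinset _ hn]
    have : L.toFinset = Finset.univ.image (Sum.inl : J → J ⊕ M) := by
      ext x
      cases x with
      | inl j => simpa using hJ j
      | inr i => simpa using hL i
    rw [this, Finset.prod_image fun _ _ _ _ h => Sum.inl_injective h]
    rfl
  rw [h, h1, diagTerm_add, diagTerm_smul, diagTerm, diagTerm, hR0, Module.End.one_apply,
    coeff_basisVec, if_pos rfl]
  ring

end Trace

end GhostSystem

namespace GhostSystem
open MvPolynomial Filter Topology
open scoped ComplexOrder

/-! ### Sums of products -/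

theorem hasSum_fin_pi {κ : Type*} {n : ℕ} {f : Fin n → κ → ℂ} (hf : ∀ i, Summable fun k => ‖f i k‖) :
    (Summable fun x : Fin n → κ => ‖∏ i, f i (x i)‖) ∧
    HasSum (fun x : Fin n → κ => ∏ i, f i (x i)) (∏ i, ∑' k, f i k) := by
  induction n with
  | zero => exact ⟨(hasSum_fintype _).summable, by simp⟩
  | succ n ih =>
    obtain ⟨h1, h2⟩ := ih fun i => hf i.succ
    obtain ⟨E, hE⟩ : ∃ E : κ × (Fin n → κ) ≃ (Fin (n + 1) → κ), ∀ x, E x = Fin.cons x.1 x.2 :=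
      ⟨Fin.consEquiv fun _ => κ, fun _ => rfl⟩
    have e : ∀ x, ∏ i, f i (E x i) = f 0 x.1 * ∏ i : Fin n, f i.succ (x.2 i) := fun x => by
      rw [Fin.prod_univ_succ, hE, Fin.cons_zero]
      simp only [Fin.cons_succ]
    have key : ∀ (g : (Fin n → κ) → ℂ) (G : ℂ), (Summable fun x => ‖g x‖) → HasSum g G →
        (Summable fun x : κ × (Fin n → κ) => ‖f 0 x.1 * g x.2‖) ∧
        HasSum (fun x : κ × (Fin n → κ) => f 0 x.1 * g x.2) ((∑' k, f 0 k) * G) := fun g G h1 h2 =>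
      ⟨(hf 0).mul_norm h1,
        (hf 0).of_norm.hasSum.mul h2 (summable_mul_of_summable_norm (hf 0) h1)⟩
    have := key _ _ h1 h2
    rw [Fin.prod_univ_succ, ← E.hasSum_iff, ← E.summable_iff]
    simp only [Function.comp_def, e]
    exact this

theorem hasSum_pi {I κ : Type*} [Fintype I] {f : I → κ → ℂ} (hf : ∀ i, Summable fun k => ‖f i k‖) :
    (Summable fun x : I → κ => ‖∏ i, f i (x i)‖) ∧
    HasSum (fun x : I → κ => ∏ i, f i (x i)) (∏ i, ∑' k, f i k) := by
  obtain ⟨h1, h2⟩ := hasSum_fin_pi fun i => hf ((Fintype.equivFin I).symm i)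
  have e : ∀ x : I → κ, ∏ i : Fin (Fintype.card I), f ((Fintype.equivFin I).symm i)
      (((Fintype.equivFin I).arrowCongr (Equiv.refl κ)) x i) = ∏ i, f i (x i) := fun x => by
    rw [← (Fintype.equivFin I).symm.prod_comp]
    rfl
  rw [(Fintype.equivFin I).symm.prod_comp fun i => ∑' k, f i k] at h2
  rw [← ((Fintype.equivFin I).arrowCongr (Equiv.refl κ)).summable_iff] at h1
  rw [← ((Fintype.equivFin I).arrowCongr (Equiv.refl κ)).hasSum_iff] at h2
  exact ⟨h1.congr fun x => by simp only [Function.comp_apply, e],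
    h2.congr_fun fun x => by simp only [Function.comp_apply, e]⟩

variable {ι : Type*}

/-! ### The partition function -/

theorem hasSum_weight_support {w : ι × ℤ → ℂ} (hw : ∀ p, ‖w p‖ < 1) (s : Finset (ι × ℤ)) :
    HasSum ({d : ι × ℤ →₀ ℕ | (d.support : Set (ι × ℤ)) ⊆ s}.indicator (weight w))
      (∏ p ∈ s, (1 - w p)⁻¹) := by
  classical
  have h := (hasSum_pi (f := fun (p : s) (r : ℕ) => w p ^ r) fun p => by
    simp only [norm_pow]; exact summable_geometric_of_lt_one (norm_nonneg _) (hw p)).2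
  simp only [tsum_geometric_of_norm_lt_one (hw _)] at h
  rw [Finset.prod_coe_sort s fun p => (1 - w p)⁻¹] at h
  let E : (s → ℕ) ≃ {d : ι × ℤ →₀ ℕ // (d.support : Set (ι × ℤ)) ⊆ s} :=
    Finsupp.equivFunOnFinite.symm.trans (Finsupp.restrictSupportEquiv (s : Set (ι × ℤ)) ℕ).symm
  have hE : ∀ g (p : s), (E g).1 p.1 = g p := fun g p => by
    have := Finsupp.restrictSupportEquiv_apply (s : Set (ι × ℤ)) ℕ (E g)
    have h2 : (Finsupp.restrictSupportEquiv (s : Set (ι × ℤ)) ℕ) (E g) =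
        Finsupp.equivFunOnFinite.symm g := by simp [E]
    rw [h2] at this
    have := DFunLike.congr_fun this p
    simpa using this.symm
  rw [← hasSum_subtype_iff_indicator]
  refine E.hasSum_iff.1 ?_
  convert! h using 1
  funext g
  rw [Function.comp_apply, Function.comp_apply, weight,
    Finsupp.prod_of_support_subset _ (Finset.coe_subset.1 (E g).2) _ (by simp),
    ← Finset.prod_coe_sort]
  simp only [hE]

/-- A vector with occupied oscillators in s N contributes to the finite product over s N. The bound
on the products for ‖w‖ gives absolute summability, and dominated convergence along the exhaustion
identifies the sum. -/
theorem hasSum_weight {w : ι × ℤ → ℂ} (hw : ∀ p, ‖w p‖ < 1) {s : ℕ → Finset (ι × ℤ)}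
    (hs : Monotone s) (hs' : ∀ p, ∃ N, p ∈ s N) {K : ℝ}
    (hK : ∀ N, ∏ p ∈ s N, (1 - ‖w p‖)⁻¹ ≤ K) {z : ℂ}
    (hz : Tendsto (fun N => ∏ p ∈ s N, (1 - w p)⁻¹) atTop (𝓝 z)) :
    (Summable fun d => ‖weight w d‖) ∧ HasSum (weight w) z := by
  classical
  have hev : ∀ d : ι × ℤ →₀ ℕ, ∃ N, ∀ n, N ≤ n → (d.support : Set (ι × ℤ)) ⊆ s n := by
    intro d
    choose N hN using hs'
    refine ⟨d.support.sup N, fun n hn p hp => ?_⟩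
    exact hs ((Finset.le_sup (f := N) hp).trans hn) (hN p)
  have hnorm : ∀ d, ‖weight w d‖ = (weight (fun p => (‖w p‖ : ℂ)) d).re := by
    intro d
    have : weight (fun p => (‖w p‖ : ℂ)) d = (‖weight w d‖ : ℂ) := by
      simp [weight, Finsupp.prod, norm_prod]
    rw [this, Complex.ofReal_re]
  have h1 : Summable fun d => ‖weight w d‖ := by
    refine summable_of_sum_le (c := K) (fun _ => norm_nonneg _) fun T => ?_
    choose N hN using hev
    set n := T.sup N
    have h2 := Complex.hasSum_re (hasSum_weight_support (w := fun p => (‖w p‖ : ℂ))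
      (fun p => by simpa using hw p) (s n))
    refine le_trans ?_ (hK n)
    have h3 : (∏ p ∈ s n, (1 - (‖w p‖ : ℂ))⁻¹).re = ∏ p ∈ s n, (1 - ‖w p‖)⁻¹ := by
      rw [← Complex.ofReal_re (∏ p ∈ s n, (1 - ‖w p‖)⁻¹)]
      push_cast
      rfl
    rw [h3] at h2
    refine le_trans (le_of_eq ?_) (sum_le_hasSum T (fun d _ => ?_) h2)
    · refine Finset.sum_congr rfl fun d hd => ?_
      rw [Set.indicator_of_mem, hnorm]
      exact hN d n (Finset.le_sup (f := N) hd)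
    · by_cases hd : d ∈ {d : ι × ℤ →₀ ℕ | (d.support : Set (ι × ℤ)) ⊆ s n}
      · rw [Set.indicator_of_mem hd, ← hnorm]; exact norm_nonneg _
      · rw [Set.indicator_of_notMem hd]; simp
  refine ⟨h1, ?_⟩
  have h4 : Tendsto (fun N => ∑' d, {d : ι × ℤ →₀ ℕ | (d.support : Set (ι × ℤ)) ⊆ s N}.indicator
      (weight w) d) atTop (𝓝 (∑' d, weight w d)) := by
    refine tendsto_tsum_of_dominated_convergence h1 (fun d => ?_) (Eventually.of_forall fun N d => ?_)
    · obtain ⟨N, hN⟩ := hev d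
      refine tendsto_const_nhds.congr' ?_
      filter_upwards [eventually_ge_atTop N] with n hn
      rw [Set.indicator_of_mem (hN n hn)]
    · exact norm_indicator_le_norm_self _ _
  simp only [(hasSum_weight_support hw (s _)).tsum_eq] at h4
  rw [tendsto_nhds_unique hz h4]
  exact h1.of_norm.hasSum

/-- The weights of the oscillators in the trace, `y α` being `e^{-α(H)}`. -/
def ghostWeight (q : ℂ) (y : ι → ℂ) (p : ι × ℤ) : ℂ :=
  if p.2 < 0 then q ^ p.2.natAbs * (y p.1)⁻¹ else q ^ p.2.natAbs * y p.1

theorem norm_ghostWeight (q : ℂ) (y : ι → ℂ) (p : ι × ℤ) :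
    (‖ghostWeight q y p‖ : ℂ) = ghostWeight (‖q‖ : ℂ) (fun a => (‖y a‖ : ℂ)) p := by
  simp only [ghostWeight]
  split_ifs <;> simp

theorem norm_ghostWeight_lt_one {q : ℂ} {y : ι → ℂ} (hq : ∀ a, ‖q‖ < ‖y a‖) (hy : ∀ a, ‖y a‖ < 1)
    (p : ι × ℤ) : ‖ghostWeight q y p‖ < 1 := by
  have hq1 := (hq p.1).trans (hy p.1)
  have h0 := (norm_nonneg q).trans_lt (hq p.1)
  rw [ghostWeight]
  split_ifs with h
  · obtain ⟨n, hn⟩ : ∃ n, p.2.natAbs = n + 1 := Nat.exists_eq_succ_of_ne_zero (by omega)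
    rw [hn, norm_mul, norm_inv, norm_pow, pow_succ, ← div_eq_mul_inv, div_lt_one h0]
    have := pow_le_one₀ (n := n) (norm_nonneg q) hq1.le
    nlinarith [norm_nonneg q, hq p.1]
  · rw [norm_mul, norm_pow]
    have := pow_le_one₀ (n := p.2.natAbs) (norm_nonneg q) hq1.le
    nlinarith [hy p.1, pow_nonneg (norm_nonneg q) p.2.natAbs]

variable [Fintype ι]

/-- The trace of `q^{T[0]} e^{H[0]}`. -/
def partitionFunction (q : ℂ) (y : ι → ℂ) : ℂ := ∏ a, (qPoch q (y a) * qPoch q (q / y a))⁻¹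

-- One exhaustion serves all (q, y), so the statement can be applied both to the given parameters
-- and to their norms. The modes -N, ..., N - 1 match the first N factors of the two Pochhammer
-- symbols.
variable (ι) in
theorem exists_tendsto_prod_ghostWeight : ∃ s : ℕ → Finset (ι × ℤ), Monotone s ∧
      (∀ p, ∃ N, p ∈ s N) ∧ ∀ (q : ℂ) (y : ι → ℂ), (∀ a, ‖q‖ < ‖y a‖) → (∀ a, ‖y a‖ < 1) → ‖q‖ < 1 →
      Tendsto (fun N => ∏ p ∈ s N, (1 - ghostWeight q y p)⁻¹) atTop (𝓝 (partitionFunction q y)) := by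
  classical
  set t : ℕ → Finset ℤ := fun N => (Finset.range N).image (fun n : ℕ => (n : ℤ)) ∪
    (Finset.range N).image (fun n : ℕ => -((n : ℤ) + 1)) with ht
  have hmem : ∀ N k, k ∈ t N ↔ -(N : ℤ) ≤ k ∧ k < N := by
    intro N k
    simp only [ht, Finset.mem_union, Finset.mem_image, Finset.mem_range]
    constructor
    · rintro (⟨n, hn, rfl⟩ | ⟨n, hn, rfl⟩) <;> omega
    · rintro ⟨h1, h2⟩
      rcases le_or_gt 0 k with h | h
      · exact Or.inl ⟨k.toNat, by omega, by omega⟩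
      · exact Or.inr ⟨(-k - 1).toNat, by omega, by omega⟩
  refine ⟨fun N => Finset.univ ×ˢ t N, fun M N hMN p hp => ?_, fun p => ⟨p.2.natAbs + 1, ?_⟩,
    fun q y hq hy hq1 => ?_⟩
  · simp only [Finset.mem_product, Finset.mem_univ, true_and, hmem] at hp ⊢
    omega
  · simp only [Finset.mem_product, Finset.mem_univ, true_and, hmem]
    omega
  · have e : ∀ N, ∏ p ∈ Finset.univ ×ˢ t N, (1 - ghostWeight q y p)⁻¹ =
        ∏ a, ((∏ n ∈ Finset.range N, (1 - y a * q ^ n)) *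
          ∏ n ∈ Finset.range N, (1 - q / y a * q ^ n))⁻¹ := by
      intro N
      rw [Finset.prod_product]
      refine Finset.prod_congr rfl fun a _ => ?_
      rw [ht, Finset.prod_union, Finset.prod_image (by simp), Finset.prod_image (by simp), mul_inv,
        ← Finset.prod_inv_distrib, ← Finset.prod_inv_distrib]
      · congr 1
        · refine Finset.prod_congr rfl fun n _ => ?_
          simp [ghostWeight, mul_comm]
        · refine Finset.prod_congr rfl fun n _ => ?_
          have h1 : -((n : ℤ) + 1) < 0 := by omega
          have h2 : (-((n : ℤ) + 1)).natAbs = n + 1 := by omega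
          simp only [ghostWeight, h1, if_true, h2]
          congr 2
          ring
      · rw [Finset.disjoint_left]
        simp only [Finset.mem_image]
        rintro k ⟨n, _, rfl⟩ ⟨n', _, h⟩
        omega
    simp only [e]
    refine tendsto_finsetProd _ fun a _ => Tendsto.inv₀ ((tendsto_qPoch hq1 _).mul (tendsto_qPoch hq1 _))
      (mul_ne_zero (qPoch_ne_zero hq1 (mul_pow_ne_one_of_norm_lt hq1 (hy a)))
        (qPoch_ne_zero hq1 (mul_pow_ne_one_of_norm_lt hq1 (norm_div_lt_one (hq a)))))

theorem hasSum_ghostWeight {q : ℂ} {y : ι → ℂ} (hq : ∀ a, ‖q‖ < ‖y a‖)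
    (hy : ∀ a, ‖y a‖ < 1) (hq1 : ‖q‖ < 1) :
    (Summable fun d => ‖weight (ghostWeight q y) d‖) ∧
      HasSum (weight (ghostWeight q y)) (partitionFunction q y) := by
  obtain ⟨s, hs, hs', h⟩ := exists_tendsto_prod_ghostWeight ι
  -- At the norms of the parameters the products converge as well, hence are bounded; this is the
  -- bound required for absolute summability.
  have h1 := h (‖q‖ : ℂ) (fun a => (‖y a‖ : ℂ)) (by simpa using hq) (by simpa using hy)
    (by simpa using hq1)
  have h2 := (Complex.continuous_re.tendsto _).comp h1
  have h3 : ∀ N, (∏ p ∈ s N, (1 - ghostWeight (‖q‖ : ℂ) (fun a => (‖y a‖ : ℂ)) p)⁻¹).re =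
      ∏ p ∈ s N, (1 - ‖ghostWeight q y p‖)⁻¹ := by
    intro N
    rw [← Complex.ofReal_re (∏ p ∈ s N, (1 - ‖ghostWeight q y p‖)⁻¹)]
    push_cast
    simp only [norm_ghostWeight]
  obtain ⟨K, hK⟩ := h2.bddAbove_range
  exact hasSum_weight (norm_ghostWeight_lt_one hq hy) hs hs'
    (fun N => by rw [← h3]; exact hK ⟨N, rfl⟩) (h q y hq hy hq1)

end GhostSystem

namespace GhostSystem
open MvPolynomial Filter Topology
open scoped ComplexOrder

section Wick

variable {ι J M : Type*}

/-! ### Traces of words in the ghost fields -/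

/-- The order of the letters in a word, `left i j` meaning that `inl j` precedes `inr i`. -/
def LetterOrder (left : M → J → Prop) : J ⊕ M → J ⊕ M → Prop
  | .inl j, .inr i => left i j
  | .inr i, .inl j => ¬ left i j
  | _, _ => True

/-- A word without repetitions that contains all letters `inl j`. -/
structure IsGhostWord (left : M → J → Prop) (L : List (J ⊕ M)) : Prop where
  nodup : L.Nodup
  mem : ∀ j, Sum.inl j ∈ L
  order : L.Pairwise (LetterOrder left)

variable {left : M → J → Prop}

theorem IsGhostWord.erase {L₁ L₂ : List (J ⊕ M)} {i : M}
    (h : IsGhostWord left (L₁ ++ Sum.inr i :: L₂)) : IsGhostWord left (L₁ ++ L₂) where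
  nodup := (List.nodup_middle.1 h.nodup).of_cons
  mem j := by simpa using h.mem j
  order := h.order.sublist (List.Sublist.append_left (List.sublist_cons_self _ _) _)

theorem IsGhostWord.left_of_mem {L₁ L₂ : List (J ⊕ M)} {i : M}
    (h : IsGhostWord left (L₁ ++ Sum.inr i :: L₂)) {j : J} (hj : Sum.inl j ∈ L₁) : left i j :=
  (List.pairwise_append.1 h.order).2.2 _ hj _ List.mem_cons_self

theorem IsGhostWord.not_left_of_mem {L₁ L₂ : List (J ⊕ M)} {i : M}
    (h : IsGhostWord left (L₁ ++ Sum.inr i :: L₂)) {j : J} (hj : Sum.inl j ∈ L₂) : ¬ left i j :=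
  (List.pairwise_cons.1 (List.pairwise_append.1 h.order).2.1).1 _ hj

theorem IsGhostWord.mem_right_iff {L₁ L₂ : List (J ⊕ M)} {i : M}
    (h : IsGhostWord left (L₁ ++ Sum.inr i :: L₂)) (j : J) : Sum.inl j ∈ L₂ ↔ Sum.inl j ∉ L₁ := by
  have h1 := h.mem j
  simp only [List.mem_append, List.mem_cons, reduceCtorEq, false_or] at h1
  constructor
  · intro h2 h3
    exact h.not_left_of_mem h2 (h.left_of_mem h3)
  · tauto

theorem IsGhostWord.exists_enum {L : List (J ⊕ M)} (h : IsGhostWord left L) :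
    ∃ (m : ℕ) (e : Fin m → M), Function.Injective e ∧ ∀ i, Sum.inr i ∈ L ↔ i ∈ Set.range e := by
  have hn : (L.filterMap Sum.getRight?).Nodup := by
    refine h.nodup.filterMap fun a a' b hb hb' => ?_
    cases a <;> cases a' <;> simp_all
  refine ⟨_, _, List.nodup_iff_injective_get.1 hn, fun i => ?_⟩
  rw [Set.mem_range, ← List.mem_iff_get, List.mem_filterMap]
  simp

open Classical in
/-- The contraction of the `i`-th `β` with the `γ` at `j`. -/
def contraction (left : M → J → Prop) (ε : ℂ) (β : M → ι × ℤ) (w : ι × ℤ → ℂ) (i : M) (j : J) : ℂ :=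
  if left i j then contractLeft ε (β i).2 (w (β i)) else contractRight ε (β i).2 (w (β i))

variable [Fintype J] [DecidableEq J]

omit [DecidableEq J] in
open Classical in
theorem IsGhostWord.sum_contraction {L₁ L₂ : List (J ⊕ M)} {i : M}
    (h : IsGhostWord left (L₁ ++ Sum.inr i :: L₂)) (ε : ℂ) (β : M → ι × ℤ) (w : ι × ℤ → ℂ)
    (T : J → ℂ) :
    contractLeft ε (β i).2 (w (β i)) * (∑ j, if Sum.inl j ∈ L₁ then T j else 0) +
      contractRight ε (β i).2 (w (β i)) * (∑ j, if Sum.inl j ∈ L₂ then T j else 0) =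
    ∑ j, contraction left ε β w i j * T j := by
  rw [Finset.mul_sum, Finset.mul_sum, ← Finset.sum_add_distrib]
  refine Finset.sum_congr rfl fun j _ => ?_
  have h2 := h.mem_right_iff j
  by_cases hj : Sum.inl j ∈ L₁
  · rw [if_pos hj, if_neg (fun h' => h2.1 h' hj), contraction, if_pos (h.left_of_mem hj)]
    ring
  · rw [if_neg hj, if_pos (h2.2 hj), contraction, if_neg (h.not_left_of_mem (h2.2 hj))]
    ring

open Classical in
theorem IsGhostWord.sum_left_mul {L₁ L₂ : List (J ⊕ M)} {i : M}
    (h : IsGhostWord left (L₁ ++ Sum.inr i :: L₂)) (ε : ℂ) (β : M → ι × ℤ)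
    (σ : J → MvPolynomial ι ℂ × ℤ) (p : ι × ℤ) :
    (∑ j, if Sum.inl j ∈ L₁ then wordOp ε β (Function.update σ j (contractData p (σ j))) L₁ else 0) *
      wordOp ε β σ L₂ = ∑ j, if Sum.inl j ∈ L₁ then
        wordOp ε β (Function.update σ j (contractData p (σ j))) (L₁ ++ L₂) else 0 := by
  rw [Finset.sum_mul]
  refine Finset.sum_congr rfl fun j _ => ?_
  split_ifs with hj
  · rw [wordOp_append, wordOp_update ε β σ (L := L₂) fun h' => (h.mem_right_iff j).1 h' hj]
  · rw [zero_mul]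

open Classical in
theorem IsGhostWord.mul_sum_right {L₁ L₂ : List (J ⊕ M)} {i : M}
    (h : IsGhostWord left (L₁ ++ Sum.inr i :: L₂)) (ε : ℂ) (β : M → ι × ℤ)
    (σ : J → MvPolynomial ι ℂ × ℤ) (p : ι × ℤ) :
    wordOp ε β σ L₁ *
      (∑ j, if Sum.inl j ∈ L₂ then wordOp ε β (Function.update σ j (contractData p (σ j))) L₂ else 0) =
      ∑ j, if Sum.inl j ∈ L₂ then
        wordOp ε β (Function.update σ j (contractData p (σ j))) (L₁ ++ L₂) else 0 := by
  rw [Finset.mul_sum]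
  refine Finset.sum_congr rfl fun j _ => ?_
  split_ifs with hj
  · rw [wordOp_append, wordOp_update ε β σ (L := L₁) ((h.mem_right_iff j).1 hj)]
  · rw [mul_zero]

/-! ### The majorant -/

def normData (x : MvPolynomial ι ℂ × ℤ) : MvPolynomial ι ℂ × ℤ := (normPoly x.1, x.2)

theorem normData_contractData (p : ι × ℤ) (x : MvPolynomial ι ℂ × ℤ) :
    normData (contractData p x) = contractData p (normData x) := by
  simp [normData, contractData, normPoly_pderiv]

omit [Fintype J] [DecidableEq J] in
theorem dominated_wordOp {ε : ℂ} (hε : ‖ε‖ ≤ 1) (β : M → ι × ℤ) (σ : J → MvPolynomial ι ℂ × ℤ)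
    (L : List (J ⊕ M)) : Dominated (wordOp ε β σ L) (wordOp 1 β (normData ∘ σ) L) := by
  induction L with
  | nil => exact dominated_one
  | cons x L ih =>
    rw [wordOp_cons, wordOp_cons]
    refine Dominated.mul ?_ ih
    cases x with
    | inl j => exact dominated_polyOp hε _ _
    | inr i => exact dominated_betaMode _ _

theorem normData_normData (x : MvPolynomial ι ℂ × ℤ) : normData (normData x) = normData x := by
  simp [normData, normPoly_normPoly]

omit [Fintype J] [DecidableEq J] in
theorem dominated_wordOp_normData (β : M → ι × ℤ) (σ : J → MvPolynomial ι ℂ × ℤ)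
    (L : List (J ⊕ M)) :
    Dominated (wordOp 1 β (normData ∘ σ) L) (wordOp 1 β (normData ∘ σ) L) := by
  have := dominated_wordOp (ε := 1) (by simp) β (normData ∘ σ) L
  rwa [← Function.comp_assoc, show (normData ∘ normData : MvPolynomial ι ℂ × ℤ → _) = normData from
    funext normData_normData] at this

theorem dataValue_normData_nonneg (x : MvPolynomial ι ℂ × ℤ) (e : (ι →₀ ℕ) × ℤ) :
    0 ≤ dataValue (normData x) e := by
  rw [dataValue]
  split_ifs
  · rw [normData, coeff_normPoly]
    refine mul_nonneg (by exact_mod_cast norm_nonneg _) (Finset.prod_nonneg fun _ _ => ?_)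
    exact Nat.cast_nonneg _
  · exact le_rfl

omit [Fintype J] [DecidableEq J] in
theorem contraction_one_nonneg (left : M → J → Prop) (β : M → ι × ℤ) {w : ι × ℤ → ℂ}
    (hw : ∀ p, 0 ≤ w p) (hw1 : ∀ p, w p < 1) (i : M) (j : J) : 0 ≤ contraction left 1 β w i j := by
  have h1 : 0 ≤ (1 - w (β i))⁻¹ := inv_nonneg.2 (sub_nonneg.2 (hw1 _).le)
  rw [contraction, contractLeft, contractRight]
  simp only [one_mul]
  split_ifs
  exacts [mul_nonneg (hw _) h1, h1, h1, mul_nonneg (hw _) h1]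

/-- The Wick expansion as an inequality, for the majorant words and for finite sets of basis vectors
closed under removing quanta. The bound does not depend on the set s. -/
theorem sum_diagTerm_wordOp_le {w : ι × ℤ → ℂ} (hw : ∀ p, 0 ≤ w p) (hw1 : ∀ p, w p < 1)
    {Z : ℂ} (hZ : ∀ s : Finset (ι × ℤ →₀ ℕ), ∑ d ∈ s, weight w d ≤ Z) (β : M → ι × ℤ)
    {s : Finset (ι × ℤ →₀ ℕ)} (hs : ∀ d p, d + Finsupp.single p 1 ∈ s → d ∈ s)
    {m : ℕ} {e : Fin m → M} (he : Function.Injective e) (σ : J → MvPolynomial ι ℂ × ℤ)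
    {L : List (J ⊕ M)} (hL : IsGhostWord left L) (hLe : ∀ i, Sum.inr i ∈ L ↔ i ∈ Set.range e) :
    ∑ d ∈ s, diagTerm (weight w) (wordOp 1 β (normData ∘ σ) L) d ≤
      ∑ f : Fin m → J, (∏ i, contraction left 1 β w (e i) (f i)) * (Z * ∏ j, dataValue
        (normData (σ j))
        (∑ i, if f i = j then ((Finsupp.single (β (e i)).1 1, (β (e i)).2) : (ι →₀ ℕ) × ℤ) else 0)) := by
  classical
  refine wick_expansion (· ≤ ·) (fun a => le_refl a) (fun _ _ _ => le_trans)
    (fun _ _ _ _ => add_le_add) (contraction left 1 β w)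
    (fun i j _ _ h => mul_le_mul_of_nonneg_left h (contraction_one_nonneg left β hw hw1 i j))
    (fun σ L => ∑ d ∈ s, diagTerm (weight w) (wordOp 1 β (normData ∘ σ) L) d)
    (fun i => contractData (β i)) (fun i => (Finsupp.single (β i).1 1, (β i).2))
    (fun x => dataValue (normData x)) (fun i x t => ?_) Z (IsGhostWord left) (fun L hL => hL.nodup)
    (fun L₁ i L₂ h => h.erase) (fun σ L₁ i L₂ h => ?_) (fun σ L hL hLi => ?_) e he σ L hL hLe
  · rw [normData_contractData, dataValue_contractData]
  · have hn1 : L₁.Nodup := h.nodup.of_append_left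
    have hn2 : L₂.Nodup := (h.nodup.of_append_right).of_cons
    have h1 := sum_diagTerm_beta_le (w := w) (b := (β i).1) (m := (β i).2) hw (hw1 _)
      (betaMode_mul_wordOp 1 β (normData ∘ σ) (β i) L₁ hn1)
      (betaMode_mul_wordOp 1 β (normData ∘ σ) (β i) L₂ hn2)
      (dominated_wordOp_normData β σ L₁) (dominated_wordOp_normData β σ L₂)
      (s := s) (fun d hd => hs d _ hd)
    rw [h.sum_left_mul, h.mul_sum_right] at h1
    have h2 : ∀ L : List (J ⊕ M), (∑ d ∈ s, diagTerm (weight w) (∑ j, if Sum.inl j ∈ L then wordOp 1 β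
        (Function.update (normData ∘ σ) j (contractData (β i) ((normData ∘ σ) j))) (L₁ ++ L₂) else 0) d) =
        ∑ j, if Sum.inl j ∈ L then ∑ d ∈ s, diagTerm (weight w) (wordOp 1 β
          (normData ∘ (Function.update σ j (contractData (β i) (σ j)))) (L₁ ++ L₂)) d else 0 := by
      intro L
      simp only [diagTerm_sum]
      rw [Finset.sum_comm]
      refine Finset.sum_congr rfl fun j _ => ?_
      split_ifs
      · rw [Function.comp_update, normData_contractData]
        rfl
      · simp [diagTerm]
    rw [h2, h2, h.sum_contraction] at h1
    rw [wordOp_append, wordOp_cons]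
    exact h1
  · simp only [diagTerm_wordOp (weight w) 1 β (normData ∘ σ) L hLi hL.nodup hL.mem]
    rw [← Finset.sum_mul]
    exact mul_le_mul_of_nonneg_right (hZ s)
      (Finset.prod_nonneg fun j _ => dataValue_normData_nonneg _ _)

theorem sum_norm_diagTerm_wordOp_le {w : ι × ℤ → ℂ} (hw1 : ∀ p, ‖w p‖ < 1)
    {Z : ℂ} (hZ : ∀ s : Finset (ι × ℤ →₀ ℕ), ∑ d ∈ s, weight (fun p => (‖w p‖ : ℂ)) d ≤ Z)
    (β : M → ι × ℤ) {ε : ℂ} (hε : ‖ε‖ ≤ 1) (s : Finset (ι × ℤ →₀ ℕ))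
    {m : ℕ} {e : Fin m → M} (he : Function.Injective e) (σ : J → MvPolynomial ι ℂ × ℤ)
    {L : List (J ⊕ M)} (hL : IsGhostWord left L) (hLe : ∀ i, Sum.inr i ∈ L ↔ i ∈ Set.range e) :
    ((∑ d ∈ s, ‖diagTerm (weight w) (wordOp ε β σ L) d‖ : ℝ) : ℂ) ≤
      ∑ f : Fin m → J, (∏ i, contraction left 1 β (fun p => (‖w p‖ : ℂ)) (e i) (f i)) *
        (Z * ∏ j, dataValue (normData (σ j))
        (∑ i, if f i = j then ((Finsupp.single (β (e i)).1 1, (β (e i)).2) : (ι →₀ ℕ) × ℤ) else 0)) := by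
  classical
  have hw0 : ∀ p, (0 : ℂ) ≤ ‖w p‖ := fun p => by exact_mod_cast norm_nonneg (w p)
  have hw1' : ∀ p, (‖w p‖ : ℂ) < 1 := fun p => by exact_mod_cast hw1 p
  have hW : ∀ d, weight (fun p => (‖w p‖ : ℂ)) d = (‖weight w d‖ : ℂ) := fun d => by
    simp [weight, Finsupp.prod, norm_prod]
  -- The closure of s under removing quanta; enlarging s is harmless because all terms of the
  -- majorant are nonnegative.
  set t := s.biUnion fun d => Finset.Icc 0 d
  have ht : ∀ d p, d + Finsupp.single p 1 ∈ t → d ∈ t := by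
    intro d p hd
    simp only [t, Finset.mem_biUnion, Finset.mem_Icc, zero_le, true_and] at hd ⊢
    obtain ⟨a, ha, h⟩ := hd
    exact ⟨a, ha, le_trans (le_self_add) h⟩
  have hst : s ⊆ t := fun d hd => Finset.mem_biUnion.2 ⟨d, hd, by simp⟩
  refine le_trans ?_ (sum_diagTerm_wordOp_le hw0 hw1' hZ β ht he σ hL hLe)
  have hnn := fun d => (dominated_wordOp_normData β σ L).diagTerm_nonneg
    (W := weight fun p => (‖w p‖ : ℂ)) (fun d => by rw [hW]; exact_mod_cast norm_nonneg _) d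
  refine le_trans ?_ (Finset.sum_le_sum_of_subset_of_nonneg hst fun d _ _ => hnn d)
  push_cast
  refine Finset.sum_le_sum fun d _ => ?_
  obtain ⟨r, h1, h2⟩ := dominated_wordOp hε β σ L d d
  rw [diagTerm, diagTerm, h1, hW, norm_mul]
  exact_mod_cast mul_le_mul_of_nonneg_right h2 (norm_nonneg _)

/-! ### The trace of a word -/

theorem summable_diagTerm_wordOp {w : ι × ℤ → ℂ} (hw1 : ∀ p, ‖w p‖ < 1)
    {Z : ℂ} (hZ : ∀ s : Finset (ι × ℤ →₀ ℕ), ∑ d ∈ s, weight (fun p => (‖w p‖ : ℂ)) d ≤ Z)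
    (β : M → ι × ℤ) {ε : ℂ} (hε : ‖ε‖ ≤ 1) (σ : J → MvPolynomial ι ℂ × ℤ)
    {L : List (J ⊕ M)} (hL : IsGhostWord left L) :
    Summable fun d => ‖diagTerm (weight w) (wordOp ε β σ L) d‖ := by
  obtain ⟨m, e, he, hLe⟩ := hL.exists_enum
  classical
  have h := fun s => (Complex.le_def.1 (sum_norm_diagTerm_wordOp_le hw1 hZ β hε s he σ hL hLe)).1
  simp only [Complex.ofReal_re] at h
  exact summable_of_sum_le (fun _ => norm_nonneg _) h

/-- Wick's theorem for the trace of a word. The summability needed at each removal of a β is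
supplied by the majorant, which applies to all words that arise. -/
theorem tsum_diagTerm_wordOp {w : ι × ℤ → ℂ} (hw1 : ∀ p, ‖w p‖ < 1)
    {Z : ℂ} (hZ : ∀ s : Finset (ι × ℤ →₀ ℕ), ∑ d ∈ s, weight (fun p => (‖w p‖ : ℂ)) d ≤ Z)
    (β : M → ι × ℤ) {ε : ℂ} (hε : ‖ε‖ ≤ 1)
    {m : ℕ} {e : Fin m → M} (he : Function.Injective e) (σ : J → MvPolynomial ι ℂ × ℤ)
    {L : List (J ⊕ M)} (hL : IsGhostWord left L) (hLe : ∀ i, Sum.inr i ∈ L ↔ i ∈ Set.range e) :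
    ∑' d, diagTerm (weight w) (wordOp ε β σ L) d =
      ∑ f : Fin m → J, (∏ i, contraction left ε β w (e i) (f i)) * ((∑' d, weight w d) *
        ∏ j, dataValue (σ j)
        (∑ i, if f i = j then ((Finsupp.single (β (e i)).1 1, (β (e i)).2) : (ι →₀ ℕ) × ℤ) else 0)) := by
  classical
  have hsum := fun (σ : J → MvPolynomial ι ℂ × ℤ) (L : List (J ⊕ M)) (hL : IsGhostWord left L) =>
    (summable_diagTerm_wordOp hw1 hZ β hε σ hL).of_norm
  refine wick_expansion (· = ·) (fun a => rfl) (fun _ _ _ => Eq.trans)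
    (fun _ _ _ _ h h' => by rw [h, h']) (contraction left ε β w)
    (fun i j _ _ h => by rw [h])
    (fun σ L => ∑' d, diagTerm (weight w) (wordOp ε β σ L) d)
    (fun i => contractData (β i)) (fun i => (Finsupp.single (β i).1 1, (β i).2))
    dataValue (fun i x t => dataValue_contractData _ _ _) _ (IsGhostWord left) (fun L hL => hL.nodup)
    (fun L₁ i L₂ h => h.erase) (fun σ L₁ i L₂ h => ?_) (fun σ L hL hLi => ?_) e he σ L hL hLe
  · have hn1 : L₁.Nodup := h.nodup.of_append_left
    have hn2 : L₂.Nodup := (h.nodup.of_append_right).of_cons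
    have h2 : ∀ L : List (J ⊕ M), HasSum (diagTerm (weight w) (∑ j, if Sum.inl j ∈ L then wordOp ε β
        (Function.update σ j (contractData (β i) (σ j))) (L₁ ++ L₂) else 0))
        (∑ j, if Sum.inl j ∈ L then ∑' d, diagTerm (weight w) (wordOp ε β
          (Function.update σ j (contractData (β i) (σ j))) (L₁ ++ L₂)) d else 0) := by
      intro L
      rw [show diagTerm (weight w) (∑ j, if Sum.inl j ∈ L then wordOp ε β
        (Function.update σ j (contractData (β i) (σ j))) (L₁ ++ L₂) else 0) = _ from
        funext fun d => diagTerm_sum _ _ _ d]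
      refine hasSum_sum fun j _ => ?_
      split_ifs
      · exact (hsum _ _ h.erase).hasSum
      · convert! hasSum_zero using 1
        funext d
        simp [diagTerm]
    have h1 := tsum_diagTerm_beta (w := w) (b := (β i).1) (m := (β i).2) (A := wordOp ε β σ L₁)
      (B := wordOp ε β σ L₂) (ε := ε)
      (fun h => by have := hw1 (β i); rw [show w (β i) = 1 from h] at this; simp at this)
      (betaMode_mul_wordOp ε β σ (β i) L₁ hn1)
      (betaMode_mul_wordOp ε β σ (β i) L₂ hn2)
      (by
        have := hsum σ _ h
        rwa [wordOp_append, wordOp_cons] at this)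
      (by rw [h.sum_left_mul]; exact (h2 L₁).summable)
      (by rw [h.mul_sum_right]; exact (h2 L₂).summable)
    rw [h.sum_left_mul, h.mul_sum_right, (h2 L₁).tsum_eq, (h2 L₂).tsum_eq, h.sum_contraction] at h1
    rw [wordOp_append, wordOp_cons]
    exact h1
  · simp only [diagTerm_wordOp (weight w) ε β σ L hLi hL.nodup hL.mem]
    rw [tsum_mul_right]

end Wick

end GhostSystem

namespace GhostSystem
open MvPolynomial Filter Topology
open scoped ComplexOrder

/-! ### Summation over the modes -/

section ModeSums

variable {ι J : Type*}

/-- The value at the origin of the derivative `∂^e Q`. -/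
def derivativeAtZero (Q : MvPolynomial ι ℂ) (e : ι →₀ ℕ) : ℂ :=
  Q.coeff e * (e.prod fun _ r => (r.factorial : ℂ))

theorem derivativeAtZero_eq_zero {Q : MvPolynomial ι ℂ} {b : ι} (h : pderiv b Q = 0) {e : ι →₀ ℕ}
    (he : e b ≠ 0) : derivativeAtZero Q e = 0 := by
  have h1 := congrArg (coeff (e - Finsupp.single b 1)) h
  rw [coeff_pderiv, coeff_zero] at h1
  have h2 : e - Finsupp.single b 1 + Finsupp.single b 1 = e :=
    tsub_add_cancel_of_le (Finsupp.single_le_iff.2 (Nat.one_le_iff_ne_zero.2 he))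
  rw [h2] at h1
  rw [derivativeAtZero]
  rcases mul_eq_zero.1 h1 with h1 | h1
  · rw [h1, zero_mul]
  · exact absurd h1 (Nat.cast_add_one_ne_zero _)

theorem dataValue_eq (Q : MvPolynomial ι ℂ) (k : ℤ) (e : (ι →₀ ℕ) × ℤ) :
    dataValue (Q, k) e = if k + e.2 = 0 then derivativeAtZero Q e.1 else 0 := rfl

variable [Fintype J] [DecidableEq J] {m : ℕ}

/-- The number of contractions with each of the `β`'s at the vertex `j`. -/
def incidence (b : Fin m → ι) (f : Fin m → J) (j : J) : ι →₀ ℕ :=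
  ∑ i, if f i = j then Finsupp.single (b i) 1 else 0

omit [Fintype J] in
theorem sum_ite_prod_mk (b : Fin m → ι) (μ : Fin m → ℤ) (f : Fin m → J) (j : J) :
    (∑ i, if f i = j then ((Finsupp.single (b i) 1, μ i) : (ι →₀ ℕ) × ℤ) else 0) =
      (incidence b f j, ∑ i, if f i = j then μ i else 0) := by
  refine Prod.ext ?_ ?_
  · rw [Prod.fst_sum]
    exact Finset.sum_congr rfl fun i _ => by split_ifs <;> rfl
  · rw [Prod.snd_sum]
    exact Finset.sum_congr rfl fun i _ => by split_ifs <;> rfl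

omit [Fintype J] in
theorem prod_zpow_sum (f : Fin m → J) (μ : Fin m → ℤ) {x : J → ℂ} (hx : ∀ j, x j ≠ 0)
    (s : Finset J) (hs : ∀ i, f i ∈ s) :
    ∏ j ∈ s, x j ^ (∑ i, if f i = j then μ i else 0) = ∏ i, x (f i) ^ μ i := by
  have h : ∀ j, x j ^ (∑ i, if f i = j then μ i else 0) =
      ∏ i, x j ^ (if f i = j then μ i else 0) := fun j => by
    induction (Finset.univ : Finset (Fin m)) using Finset.induction_on with
    | empty => simp
    | insert a s ha ih => rw [Finset.sum_insert ha, Finset.prod_insert ha, zpow_add₀ (hx j), ih]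
  simp only [h]
  rw [Finset.prod_comm]
  refine Finset.prod_congr rfl fun i _ => ?_
  rw [Finset.prod_eq_single_of_mem (f i) (hs i) fun j _ hj => by rw [if_neg (Ne.symm hj), zpow_zero],
    if_pos rfl]

/-- For a fixed diagram f the mode of the polynomial at j must cancel the modes of the β's
contracted there, so only the modes μ of the β's remain free, and the sum over them factorizes over
i. Summability is demanded only if the derivatives at 0 do not vanish; this leaves out
self-contractions, for which the sum over μ may diverge. -/
theorem hasSum_contraction (b : Fin m → ι) (f : Fin m → J) {x : J → ℂ} (hx : ∀ j, x j ≠ 0)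
    (t : Fin m → ℂ) (Q : J → MvPolynomial ι ℂ) (C : Fin m → ℤ → ℂ)
    (hC : ∏ j, derivativeAtZero (Q j) (incidence b f j) ≠ 0 →
      ∀ i, Summable fun μ : ℤ => ‖t i ^ (-μ - 1) * x (f i) ^ μ * C i μ‖) :
    HasSum (fun p : (J → ℤ) × (Fin m → ℤ) => (∏ j, x j ^ (-p.1 j)) * (∏ i, t i ^ (-p.2 i - 1)) *
      ((∏ i, C i (p.2 i)) * ∏ j, dataValue (Q j, p.1 j)
        (∑ i, if f i = j then ((Finsupp.single (b i) 1, p.2 i) : (ι →₀ ℕ) × ℤ) else 0)))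
      ((∏ i, ∑' μ : ℤ, t i ^ (-μ - 1) * x (f i) ^ μ * C i μ) *
        ∏ j, derivativeAtZero (Q j) (incidence b f j)) := by
  simp only [sum_ite_prod_mk, dataValue_eq]
  by_cases h0 : ∏ j, derivativeAtZero (Q j) (incidence b f j) = 0
  · rw [h0, mul_zero]
    obtain ⟨j, -, hj⟩ := Finset.prod_eq_zero_iff.1 h0
    convert! hasSum_zero using 1
    funext p
    exact mul_eq_zero_of_right _ (mul_eq_zero_of_right _ (Finset.prod_eq_zero (Finset.mem_univ j)
      (by rw [hj, ite_self])))
  · set g : (Fin m → ℤ) → (J → ℤ) × (Fin m → ℤ) :=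
      fun μ => (fun j => -∑ i, if f i = j then μ i else 0, μ)
    have hg : Function.Injective g := fun a a' h => congrArg Prod.snd h
    rw [← hg.hasSum_iff]
    · convert! (hasSum_pi (hC h0)).2.mul_right (∏ j, derivativeAtZero (Q j) (incidence b f j)) using 1
      funext μ
      simp only [Function.comp_apply, g, neg_neg, neg_add_cancel, if_true]
      rw [prod_zpow_sum f μ hx Finset.univ fun i => Finset.mem_univ _, Finset.prod_mul_distrib,
        Finset.prod_mul_distrib]
      ring
    · rintro ⟨k, μ⟩ hp
      have : ∃ j, k j + ∑ i, (if f i = j then μ i else 0) ≠ 0 := by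
        by_contra! h
        exact hp ⟨μ, Prod.ext (funext fun j => (eq_neg_of_add_eq_zero_left (h j)).symm) rfl⟩
      obtain ⟨j, hj⟩ := this
      exact mul_eq_zero_of_right _ (mul_eq_zero_of_right _ (Finset.prod_eq_zero (Finset.mem_univ j)
        (if_neg hj)))

end ModeSums

/-! ### Propagators as Laurent expansions of the Kronecker function -/

section Contractions

variable {ι J M : Type*} {q : ℂ} {y : ι → ℂ}

theorem ghostWeight_eq_zpow (b : ι) (m : ℤ) :
    ghostWeight q y (b, m) = if m < 0 then (y b * q ^ m)⁻¹ else y b * q ^ m := by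
  rw [ghostWeight]
  split_ifs with hm <;> simp only at hm
  · obtain ⟨k, rfl⟩ : ∃ k : ℕ, m = -k := ⟨m.natAbs, by omega⟩
    simp
  · obtain ⟨k, rfl⟩ : ∃ k : ℕ, m = k := ⟨m.natAbs, by omega⟩
    simp [mul_comm]

theorem mul_zpow_ne_one (hq : ∀ a, ‖q‖ < ‖y a‖) (hy : ∀ a, ‖y a‖ < 1) (b : ι) (m : ℤ) :
    y b * q ^ m ≠ 1 := by
  intro h
  have h1 := norm_ghostWeight_lt_one hq hy (b, m)
  rw [ghostWeight_eq_zpow, h] at h1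
  simp at h1

theorem contractLeft_ghostWeight (hq0 : q ≠ 0) (hq : ∀ a, ‖q‖ < ‖y a‖) (hy : ∀ a, ‖y a‖ < 1) (b : ι)
    (m : ℤ) : contractLeft (-1) m (ghostWeight q y (b, m)) = y b * q ^ m / (1 - y b * q ^ m) := by
  have h1 : y b * q ^ m ≠ 0 :=
    mul_ne_zero (norm_pos_iff.1 ((norm_nonneg q).trans_lt (hq b))) (zpow_ne_zero _ hq0)
  have h2 : y b * q ^ m ≠ 1 := mul_zpow_ne_one hq hy b m
  rw [ghostWeight_eq_zpow, contractLeft]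
  generalize y b * q ^ m = u at *
  by_cases hm : m < 0
  · rw [if_neg (not_le.2 hm), if_pos hm]
    have h3 : 1 - u⁻¹ ≠ 0 := sub_ne_zero.2 fun h => h2 (inv_eq_one.1 h.symm)
    have h4 : 1 - u ≠ 0 := sub_ne_zero.2 h2.symm
    field_simp
    ring
  · rw [if_pos (not_lt.1 hm), if_neg hm]
    rfl

theorem contractRight_ghostWeight (hq0 : q ≠ 0) (hq : ∀ a, ‖q‖ < ‖y a‖) (hy : ∀ a, ‖y a‖ < 1) (b : ι)
    (m : ℤ) : contractRight (-1) m (ghostWeight q y (b, m)) = 1 / (1 - y b * q ^ m) := by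
  have h1 : y b * q ^ m ≠ 0 :=
    mul_ne_zero (norm_pos_iff.1 ((norm_nonneg q).trans_lt (hq b))) (zpow_ne_zero _ hq0)
  have h2 : y b * q ^ m ≠ 1 := mul_zpow_ne_one hq hy b m
  rw [ghostWeight_eq_zpow, contractRight]
  generalize y b * q ^ m = u at *
  by_cases hm : m < 0
  · rw [if_neg (not_le.2 hm), if_pos hm]
    have h3 : 1 - u⁻¹ ≠ 0 := sub_ne_zero.2 fun h => h2 (inv_eq_one.1 h.symm)
    have h4 : 1 - u ≠ 0 := sub_ne_zero.2 h2.symm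
    field_simp
    ring
  · rw [if_pos (not_lt.1 hm), if_neg hm, one_div]

theorem hasSum_contractLeft (hq0 : q ≠ 0) (hq : ∀ a, ‖q‖ < ‖y a‖) (hy : ∀ a, ‖y a‖ < 1) (b : ι)
    {x t : ℂ} (ht : t ≠ 0) (h : ‖t‖ < ‖x‖) (h' : ‖x‖ * ‖q‖ < ‖t‖) :
    HasSum (fun m : ℤ => t ^ (-m - 1) * x ^ m * contractLeft (-1) m (ghostWeight q y (b, m)))
      (t⁻¹ * kronecker q (y b) (x / t)) := by
  have ht' := norm_pos_iff.2 ht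
  convert! (hasSum_kronecker' hq0 (hq b) (hy b) (v := x / t) ?_ ?_).mul_left t⁻¹ using 1
  · funext m
    rw [contractLeft_ghostWeight hq0 hq hy, div_zpow, sub_eq_add_neg, zpow_add₀ ht, zpow_neg,
      zpow_neg_one]
    field_simp
  · rwa [norm_div, one_lt_div ht']
  · rwa [norm_mul, norm_div, div_mul_eq_mul_div, div_lt_one ht']

theorem hasSum_contractRight (hq0 : q ≠ 0) (hq : ∀ a, ‖q‖ < ‖y a‖) (hy : ∀ a, ‖y a‖ < 1) (b : ι)
    {x t : ℂ} (ht : t ≠ 0) (h : ‖x‖ < ‖t‖) (h' : ‖q‖ * ‖t‖ < ‖x‖) :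
    HasSum (fun m : ℤ => t ^ (-m - 1) * x ^ m * contractRight (-1) m (ghostWeight q y (b, m)))
      (t⁻¹ * kronecker q (y b) (x / t)) := by
  have ht' := norm_pos_iff.2 ht
  convert! (hasSum_kronecker hq0 (hq b) (hy b) (v := x / t) ?_ ?_).mul_left t⁻¹ using 1
  · funext m
    rw [contractRight_ghostWeight hq0 hq hy, div_zpow, sub_eq_add_neg, zpow_add₀ ht, zpow_neg,
      zpow_neg_one]
    field_simp
  · rwa [norm_div, lt_div_iff₀ ht']
  · rwa [norm_div, div_lt_one ht']

/-- The sign change in the majorant does not affect the size of the contractions, so the majorant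
converges on the same annuli. -/
theorem norm_contraction_one (left : M → J → Prop) (β : M → ι × ℤ) (w : ι × ℤ → ℂ) (i : M) (j : J) :
    ‖contraction left 1 β w i j‖ = ‖contraction left (-1) β w i j‖ := by
  simp only [contraction, contractLeft, contractRight]
  split_ifs <;> simp

theorem hasSum_contraction_kernel {left : M → J → Prop} (hq0 : q ≠ 0) (hq : ∀ a, ‖q‖ < ‖y a‖)
    (hy : ∀ a, ‖y a‖ < 1) (b : ι) {i : M} {j : J} {x t : ℂ} (ht : t ≠ 0)
    (h : (left i j → ‖t‖ < ‖x‖ ∧ ‖x‖ * ‖q‖ < ‖t‖) ∧ (¬ left i j → ‖x‖ < ‖t‖ ∧ ‖q‖ * ‖t‖ < ‖x‖)) :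
    HasSum (fun μ : ℤ => t ^ (-μ - 1) * x ^ μ *
      contraction left (-1) (fun _ => (b, μ)) (ghostWeight q y) i j)
      (t⁻¹ * kronecker q (y b) (x / t)) := by
  by_cases hl : left i j
  · simpa only [contraction, if_pos hl] using
      hasSum_contractLeft hq0 hq hy b ht (h.1 hl).1 (h.1 hl).2
  · simpa only [contraction, if_neg hl] using
      hasSum_contractRight hq0 hq hy b ht (h.2 hl).1 (h.2 hl).2

end Contractions

/-! ### Absolutely convergent sums of traces over all modes -/

section Fine

variable {ι J : Type*} [Fintype ι] [Fintype J] [DecidableEq J] {m : ℕ} {q : ℂ} {y : ι → ℂ}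

omit [Fintype ι] [DecidableEq J] in
theorem prod_derivativeAtZero_normPoly_ne_zero (Q : J → MvPolynomial ι ℂ) (e : J → ι →₀ ℕ)
    (h : ∏ j, derivativeAtZero (normPoly (Q j)) (e j) ≠ 0) :
    ∏ j, derivativeAtZero (Q j) (e j) ≠ 0 := by
  refine Finset.prod_ne_zero_iff.2 fun j hj h0 => Finset.prod_ne_zero_iff.1 h j hj ?_
  rw [derivativeAtZero, mul_eq_zero] at h0 ⊢
  refine h0.imp_left fun h1 => ?_
  rw [coeff_normPoly, h1]
  simp

/-- The conditions on the positions of the fields under which the traces of words in the modes can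
be summed over the modes. -/
structure IsRadiallyOrdered (left : Fin m → J → Prop) (q : ℂ) (y : ι → ℂ) (x : J → ℂ) (t : Fin m → ℂ)
    (own : Fin m → J) : Prop where
  q_ne_zero : q ≠ 0
  norm_q_lt : ‖q‖ < 1
  norm_q_lt_y : ∀ a, ‖q‖ < ‖y a‖
  norm_y_lt : ∀ a, ‖y a‖ < 1
  x_ne_zero : ∀ j, x j ≠ 0
  t_ne_zero : ∀ i, t i ≠ 0
  order : ∀ i j, j ≠ own i → (left i j → ‖t i‖ < ‖x j‖ ∧ ‖x j‖ * ‖q‖ < ‖t i‖) ∧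
    (¬ left i j → ‖x j‖ < ‖t i‖ ∧ ‖q‖ * ‖t i‖ < ‖x j‖)

omit [Fintype ι] [Fintype J] [DecidableEq J] in
theorem IsRadiallyOrdered.norm {left : Fin m → J → Prop} {x : J → ℂ} {t : Fin m → ℂ}
    {own : Fin m → J} (h : IsRadiallyOrdered left q y x t own) :
    IsRadiallyOrdered left (‖q‖ : ℂ) (fun a => (‖y a‖ : ℂ)) (fun j => (‖x j‖ : ℂ))
      (fun i => (‖t i‖ : ℂ)) own where
  q_ne_zero := by simpa using h.q_ne_zero
  norm_q_lt := by simpa using h.norm_q_lt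
  norm_q_lt_y := by simpa using h.norm_q_lt_y
  norm_y_lt := by simpa using h.norm_y_lt
  x_ne_zero := by simpa using h.x_ne_zero
  t_ne_zero := by simpa using h.t_ne_zero
  order := by simpa using h.order

omit [Fintype ι] in
-- A contraction of β_(b i) with its own coefficient polynomial would differentiate that polynomial
-- by its absent variable b i.
theorem ne_own_of_prod_ne_zero {b : Fin m → ι} {Q : J → MvPolynomial ι ℂ} {own : Fin m → J}
    (hQ : ∀ i, pderiv (b i) (Q (own i)) = 0) {f : Fin m → J}
    (h : ∏ j, derivativeAtZero (Q j) (incidence b f j) ≠ 0) (i : Fin m) : f i ≠ own i := by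
  intro hi
  refine Finset.prod_ne_zero_iff.1 h (own i) (Finset.mem_univ _) (derivativeAtZero_eq_zero (hQ i) ?_)
  rw [incidence, Finsupp.finsetSum_apply]
  refine ne_of_gt (Finset.sum_pos' (fun _ _ => Nat.zero_le _) ⟨i, Finset.mem_univ _, ?_⟩)
  rw [if_pos hi]
  simp

-- The trace of a word, with every mode summed. Absolute summability over modes and basis vectors
-- jointly is proved first from the majorant; only then may the trace be taken for fixed modes by
-- Wick's theorem and the sum over the modes be evaluated diagram by diagram.
set_option maxHeartbeats 1000000 in
theorem hasSum_wordOp {left : Fin m → J → Prop} {x : J → ℂ} {t : Fin m → ℂ} {own : Fin m → J}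
    (h : IsRadiallyOrdered left q y x t own) {L : List (J ⊕ Fin m)} (hL : IsGhostWord left L)
    (hLm : ∀ i, Sum.inr i ∈ L) {b : Fin m → ι} {Q : J → MvPolynomial ι ℂ}
    (hQ : ∀ i, pderiv (b i) (Q (own i)) = 0) :
    HasSum (fun p : ((J → ℤ) × (Fin m → ℤ)) × (ι × ℤ →₀ ℕ) =>
      (∏ j, x j ^ (-p.1.1 j)) * (∏ i, t i ^ (-p.1.2 i - 1)) *
      diagTerm (weight (ghostWeight q y)) (wordOp (-1) (fun i => (b i, p.1.2 i))
        (fun j => (Q j, p.1.1 j)) L) p.2)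
      (partitionFunction q y * ∑ f : Fin m → J,
        (∏ i, (t i)⁻¹ * kronecker q (y (b i)) (x (f i) / t i)) *
          ∏ j, derivativeAtZero (Q j) (incidence b f j)) := by
  have hw1 := norm_ghostWeight_lt_one h.norm_q_lt_y h.norm_y_lt
  obtain ⟨hZs, hZ⟩ := hasSum_ghostWeight h.norm_q_lt_y h.norm_y_lt h.norm_q_lt
  set w := ghostWeight q y with hw
  set Z' : ℂ := ((∑' d, ‖weight w d‖ : ℝ) : ℂ) with hZ'
  have hZb : ∀ s : Finset (ι × ℤ →₀ ℕ), ∑ d ∈ s, weight (fun p => (‖w p‖ : ℂ)) d ≤ Z' := by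
    intro s
    have hW : ∀ d, weight (fun p => (‖w p‖ : ℂ)) d = (‖weight w d‖ : ℂ) := fun d => by
      simp [weight, Finsupp.prod, norm_prod]
    simp only [hW, hZ']
    exact_mod_cast hZs.sum_le_tsum s fun _ _ => norm_nonneg _
  have hid : ∀ i : Fin m, Sum.inr i ∈ L ↔ i ∈ Set.range id := fun i => by simp [hLm i]
  -- the sum of the contractions
  have hG : ∀ f : Fin m → J, HasSum (fun p : (J → ℤ) × (Fin m → ℤ) =>
      (∏ j, x j ^ (-p.1 j)) * (∏ i, t i ^ (-p.2 i - 1)) *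
      ((∏ i, contraction left (-1) (fun i' => (b i', p.2 i)) w i (f i)) * ∏ j, dataValue (Q j, p.1 j)
        (∑ i, if f i = j then ((Finsupp.single (b i) 1, p.2 i) : (ι →₀ ℕ) × ℤ) else 0)))
      ((∏ i, (t i)⁻¹ * kronecker q (y (b i)) (x (f i) / t i)) *
          ∏ j, derivativeAtZero (Q j) (incidence b f j)) := by
    intro f
    have hk := fun (h0 : ∏ j, derivativeAtZero (Q j) (incidence b f j) ≠ 0) i =>
      hasSum_contraction_kernel (left := left) h.q_ne_zero h.norm_q_lt_y h.norm_y_lt (b i)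
        (h.t_ne_zero i) (h.order i (f i) (ne_own_of_prod_ne_zero hQ h0 i))
    convert! hasSum_contraction b f h.x_ne_zero t Q
      (fun i μ => contraction left (-1) (fun i' => (b i', μ)) w i (f i))
      (fun h0 i => (hk h0 i).summable.norm) using 1
    by_cases h0 : ∏ j, derivativeAtZero (Q j) (incidence b f j) = 0
    · rw [h0, mul_zero, mul_zero]
    · rw [Finset.prod_congr rfl fun i _ => (hk h0 i).tsum_eq.symm]
      rfl
  -- the sum of the majorants
  have hM : ∀ f : Fin m → J, Summable (fun p : (J → ℤ) × (Fin m → ℤ) =>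
      (∏ j, (‖x j‖ : ℂ) ^ (-p.1 j)) * (∏ i, (‖t i‖ : ℂ) ^ (-p.2 i - 1)) *
      ((∏ i, contraction left 1 (fun i' => (b i', p.2 i)) (fun p => (‖w p‖ : ℂ)) i (f i)) *
        ∏ j, dataValue (normPoly (Q j), p.1 j)
        (∑ i, if f i = j then ((Finsupp.single (b i) 1, p.2 i) : (ι →₀ ℕ) × ℤ) else 0))) := by
    intro f
    refine (hasSum_contraction b f h.norm.x_ne_zero _ (fun j => normPoly (Q j))
      (fun i μ => contraction left 1 (fun i' => (b i', μ)) (fun p => (‖w p‖ : ℂ)) i (f i))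
      (fun h0 i => ?_)).summable
    have h1 := (hasSum_contraction_kernel (left := left) h.norm.q_ne_zero h.norm.norm_q_lt_y
      h.norm.norm_y_lt (b i) (h.norm.t_ne_zero i) (h.norm.order i (f i) (ne_own_of_prod_ne_zero hQ
        (prod_derivativeAtZero_normPoly_ne_zero _ _ h0) i))).summable.norm
    convert! h1 using 2 with μ
    rw [norm_mul, norm_mul _ (contraction _ _ _ _ _ _), norm_contraction_one, hw]
    simp only [norm_ghostWeight]
    rfl
  have hsum : Summable fun p : ((J → ℤ) × (Fin m → ℤ)) × (ι × ℤ →₀ ℕ) =>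
      ‖(∏ j, x j ^ (-p.1.1 j)) * (∏ i, t i ^ (-p.1.2 i - 1)) *
      diagTerm (weight w) (wordOp (-1) (fun i => (b i, p.1.2 i))
        (fun j => (Q j, p.1.1 j)) L) p.2‖ := by
    refine (summable_prod_of_nonneg fun _ => norm_nonneg _).2 ⟨fun p => ?_, ?_⟩
    · simp only [norm_mul]
      exact (summable_diagTerm_wordOp hw1 hZb _ (by simp) _ hL).mul_left _
    · have hM' := Complex.reCLM.summable ((summable_sum fun f (_ : f ∈ Finset.univ) => hM f).mul_left Z')
      -- For fixed modes, the sum of norms over basis vectors is at most Z' times the majorant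
      -- contractions, whose sum over the modes converges by `hM`.
      refine Summable.of_nonneg_of_le (fun p => tsum_nonneg fun _ => norm_nonneg _) (fun p => ?_) hM'
      refine Real.tsum_le_of_sum_le (fun _ => norm_nonneg _) fun s => ?_
      have h1 := sum_norm_diagTerm_wordOp_le hw1 hZb (fun i => (b i, p.2 i)) (ε := -1) (by simp) s
        Function.injective_id (fun j => (Q j, p.1 j)) hL hid
      have h2 : (0 : ℂ) ≤ ((∏ j, ‖x j‖ ^ (-p.1 j)) * (∏ i, ‖t i‖ ^ (-p.2 i - 1)) : ℝ) := by
        have : (0:ℝ) ≤ (∏ j, ‖x j‖ ^ (-p.1 j)) * (∏ i, ‖t i‖ ^ (-p.2 i - 1)) := by positivity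
        exact_mod_cast this
      have h3 := (Complex.le_def.1 (mul_le_mul_of_nonneg_left h1 h2)).1
      rw [← Complex.ofReal_mul, Complex.ofReal_re] at h3
      refine le_trans (le_of_eq ?_) (h3.trans (le_of_eq ?_))
      · rw [Finset.mul_sum]
        simp only [norm_mul, norm_prod, norm_zpow]
      · rw [Complex.reCLM_apply]
        congr 1
        rw [Finset.mul_sum, Finset.mul_sum]
        refine Finset.sum_congr rfl fun f _ => ?_
        push_cast
        simp only [id, normData, contraction]
        ring
  have h1 := hsum.of_norm.hasSum.prod_fiberwise (g := fun p : (J → ℤ) × (Fin m → ℤ) =>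
    (∏ j, x j ^ (-p.1 j)) * (∏ i, t i ^ (-p.2 i - 1)) * ∑' d, diagTerm (weight w)
      (wordOp (-1) (fun i => (b i, p.2 i)) (fun j => (Q j, p.1 j)) L) d)
    (fun p => (summable_diagTerm_wordOp hw1 hZb _ (by simp) _ hL).of_norm.hasSum.mul_left _)
  have h2 : HasSum (fun p : (J → ℤ) × (Fin m → ℤ) =>
      (∏ j, x j ^ (-p.1 j)) * (∏ i, t i ^ (-p.2 i - 1)) * ∑' d, diagTerm (weight w)
      (wordOp (-1) (fun i => (b i, p.2 i)) (fun j => (Q j, p.1 j)) L) d)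
      (partitionFunction q y * ∑ f : Fin m → J,
        (∏ i, (t i)⁻¹ * kronecker q (y (b i)) (x (f i) / t i)) *
          ∏ j, derivativeAtZero (Q j) (incidence b f j)) := by
    convert! (hasSum_sum fun f (_ : f ∈ Finset.univ) => hG f).mul_left (partitionFunction q y) using 1
    funext p
    rw [tsum_diagTerm_wordOp hw1 hZb (fun i => (b i, p.2 i)) (ε := -1) (by simp)
      Function.injective_id (fun j => (Q j, p.1 j)) hL hid, hZ.tsum_eq, Finset.mul_sum,
      Finset.mul_sum]
    refine Finset.sum_congr rfl fun f _ => ?_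
    simp only [id, contraction]
    ring
  rw [← h1.unique h2]
  exact hsum.of_norm.hasSum

end Fine
end GhostSystem

namespace GhostSystem
open MvPolynomial Filter Topology

/-! ### Locally finite sums of operators -/

section FiniteExpansion

variable {ι K K' : Type*}

/-- `B` is the locally finite sum of the operators `A k`. -/
def IsFiniteExpansion (A : K → Module.End ℂ (Fock ι)) (B : Module.End ℂ (Fock ι)) : Prop :=
  ∀ v, ∃ s : Finset K, (∀ k ∉ s, A k v = 0) ∧ B v = ∑ k ∈ s, A k v

theorem IsFiniteExpansion.mul {A : K → Module.End ℂ (Fock ι)} {B : Module.End ℂ (Fock ι)}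
    {A' : K' → Module.End ℂ (Fock ι)} {B' : Module.End ℂ (Fock ι)} (h : IsFiniteExpansion A B)
    (h' : IsFiniteExpansion A' B') :
    IsFiniteExpansion (fun k : K × K' => A k.1 * A' k.2) (B * B') := by
  classical
  intro v
  obtain ⟨s', hs', hB'⟩ := h' v
  choose s hs hB using h
  refine ⟨(s'.biUnion fun k' => s (A' k' v)) ×ˢ s', fun k hk => ?_, ?_⟩
  · rw [Module.End.mul_apply]
    by_cases hk' : k.2 ∈ s'
    · refine hs _ _ fun hk1 => hk (Finset.mem_product.2 ⟨Finset.mem_biUnion.2 ⟨_, hk', hk1⟩, hk'⟩)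
    · rw [hs' _ hk', map_zero]
  · rw [Module.End.mul_apply, hB', map_sum, Finset.sum_product_right]
    refine Finset.sum_congr rfl fun k' hk' => ?_
    rw [hB]
    exact Finset.sum_subset (fun k hk => Finset.mem_biUnion.2 ⟨k', hk', hk⟩)
      fun k _ hk => hs _ _ hk

theorem IsFiniteExpansion.equiv {A : K → Module.End ℂ (Fock ι)} {B : Module.End ℂ (Fock ι)}
    (h : IsFiniteExpansion A B) (e : K' ≃ K) : IsFiniteExpansion (fun k => A (e k)) B := by
  intro v
  obtain ⟨s, hs, hB⟩ := h v
  refine ⟨s.map e.symm.toEmbedding, fun k hk => hs _ fun h' => hk ?_, ?_⟩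
  · exact Finset.mem_map.2 ⟨_, h', by simp⟩
  · rw [hB, Finset.sum_map]
    simp

theorem IsFiniteExpansion.prod_ofFn {m : ℕ} {A : Fin m → K → Module.End ℂ (Fock ι)}
    {B : Fin m → Module.End ℂ (Fock ι)} (h : ∀ i, IsFiniteExpansion (A i) (B i)) :
    IsFiniteExpansion (fun k : Fin m → K => (List.ofFn fun i => A i (k i)).prod)
      (List.ofFn B).prod := by
  induction m with
  | zero =>
    intro v
    exact ⟨Finset.univ, fun k hk => absurd (Finset.mem_univ k) hk, by simp⟩
  | succ m ih =>
    have h1 := ((h 0).mul (ih fun i => h i.succ)).equiv (Fin.consEquiv fun _ => K).symm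
    convert! h1 using 1
    · funext k
      rw [List.ofFn_succ, List.prod_cons]
      rfl
    · rw [List.ofFn_succ, List.prod_cons]

theorem IsFiniteExpansion.mul_left {A : K → Module.End ℂ (Fock ι)} {B : Module.End ℂ (Fock ι)}
    (h : IsFiniteExpansion A B) (C : Module.End ℂ (Fock ι)) :
    IsFiniteExpansion (fun k => C * A k) (C * B) := by
  intro v
  obtain ⟨s, hs, hB⟩ := h v
  refine ⟨s, fun k hk => ?_, ?_⟩
  · rw [Module.End.mul_apply, hs k hk, map_zero]
  · rw [Module.End.mul_apply, hB, map_sum]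
    rfl

theorem IsFiniteExpansion.hasSum_diagTerm {A : K → Module.End ℂ (Fock ι)}
    {B : Module.End ℂ (Fock ι)} (h : IsFiniteExpansion A B) (W : (ι × ℤ →₀ ℕ) → ℂ)
    (d : ι × ℤ →₀ ℕ) : HasSum (fun k => diagTerm W (A k) d) (diagTerm W B d) := by
  obtain ⟨s, hs, hB⟩ := h (basisVec d)
  rw [diagTerm, hB, coeff_sum, Finset.sum_mul]
  exact hasSum_sum_of_ne_finset_zero fun k hk => by rw [diagTerm, hs k hk]; simp

/-- If Q does not involve the variable b, then β_b commutes with Q(γ) and normal ordering changes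
nothing. A current is then a plain product of two fields, to which the results on words apply. -/
theorem isFiniteExpansion_currentMode {Q : MvPolynomial ι ℂ} {b : ι} (hQ : pderiv b Q = 0) (n : ℤ) :
    IsFiniteExpansion (fun m : ℤ => polyMode Q (n - m) * betaMode b m) (currentMode Q b n) := by
  have hcomm : ∀ m k, betaMode b m * polyMode Q k = polyMode Q k * betaMode b m := fun m k => by
    refine LinearMap.ext fun v => ?_
    have h := betaMode_polyOp (-1) b m Q k v
    rw [hQ, polyOp_zero] at h
    simpa [polyOp_neg_one] using h
  have h1 : currentMode Q b n = modeSum fun m => polyMode Q (n - m) * betaMode b m := by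
    rw [currentMode]
    congr 1
    funext m
    rw [hcomm, ite_self]
  have hfin : LocFin fun m : ℤ => polyMode Q (n - m) * betaMode b m := by
    intro v
    obtain ⟨N, hN⟩ := exists_pderiv_eq_zero v
    obtain ⟨N', hN'⟩ := (isGammaField_polyOp (-1) Q).bounded v
    refine (Set.finite_Icc (n - N') (max N 0)).subset fun m hm => ?_
    rw [Set.mem_Icc]
    by_contra hc
    refine hm ?_
    by_cases h2 : n - N' ≤ m
    · have h3 : max N 0 < m := not_le.1 fun h3 => hc ⟨h2, h3⟩
      have h4 : ¬ m < 0 := by omega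
      rw [Module.End.mul_apply, betaMode, if_neg h4]
      have := hN b m (by rw [abs_of_nonneg (by omega)]; omega)
      rw [Derivation.coeFn_coe, this, map_zero]
    · change (polyMode Q (n - m) * betaMode b m) v = 0
      rw [← hcomm, Module.End.mul_apply, ← polyOp_neg_one, hN' _ (by omega), map_zero]
  intro v
  obtain ⟨s, hs⟩ := hfin.exists_finset v
  exact ⟨s, hs, by rw [h1, modeSum_apply_eq_sum hfin hs]⟩

theorem isFiniteExpansion_fieldMode [Fintype ι] {S : ι → MvPolynomial ι ℂ}
    (hS : ∀ b, pderiv b (S b) = 0) (n : ℤ) :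
    IsFiniteExpansion (fun p : ι × ℤ => polyMode (S p.1) (n - p.2) * betaMode p.1 p.2)
      (fieldMode S n) := by
  classical
  intro v
  choose s hs hB using fun b => isFiniteExpansion_currentMode (hS b) n v
  refine ⟨Finset.univ.biUnion fun b => (s b).image fun m => (b, m), fun p hp => ?_, ?_⟩
  · refine hs p.1 p.2 fun h => hp (Finset.mem_biUnion.2 ⟨p.1, Finset.mem_univ _, ?_⟩)
    exact Finset.mem_image.2 ⟨_, h, rfl⟩
  · rw [fieldMode, LinearMap.sum_apply, Finset.sum_biUnion]
    · refine Finset.sum_congr rfl fun b _ => ?_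
      rw [hB, Finset.sum_image fun _ _ _ _ h => (Prod.mk.inj h).2]
    · intro b _ b' _ hbb'
      rw [Function.onFun, Finset.disjoint_left]
      intro p hp hp'
      obtain ⟨_, -, rfl⟩ := Finset.mem_image.1 hp
      obtain ⟨_, -, h⟩ := Finset.mem_image.1 hp'
      exact hbb' (Prod.mk.inj h).1.symm

theorem hasSum_prod_fintype {α β : Type*} [Fintype α] {g : α → β → ℂ} {a : α → ℂ}
    (h : ∀ i, HasSum (g i) (a i)) : HasSum (fun p : α × β => g p.1 p.2) (∑ i, a i) := by
  classical
  have h1 : ∀ i, HasSum (fun p : α × β => if p.1 = i then g i p.2 else 0) (a i) := by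
    intro i
    have hinj : Function.Injective fun x : β => (i, x) := fun x y h => (Prod.mk.inj h).2
    rw [← hinj.hasSum_iff]
    · simpa [Function.comp_def] using h i
    · rintro ⟨j, x⟩ hx
      refine if_neg fun (hj : j = i) => hx ⟨x, by rw [hj]⟩
  convert! hasSum_sum fun i (_ : i ∈ Finset.univ) => h1 i using 1
  funext p
  simp

end FiniteExpansion

/-! ### The trace formula -/

section TraceFormula

variable {ι : Type*} {n m : ℕ}

/-- The letters of `P_1 ⋯ P_n S_1 β_1 ⋯ S_m β_m`. -/
def ghostWord (n m : ℕ) : List ((Fin n ⊕ Fin m) ⊕ Fin m) :=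
  (List.ofFn fun a => Sum.inl (Sum.inl a)) ++
    (List.ofFn fun i => [Sum.inl (Sum.inr i), Sum.inr i]).flatten

/-- `precedes i j` means that the letter `inl j` precedes `inr i` in `ghostWord`. -/
def precedes (i : Fin m) : Fin n ⊕ Fin m → Prop := Sum.elim (fun _ => True) (· ≤ i)

theorem isGhostWord_ghostWord (n m : ℕ) : IsGhostWord precedes (ghostWord n m) where
  nodup := by
    rw [ghostWord, List.Nodup, List.pairwise_append, List.pairwise_flatten, List.pairwise_ofFn,
      List.pairwise_ofFn]
    refine ⟨fun i j h => by simpa using h.ne, ⟨by simp, fun i j h => ?_⟩, ?_⟩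
    · simpa using h.ne
    · simp only [List.mem_ofFn, List.mem_flatten]
      rintro _ ⟨a, rfl⟩ _ ⟨_, ⟨i, rfl⟩, h⟩ rfl
      simp at h
  mem j := by
    rw [ghostWord, List.mem_append, List.mem_ofFn, List.mem_flatten]
    rcases j with a | i
    · exact Or.inl ⟨a, rfl⟩
    · exact Or.inr ⟨_, List.mem_ofFn.2 ⟨i, rfl⟩, by simp⟩
  order := by
    rw [ghostWord, List.pairwise_append, List.pairwise_flatten, List.pairwise_ofFn,
      List.pairwise_ofFn]
    refine ⟨fun i j h => trivial, ⟨?_, fun i j h => ?_⟩, ?_⟩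
    · simp only [List.mem_ofFn]
      rintro _ ⟨i, rfl⟩
      simp [LetterOrder, precedes]
    · simp [LetterOrder, precedes, h, h.le]
    · simp only [List.mem_ofFn, List.mem_flatten]
      rintro _ ⟨a, rfl⟩ _ ⟨_, ⟨i, rfl⟩, h⟩
      simp only [List.mem_cons, List.not_mem_nil, or_false] at h
      rcases h with rfl | rfl <;> simp [LetterOrder, precedes]

theorem inr_mem_ghostWord (i : Fin m) : Sum.inr i ∈ ghostWord n m := by
  rw [ghostWord, List.mem_append, List.mem_flatten]
  exact Or.inr ⟨_, List.mem_ofFn.2 ⟨i, rfl⟩, by simp⟩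

theorem wordOp_ghostWord (β : Fin m → ι × ℤ) (σ : Fin n ⊕ Fin m → MvPolynomial ι ℂ × ℤ) :
    wordOp (-1) β σ (ghostWord n m) =
      (List.ofFn fun a => polyMode (σ (.inl a)).1 (σ (.inl a)).2).prod *
      (List.ofFn fun i => polyMode (σ (.inr i)).1 (σ (.inr i)).2 * betaMode (β i).1 (β i).2).prod := by
  rw [wordOp, ghostWord, List.map_append, List.prod_append, List.map_flatten, List.prod_flatten,
    List.map_ofFn, List.map_ofFn, List.map_ofFn]
  congr 3 <;> funext i <;> simp [letterOp, polyOp_neg_one]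

theorem isRadiallyOrdered {q : ℂ} {y : ι → ℂ} {z : Fin n → ℂ} {t : Fin m → ℂ} (hq0 : 0 < ‖q‖)
    (hq1 : ‖q‖ < 1) (hy : ∀ a, ‖q‖ < ‖y a‖ ∧ ‖y a‖ < 1) (hz : ∀ j, ‖q‖ < ‖z j‖ ∧ ‖z j‖ < 1)
    (ht : ∀ i, ‖q‖ < ‖t i‖ ∧ ‖t i‖ < 1) (hta : StrictAnti fun i => ‖t i‖)
    (htz : ∀ j i, ‖t i‖ < ‖z j‖) :
    IsRadiallyOrdered precedes q y (Sum.elim z t) t Sum.inr where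
  q_ne_zero := norm_pos_iff.1 hq0
  norm_q_lt := hq1
  norm_q_lt_y a := (hy a).1
  norm_y_lt a := (hy a).2
  x_ne_zero := by
    rintro (j | i)
    · exact norm_pos_iff.1 (hq0.trans (hz j).1)
    · exact norm_pos_iff.1 (hq0.trans (ht i).1)
  t_ne_zero i := norm_pos_iff.1 (hq0.trans (ht i).1)
  order := by
    rintro i (j | i') hj
    · refine ⟨fun _ => ⟨htz j i, ?_⟩, fun h => absurd trivial h⟩
      exact (mul_le_of_le_one_left hq0.le (hz j).2.le).trans_lt (ht i).1
    · have hne : i' ≠ i := fun h => hj (by rw [h])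
      refine ⟨fun h => ⟨hta (lt_of_le_of_ne h hne), ?_⟩, fun h => ⟨hta (not_le.1 h), ?_⟩⟩
      · exact (mul_le_of_le_one_left hq0.le (ht i').2.le).trans_lt (ht i).1
      · exact (mul_le_of_le_one_right hq0.le (ht i).2.le).trans_lt (ht i').1

theorem coeff_mul_boltzmann (A : Module.End ℂ (Fock ι)) (q : ℂ) (c : ι → ℂ) (d : ι × ℤ →₀ ℕ) :
    coeff d ((A * boltzmann q c) (basisVec d)) =
      diagTerm (weight (ghostWeight q fun a => Complex.exp (-c a))) A d := by
  have h0 : boltzmann q c (basisVec d) = (q ^ energy d * Complex.exp (charge c d)) • basisVec d := by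
    have h1 : basisVec d = basisMonomials (ι × ℤ) ℂ d := by simp [basisVec]
    conv_lhs => rw [h1, boltzmann, Module.Basis.constr_basis]
  have h2 : weight (ghostWeight q fun a => Complex.exp (-c a)) d =
      q ^ energy d * Complex.exp (charge c d) := by
    rw [weight, energy, charge, Finsupp.prod, Finsupp.sum, Finsupp.sum, Complex.exp_sum,
      ← Finset.prod_pow_eq_pow_sum, ← Finset.prod_mul_distrib]
    refine Finset.prod_congr rfl fun p _ => ?_
    rw [ghostWeight, Complex.exp_nat_mul, mul_comm (d p), pow_mul, ← mul_pow]
    split_ifs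
    · rw [Complex.exp_neg, inv_inv]
    · rfl
  rw [Module.End.mul_apply, h0, map_smul, coeff_smul, diagTerm, h2, smul_eq_mul, mul_comm]

variable [Fintype ι]

/-- The closed form of the one-loop correlator with the bosonizations of the vector fields `S i`,
as a function of `y_a = e^{-c_a}`: the sum over all Wick contractions. -/
def ghostCorrelator (P : Fin n → MvPolynomial ι ℂ) (S : Fin m → ι → MvPolynomial ι ℂ) (q : ℂ)
    (y : ι → ℂ) (z : Fin n → ℂ) (t : Fin m → ℂ) : ℂ :=
  partitionFunction q y * ∑ b : Fin m → ι, ∑ f : Fin m → Fin n ⊕ Fin m,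
    (∏ i, (t i)⁻¹ * kronecker q (y (b i)) (Sum.elim z t (f i) / t i)) *
      ∏ j, derivativeAtZero (Sum.elim P (fun i => S i (b i)) j) (incidence b f j)

/-- The passage from the modes of the factors of the currents to the modes of the currents. -/
def modeEquiv (ι D : Type*) (n m : ℕ) : ((Fin n → ℤ) × (Fin m → ℤ) × D) × (Fin m → ι × ℤ) ≃
    (Fin m → ι) × (((Fin n ⊕ Fin m → ℤ) × (Fin m → ℤ)) × D) where
  toFun p := (fun i => (p.2 i).1,
    ((Sum.elim p.1.1 fun i => p.1.2.1 i - (p.2 i).2, fun i => (p.2 i).2), p.1.2.2))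
  invFun p := ((fun a => p.2.1.1 (.inl a), fun i => p.2.1.1 (.inr i) + p.2.1.2 i, p.2.2),
    fun i => (p.1 i, p.2.1.2 i))
  left_inv p := by simp
  right_inv p := by
    refine Prod.ext rfl (Prod.ext (Prod.ext (funext fun j => ?_) rfl) rfl)
    cases j <;> simp

/-- The sum over the modes of all factors is regrouped along the modes of the currents. For given
modes and basis vector the regrouped sum is finite, and the powers combine as t^(-(l - μ)) t^(-μ -
1) = t^(-l - 1). -/
theorem hasSum_traceTerm (P : Fin n → MvPolynomial ι ℂ) {S : Fin m → ι → MvPolynomial ι ℂ}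
    (hS : ∀ i b, pderiv b (S i b) = 0) {q : ℂ} {c : ι → ℂ} {z : Fin n → ℂ} {t : Fin m → ℂ}
    (h : IsRadiallyOrdered precedes q (fun a => Complex.exp (-c a)) (Sum.elim z t) t Sum.inr) :
    HasSum (traceTerm P S q c z t) (ghostCorrelator P S q (fun a => Complex.exp (-c a)) z t) := by
  have h1 := hasSum_prod_fintype fun b : Fin m → ι => hasSum_wordOp h (isGhostWord_ghostWord n m)
    (fun i => inr_mem_ghostWord i) (b := b) (Q := Sum.elim P fun i => S i (b i))
    (fun i => hS i (b i))
  rw [← Finset.mul_sum, ← (modeEquiv ι (ι × ℤ →₀ ℕ) n m).hasSum_iff] at h1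
  refine h1.prod_fiberwise fun p => ?_
  obtain ⟨k, l, d⟩ := p
  have h2 := (((IsFiniteExpansion.prod_ofFn fun i => isFiniteExpansion_fieldMode (hS i) (l i)).mul_left
    (List.ofFn fun a => polyMode (P a) (k a)).prod).hasSum_diagTerm
    (weight (ghostWeight q fun a => Complex.exp (-c a))) d).mul_left
    ((∏ a, z a ^ (-k a)) * (∏ i, t i ^ (-l i - 1)))
  rw [traceTerm, coeff_mul_boltzmann]
  convert! h2 using 1
  funext κ
  simp only [Function.comp_apply, modeEquiv, Equiv.coe_fn_mk, wordOp_ghostWord, Sum.elim_inl,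
    Sum.elim_inr, Fintype.prod_sum_type]
  congr 1
  rw [mul_assoc, ← Finset.prod_mul_distrib]
  congr 1
  refine Finset.prod_congr rfl fun i _ => ?_
  rw [← zpow_add₀ (h.t_ne_zero i)]
  congr 1
  ring

end TraceFormula

end GhostSystem

namespace GhostSystem
open MvPolynomial Filter Topology

/-! ### Graded matrices -/

section Graded

variable {κ : Type*} (w : κ → ℤ)

/-- The entry `(i, j)` has weighted degree `w i - w j`. -/
def IsGradedMatrix (N : Matrix κ κ (MvPolynomial κ ℂ)) : Prop :=
  ∀ i j, IsWeightedHomogeneous w (N i j) (w i - w j)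

variable {w}

theorem IsGradedMatrix.mul [Fintype κ] {N N' : Matrix κ κ (MvPolynomial κ ℂ)}
    (h : IsGradedMatrix w N) (h' : IsGradedMatrix w N') : IsGradedMatrix w (N * N') := by
  intro i j
  rw [Matrix.mul_apply]
  refine IsWeightedHomogeneous.sum _ _ _ fun k _ => ?_
  have := (h i k).mul (h' k j)
  rwa [sub_add_sub_cancel] at this

theorem isGradedMatrix_one [DecidableEq κ] :
    IsGradedMatrix w (1 : Matrix κ κ (MvPolynomial κ ℂ)) := by
  intro i j
  rw [Matrix.one_apply]
  split_ifs with h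
  · rw [h, sub_self]
    exact isWeightedHomogeneous_one _ _
  · exact isWeightedHomogeneous_zero _ _ _

theorem IsGradedMatrix.pow [Fintype κ] [DecidableEq κ] {N : Matrix κ κ (MvPolynomial κ ℂ)}
    (h : IsGradedMatrix w N) (k : ℕ) : IsGradedMatrix w (N ^ k) := by
  induction k with
  | zero => rw [pow_zero]; exact isGradedMatrix_one
  | succ k ih => rw [pow_succ]; exact ih.mul h

theorem IsGradedMatrix.exp [Fintype κ] [DecidableEq κ] {N : Matrix κ κ (MvPolynomial κ ℂ)}
    (h : IsGradedMatrix w N) : IsGradedMatrix w (IsNilpotent.exp N) := by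
  intro i j
  rw [IsNilpotent.exp, Matrix.sum_apply]
  refine IsWeightedHomogeneous.sum _ _ _ fun k _ => ?_
  rw [Matrix.smul_apply, ← Rat.cast_smul_eq_qsmul ℂ]
  exact (weightedHomogeneousSubmodule ℂ w _).smul_mem _ (h.pow k i j)

theorem isGradedMatrix_list_prod [Fintype κ] [DecidableEq κ]
    {L : List (Matrix κ κ (MvPolynomial κ ℂ))} (h : ∀ N ∈ L, IsGradedMatrix w N) :
    IsGradedMatrix w L.prod := by
  induction L with
  | nil => exact isGradedMatrix_one
  | cons N L ih =>
    rw [List.prod_cons]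
    exact (h N List.mem_cons_self).mul (ih fun N' h' => h N' (List.mem_cons_of_mem _ h'))

theorem isWeightedHomogeneous_det [Fintype κ] [DecidableEq κ] {N : Matrix κ κ (MvPolynomial κ ℂ)}
    (r c : κ → ℤ) (h : ∀ i j, IsWeightedHomogeneous w (N i j) (r i - c j)) :
    IsWeightedHomogeneous w N.det (∑ i, r i - ∑ i, c i) := by
  rw [Matrix.det_apply]
  refine IsWeightedHomogeneous.sum _ _ _ fun σ _ => ?_
  rw [Units.smul_def, ← Int.cast_smul_eq_zsmul ℂ]
  refine (weightedHomogeneousSubmodule ℂ w _).smul_mem _ ?_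
  have := IsWeightedHomogeneous.prod Finset.univ (fun i => N (σ i) i) _ fun i _ => h (σ i) i
  rwa [Finset.sum_sub_distrib, Equiv.sum_comp σ r] at this

/-- The entry (i, j) is the determinant with row j replaced by the i-th unit vector. This is
homogeneous if row j is given the weight w i instead of w j. -/
theorem isWeightedHomogeneous_adjugate [Fintype κ] [DecidableEq κ]
    {N : Matrix κ κ (MvPolynomial κ ℂ)} (h : IsGradedMatrix w N) : IsGradedMatrix w N.adjugate := by
  intro i j
  rw [Matrix.adjugate_apply]
  have := isWeightedHomogeneous_det (w := w) (N := N.updateRow j (Pi.single i 1))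
    (Function.update w j (w i)) w fun k l => ?_
  · rw [← Finset.add_sum_erase _ _ (Finset.mem_univ j),
      ← Finset.add_sum_erase Finset.univ w (Finset.mem_univ j), Function.update_self,
      Finset.sum_congr rfl fun k hk => Function.update_of_ne (Finset.ne_of_mem_erase hk) _ _,
      add_sub_add_right_eq_sub] at this
    exact this
  · by_cases hk : k = j
    · subst hk
      rw [Matrix.updateRow_self, Function.update_self, Pi.single_apply]
      split_ifs with hl
      · rw [hl, sub_self]
        exact isWeightedHomogeneous_one _ _
      · exact isWeightedHomogeneous_zero _ _ _
    · rw [Matrix.updateRow_ne hk, Function.update_of_ne hk]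
      exact h k l

theorem eq_C_of_isWeightedHomogeneous_zero (hw : ∀ i, 0 < w i) {p : MvPolynomial κ ℂ}
    (hp : IsWeightedHomogeneous w p 0) : p = C (coeff 0 p) := by
  classical
  ext e
  rw [coeff_C]
  split_ifs with he
  · rw [he]
  · by_contra h
    have h1 := hp h
    rw [Finsupp.weight_apply, Finsupp.sum] at h1
    obtain ⟨i, hi⟩ := Finsupp.support_nonempty_iff.2 (Ne.symm he)
    refine ne_of_gt (Finset.sum_pos' (fun k _ => ?_) ⟨i, hi, ?_⟩) h1
    · exact smul_nonneg (Nat.zero_le _) (hw k).le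
    · exact smul_pos (Nat.pos_of_ne_zero (Finsupp.mem_support_iff.1 hi)) (hw i)

/-- The determinant of a graded matrix has degree 0, hence is constant because the weights are
positive; the inverse is then a scalar multiple of the adjugate. -/
theorem IsGradedMatrix.inv [Fintype κ] [DecidableEq κ] (hw : ∀ i, 0 < w i)
    {N : Matrix κ κ (MvPolynomial κ ℂ)} (h : IsGradedMatrix w N) : IsGradedMatrix w N⁻¹ := by
  intro i j
  have h1 := isWeightedHomogeneous_det w w h
  rw [sub_self] at h1
  rw [Matrix.inv_def, Matrix.smul_apply, eq_C_of_isWeightedHomogeneous_zero hw h1]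
  -- If the determinant vanishes, `Ring.inverse` takes its default value 0 and N⁻¹ = 0 is graded
  -- too. Invertibility of the Maurer-Cartan matrix need not be known here.
  by_cases h0 : coeff 0 N.det = 0
  · rw [h0, C_0, Ring.inverse_zero, zero_smul]
    exact isWeightedHomogeneous_zero _ _ _
  · have h2 : Ring.inverse (C (σ := κ) (coeff 0 N.det)) = C (coeff 0 N.det)⁻¹ := by
      have hu : IsUnit (C (σ := κ) (coeff 0 N.det)) := (IsUnit.mk0 _ h0).map C
      refine hu.mul_left_cancel ?_
      rw [Ring.mul_inverse_cancel _ hu, ← C_mul, mul_inv_cancel₀ h0, C_1]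
    rw [h2, smul_eq_mul]
    exact (isWeightedHomogeneous_adjugate h i j).C_mul _

end Graded

/-! ### The screening vector fields -/

namespace RootFrame

open LieAlgebra LieAlgebra.IsKilling

variable {𝔤 : Type*} [LieRing 𝔤] [LieAlgebra ℂ 𝔤] [FiniteDimensional ℂ 𝔤] [LieAlgebra.IsSimple ℂ 𝔤]
  {𝔥 : LieSubalgebra ℂ 𝔤} [𝔥.IsCartanSubalgebra] (fr : RootFrame 𝔥)

/-- The height of a positive root. -/
def ht (α : fr.PosRoot) : ℤ := fr.base.height α.1

theorem ht_pos (α : fr.PosRoot) : 0 < fr.ht α := α.2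

/-- The bracket lies in the root space of β + δ, which is Killing-orthogonal to e_{-γ} unless β + δ
= γ; the height is additive. -/
theorem adMatrix_ne_zero {β γ δ : fr.PosRoot} (h : fr.adMatrix β γ δ ≠ 0) :
    fr.ht γ = fr.ht β + fr.ht δ := by
  have hmem : ∀ α : fr.PosRoot, fr.posVec α ∈ rootSpace 𝔥 α.1.1 := fun α =>
    fr.rootVec_mem _ (Finset.mem_filter.1 α.1.2).2
  have h1 : ⁅fr.posVec β, fr.posVec δ⁆ ∈ rootSpace 𝔥 ((β.1.1 : 𝔥 → ℂ) + δ.1.1) :=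
    lie_mem_genWeightSpace_of_mem_genWeightSpace (hmem β) (hmem δ)
  have h2 : fr.rootVec (-γ.1.1) ∈ rootSpace 𝔥 ((-γ.1.1 : LieModule.Weight ℂ 𝔥 𝔤) : 𝔥 → ℂ) :=
    fr.rootVec_mem _ (LieModule.Weight.IsNonZero.neg (Finset.mem_filter.1 γ.1.2).2)
  have h3 : ((β.1.1 : 𝔥 → ℂ) + δ.1.1) + ((-γ.1.1 : LieModule.Weight ℂ 𝔥 𝔤) : 𝔥 → ℂ) = 0 := by
    by_contra hc
    exact h (killingForm_apply_eq_zero_of_mem_rootSpace_of_add_ne_zero ℂ 𝔤 𝔥 h1 h2 hc)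
  refine fr.base.height_add (LinearMap.ext fun x => ?_)
  have h4 := congrFun h3 x
  simp only [Pi.add_apply, LieModule.Weight.coe_neg, Pi.neg_apply, Pi.zero_apply] at h4
  simp only [rootSystem_root_apply, LinearMap.add_apply, LieModule.Weight.toLinear_apply]
  linear_combination -h4

theorem isGradedMatrix_AdExp (β : fr.PosRoot) : IsGradedMatrix fr.ht (fr.AdExp β) := by
  classical
  refine IsGradedMatrix.exp fun γ δ => ?_
  rw [Matrix.smul_apply, Matrix.map_apply, smul_eq_mul]
  by_cases h : fr.adMatrix β γ δ = 0
  · rw [h, C_0, mul_zero]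
    exact isWeightedHomogeneous_zero _ _ _
  · have h1 := (isWeightedHomogeneous_X ℂ fr.ht β).mul
      (isWeightedHomogeneous_C fr.ht (fr.adMatrix β γ δ))
    rwa [show fr.ht β + 0 = fr.ht γ - fr.ht δ by rw [fr.adMatrix_ne_zero h]; ring] at h1

theorem isWeightedHomogeneous_leftField (α β : fr.PosRoot) :
    IsWeightedHomogeneous fr.ht (fr.leftField α β) (fr.ht β - fr.ht α) := by
  classical
  refine IsWeightedHomogeneous.neg ?_
  refine IsGradedMatrix.inv fr.ht_pos (fun γ δ => ?_) β α
  rw [maurerCartan, Matrix.of_apply]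
  refine isGradedMatrix_list_prod (fun N hN => ?_) γ δ
  obtain ⟨j, rfl⟩ := List.mem_ofFn.1 (List.mem_of_mem_take hN)
  exact fr.isGradedMatrix_AdExp _

/-- A monomial of S_α^β has weighted degree ht β - ht α < ht β, and the height of any variable in it
is at most that degree. This triangularity both forbids self-contractions and makes the contraction
diagrams acyclic. -/
theorem ht_lt_of_coeff_leftField_ne_zero {α β b : fr.PosRoot} {e : fr.PosRoot →₀ ℕ}
    (h : coeff e (fr.leftField α β) ≠ 0) (hb : e b ≠ 0) : fr.ht b < fr.ht β := by
  have h1 := fr.isWeightedHomogeneous_leftField α β h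
  rw [Finsupp.weight_apply, Finsupp.sum] at h1
  have h2 : fr.ht b ≤ ∑ i ∈ e.support, e i • fr.ht i := by
    refine le_trans ?_ (Finset.single_le_sum (f := fun i => e i • fr.ht i)
      (fun i _ => smul_nonneg (Nat.zero_le _) (fr.ht_pos i).le) (Finsupp.mem_support_iff.2 hb))
    exact le_smul_of_one_le_left (fr.ht_pos b).le (Nat.one_le_iff_ne_zero.2 hb)
  have := fr.ht_pos α
  omega

theorem pderiv_leftField_self (α β : fr.PosRoot) : pderiv β (fr.leftField α β) = 0 := by
  ext e
  rw [coeff_pderiv, coeff_zero]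
  by_contra h
  exact lt_irrefl _ (fr.ht_lt_of_coeff_leftField_ne_zero (left_ne_zero_of_mul h) (b := β) (by simp))

end RootFrame

end GhostSystem

namespace GhostSystem
open MvPolynomial Filter Topology

/-! ### Nonvanishing of theta functions -/

theorem qPoch_eq_zero {q y : ℂ} (hq : ‖q‖ < 1) {n : ℕ} (h : y * q ^ n = 1) : qPoch q y = 0 := by
  induction n generalizing y with
  | zero => rw [qPoch_step hq, show y = 1 by simpa using h, sub_self, zero_mul]
  | succ n ih =>
    rw [qPoch_step hq, ih (by rw [← h]; ring), mul_zero]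

/-- The zeros of the theta function (y; q)_∞ (q / y; q)_∞ are exactly q^ℤ. This gives the
nonvanishing of the character and turns the infinitely many conditions y ∉ q^ℤ into one open
condition. -/
theorem qPoch_mul_qPoch_ne_zero_iff {q y : ℂ} (hq0 : q ≠ 0) (hq : ‖q‖ < 1) (hy : y ≠ 0) :
    qPoch q y * qPoch q (q / y) ≠ 0 ↔ ∀ k : ℤ, y ≠ q ^ k := by
  constructor
  · rintro h k rfl
    rw [mul_ne_zero_iff] at h
    obtain ⟨n, rfl | hn⟩ : ∃ n : ℕ, k = -n ∨ k = n + 1 := by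
      rcases le_or_gt k 0 with hk | hk
      · exact ⟨k.natAbs, Or.inl (by omega)⟩
      · exact ⟨(k - 1).natAbs, Or.inr (by omega)⟩
    · refine h.1 (qPoch_eq_zero hq (n := n) ?_)
      rw [zpow_neg, zpow_natCast, inv_mul_cancel₀ (pow_ne_zero _ hq0)]
    · refine h.2 (qPoch_eq_zero hq (n := n) ?_)
      rw [div_mul_eq_mul_div, div_eq_one_iff_eq hy, hn, zpow_add_one₀ hq0, zpow_natCast, mul_comm]
  · intro h
    refine mul_ne_zero (qPoch_ne_zero hq fun n hn => ?_) (qPoch_ne_zero hq fun n hn => ?_)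
    · refine h (-n) ?_
      rw [zpow_neg, zpow_natCast]
      exact eq_inv_of_mul_eq_one_left hn
    · refine h (n + 1) ?_
      rw [div_mul_eq_mul_div, div_eq_one_iff_eq hy] at hn
      rw [zpow_add_one₀ hq0, zpow_natCast, ← hn, mul_comm]

/-- The pairs `(q, y)` with `0 < |q| < 1`, `y ≠ 0` and `y ∉ q^ℤ`. -/
def thetaRegion : Set (ℂ × ℂ) :=
  {p | p.1 ≠ 0 ∧ ‖p.1‖ < 1 ∧ p.2 ≠ 0 ∧ ∀ k : ℤ, p.2 ≠ p.1 ^ k}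

theorem isOpen_thetaRegion : IsOpen thetaRegion := by
  rw [isOpen_iff_mem_nhds]
  rintro ⟨q, y⟩ ⟨hq0, hq, hy, h⟩
  have h1 := (qPoch_mul_qPoch_ne_zero_iff hq0 hq hy).2 h
  have h2 : ContinuousAt (fun p : ℂ × ℂ => qPoch p.1 p.2 * qPoch p.1 (p.1 / p.2)) (q, y) := by
    refine (differentiableAt_qPoch hq y).continuousAt.mul ?_
    exact ContinuousAt.comp (f := fun p : ℂ × ℂ => (p.1, p.1 / p.2)) (x := (q, y))
      (differentiableAt_qPoch hq (q / y)).continuousAt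
      (continuousAt_fst.prodMk (continuousAt_fst.div continuousAt_snd hy))
  filter_upwards [h2.eventually_ne h1, continuousAt_fst.eventually_ne hq0,
    continuousAt_snd.eventually_ne hy,
    continuousAt_fst.norm.eventually_lt (continuousAt_const (y := (1 : ℝ))) hq] with p e1 e2 e3 e4
  exact ⟨e2, e4, e3, (qPoch_mul_qPoch_ne_zero_iff e2 e4 e3).1 e1⟩

theorem mem_thetaRegion_of_norm {q y : ℂ} (hq0 : 0 < ‖q‖) (hq : ‖q‖ < ‖y‖) (hy : ‖y‖ < 1) :
    (q, y) ∈ thetaRegion := by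
  have hy0 : y ≠ 0 := norm_pos_iff.1 (hq0.trans hq)
  have hq0' := norm_pos_iff.1 hq0
  refine ⟨hq0', hq.trans hy, hy0, fun k h => ?_⟩
  refine mul_zpow_ne_one (ι := Unit) (y := fun _ => y) (fun _ => hq) (fun _ => hy) () (-k) ?_
  rw [show y = q ^ k from h, ← zpow_add₀ hq0', add_neg_cancel, zpow_zero]

theorem inv_mem_thetaRegion {q y : ℂ} (h : (q, y) ∈ thetaRegion) : (q, y⁻¹) ∈ thetaRegion := by
  obtain ⟨h1, h2, h3, h4⟩ := h
  refine ⟨h1, h2, inv_ne_zero h3, fun k hk => h4 (-k) ?_⟩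
  change y⁻¹ = q ^ k at hk
  rw [zpow_neg, ← hk, inv_inv]

theorem div_mem_thetaRegion_iff {q x t : ℂ} (hq0 : q ≠ 0) (hq : ‖q‖ < 1) (hx : x ≠ 0) (ht : t ≠ 0) :
    (q, x / t) ∈ thetaRegion ↔ ∀ k : ℤ, x ≠ q ^ k * t := by
  have h : ∀ k : ℤ, x / t = q ^ k ↔ x = q ^ k * t := fun k => div_eq_iff ht
  refine ⟨fun h' k hk => h'.2.2.2 k ((h k).2 hk), fun h' => ⟨hq0, hq, div_ne_zero hx ht,
    fun k hk => h' k ((h k).1 hk)⟩⟩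

/-! ### Uniqueness of the continuation along a complex line -/

/-- The zeros of a nonzero entire function are isolated, and countably many neighbourhoods
containing at most one zero each cover ℂ. -/
theorem countable_zeros {f : ℂ → ℂ} (hf : Differentiable ℂ f) {z : ℂ} (hz : f z ≠ 0) :
    {s | f s = 0}.Countable := by
  have ha : AnalyticOnNhd ℂ f Set.univ := fun s _ => hf.analyticAt s
  have h1 : ∀ s, ∀ᶠ w in 𝓝[≠] s, f w ≠ 0 := by
    intro s
    rcases (hf.analyticAt s).eventually_eq_zero_or_eventually_ne_zero with h | h
    · exact absurd (ha.eqOn_zero_of_preconnected_of_eventuallyEq_zero isPreconnected_univ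
        (Set.mem_univ s) h (Set.mem_univ z)) hz
    · exact h
  have h2 : ∀ s, {w | f w = 0 → w = s} ∈ 𝓝 s := fun s => by
    filter_upwards [eventually_nhdsWithin_iff.1 (h1 s)] with w hw h0
    by_contra hc
    exact hw hc h0
  obtain ⟨T, hT, hcov⟩ := TopologicalSpace.countable_cover_nhds h2
  refine hT.mono fun w hw => ?_
  obtain ⟨s, hs, hws⟩ := Set.mem_iUnion₂.1 (hcov.symm ▸ Set.mem_univ w : w ∈ ⋃ x ∈ T, _)
  rw [show w = s from hws hw]
  exact hs

theorem eqOn_of_countable_compl {f g : ℂ → ℂ} {U : Set ℂ} (hU : IsOpen U) (hc : Uᶜ.Countable)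
    (hf : DifferentiableOn ℂ f U) (hg : DifferentiableOn ℂ g U) {s : ℂ} (hs : s ∈ U)
    (h : f =ᶠ[𝓝 s] g) : Set.EqOn f g U := by
  have hconn : IsPreconnected U := by
    have := (hc.isConnected_compl_of_one_lt_rank (by simp)).isPreconnected
    rwa [compl_compl] at this
  exact (hf.analyticOnNhd hU).eqOn_of_preconnected_of_eventuallyEq (hg.analyticOnNhd hU) hconn hs h

end GhostSystem

namespace GhostSystem
open MvPolynomial Filter Topology
namespace RootFrame
open LieAlgebra LieAlgebra.IsKilling

variable {𝔤 : Type*} [LieRing 𝔤] [LieAlgebra ℂ 𝔤] [FiniteDimensional ℂ 𝔤] [LieAlgebra.IsSimple ℂ 𝔤]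
  {𝔥 : LieSubalgebra ℂ 𝔤} [𝔥.IsCartanSubalgebra] (fr : RootFrame 𝔥) {n m : ℕ}

/-! ### The regions -/

theorem rootEval_eq (a : fr.base.support → ℂ) (α : fr.PosRoot) :
    fr.rootEval a α =
      ∑ i, a i * (rootSystem 𝔥).root α.1 ((rootSystem 𝔥).coroot i.1) := by
  rw [rootEval, cartan, map_sum]
  exact Finset.sum_congr rfl fun i _ => by rw [map_smul, smul_eq_mul]

theorem differentiable_rootEval (α : fr.PosRoot) : Differentiable ℂ fun a => fr.rootEval a α := by
  simp only [rootEval_eq]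
  fun_prop

theorem mem_regularRegion_iff {q : ℂ} {a : fr.base.support → ℂ} {z : Fin n → ℂ} {t : Fin m → ℂ} :
    (q, a, z, t) ∈ fr.regularRegion n m ↔ 0 < ‖q‖ ∧ ‖q‖ < 1 ∧
      (∀ α, (q, Complex.exp (fr.rootEval a α)) ∈ thetaRegion) ∧ (∀ j, z j ≠ 0) ∧ (∀ i, t i ≠ 0) ∧
      (∀ j i, (q, z j / t i) ∈ thetaRegion) ∧
      ∀ i i', i ≠ i' → (q, t i / t i') ∈ thetaRegion := by
  constructor
  · rintro ⟨h1, h2, h3, h4, h5, h6, h7⟩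
    have h1' := norm_pos_iff.1 h1
    exact ⟨h1, h2, fun α => ⟨h1', h2, Complex.exp_ne_zero _, h3 α⟩, h4, h5,
      fun j i => (div_mem_thetaRegion_iff h1' h2 (h4 j) (h5 i)).2 (h6 j i),
      fun i i' hi => (div_mem_thetaRegion_iff h1' h2 (h5 i) (h5 i')).2 (h7 i i' hi)⟩
  · rintro ⟨h1, h2, h3, h4, h5, h6, h7⟩
    have h1' := norm_pos_iff.1 h1
    exact ⟨h1, h2, fun α => (h3 α).2.2.2, h4, h5,
      fun j i => (div_mem_thetaRegion_iff h1' h2 (h4 j) (h5 i)).1 (h6 j i),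
      fun i i' hi => (div_mem_thetaRegion_iff h1' h2 (h5 i) (h5 i')).1 (h7 i i' hi)⟩

theorem traceRegion_subset_regularRegion : fr.traceRegion n m ⊆ fr.regularRegion n m := by
  rintro ⟨q, a, z, t⟩ ⟨hq0, hq1, ha, hz, ht, hza, hta, htz⟩
  have h0 := norm_pos_iff.1 hq0
  have ht0 : ∀ i, t i ≠ 0 := fun i => norm_pos_iff.1 (hq0.trans (ht i).1)
  -- All positions lie in the annulus between ‖q‖ and 1, so a ratio of two of them with different
  -- norms has, up to inversion, its norm strictly between ‖q‖ and 1 and avoids q^ℤ.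
  have key : ∀ x y : ℂ, ‖q‖ < ‖x‖ → ‖x‖ < ‖y‖ → ‖y‖ < 1 → (q, x / y) ∈ thetaRegion := by
    intro x y h1 h2 h3
    have hy : 0 < ‖y‖ := (norm_nonneg x).trans_lt h2
    refine mem_thetaRegion_of_norm hq0 ?_ ?_
    · rw [norm_div, lt_div_iff₀ hy]
      exact (mul_le_of_le_one_right hq0.le h3.le).trans_lt h1
    · rwa [norm_div, div_lt_one hy]
  rw [mem_regularRegion_iff]
  refine ⟨hq0, hq1, fun α => ?_, fun j => norm_pos_iff.1 (hq0.trans (hz j).1), ht0, fun j i => ?_,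
    fun i i' hi => ?_⟩
  · have := inv_mem_thetaRegion (mem_thetaRegion_of_norm hq0 (ha α).1 (ha α).2)
    rwa [Complex.exp_neg, inv_inv] at this
  · have := inv_mem_thetaRegion (key (t i) (z j) (ht i).1 (htz j i) (hz j).2)
    rwa [inv_div] at this
  · rcases lt_or_gt_of_ne hi with h | h
    · have := inv_mem_thetaRegion (key (t i') (t i) (ht i').1 (hta h) (ht i).2)
      rwa [inv_div] at this
    · exact key (t i) (t i') (ht i).1 (hta h) (ht i').2

theorem isOpen_regularRegion : IsOpen (fr.regularRegion n m) := by
  rw [isOpen_iff_mem_nhds]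
  rintro ⟨q, a, z, t⟩ hx
  obtain ⟨h1, h2, h3, h4, h5, h6, h7⟩ := fr.mem_regularRegion_iff.1 hx
  have hr := fun α => (fr.differentiable_rootEval α).continuous
  have cq : ContinuousAt (fun x : fr.Params n m => x.1) (q, a, z, t) := continuousAt_fst
  have cz : ∀ j, ContinuousAt (fun x : fr.Params n m => x.2.2.1 j) (q, a, z, t) := fun j => by
    fun_prop
  have ct : ∀ i, ContinuousAt (fun x : fr.Params n m => x.2.2.2 i) (q, a, z, t) := fun i => by
    fun_prop
  have e3 : ∀ᶠ x : fr.Params n m in 𝓝 (q, a, z, t), ∀ α,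
      (x.1, Complex.exp (fr.rootEval x.2.1 α)) ∈ thetaRegion := eventually_all.2 fun α => by
    refine ContinuousAt.eventually_mem (ContinuousAt.prodMk cq ?_) (isOpen_thetaRegion.mem_nhds (h3 α))
    exact (Complex.continuous_exp.comp ((hr α).comp (continuous_fst.comp continuous_snd))).continuousAt
  have e6 : ∀ᶠ x : fr.Params n m in 𝓝 (q, a, z, t), ∀ j i,
      (x.1, x.2.2.1 j / x.2.2.2 i) ∈ thetaRegion :=
    eventually_all.2 fun j => eventually_all.2 fun i => ContinuousAt.eventually_mem
      (ContinuousAt.prodMk cq ((cz j).div (ct i) (h5 i))) (isOpen_thetaRegion.mem_nhds (h6 j i))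
  have e7 : ∀ᶠ x : fr.Params n m in 𝓝 (q, a, z, t), ∀ i i', i ≠ i' →
      (x.1, x.2.2.2 i / x.2.2.2 i') ∈ thetaRegion :=
    eventually_all.2 fun i => eventually_all.2 fun i' => eventually_all.2 fun hi =>
      ContinuousAt.eventually_mem
      (ContinuousAt.prodMk cq ((ct i).div (ct i') (h5 i'))) (isOpen_thetaRegion.mem_nhds (h7 i i' hi))
  filter_upwards [cq.norm.eventually_lt (continuousAt_const (y := (1 : ℝ))) h2,
    (continuousAt_const (y := (0 : ℝ))).eventually_lt cq.norm h1, e3,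
    eventually_all.2 fun j => (cz j).eventually_ne (h4 j),
    eventually_all.2 fun i => (ct i).eventually_ne (h5 i), e6, e7] with x g2 g1 g3 g4 g5 g6 g7
  obtain ⟨q', a', z', t'⟩ := x
  exact fr.mem_regularRegion_iff.2 ⟨g1, g2, g3, g4, g5, g6, g7⟩

theorem isOpen_traceRegion : IsOpen (fr.traceRegion n m) := by
  rw [isOpen_iff_mem_nhds]
  rintro ⟨q, a, z, t⟩ ⟨hq0, hq1, ha, hz, ht, hza, hta, htz⟩
  have cq : ContinuousAt (fun x : fr.Params n m => ‖x.1‖) (q, a, z, t) := continuousAt_fst.norm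
  have ca : ∀ α, ContinuousAt (fun x : fr.Params n m => ‖Complex.exp (-fr.rootEval x.2.1 α)‖)
      (q, a, z, t) := fun α => (Complex.continuous_exp.comp (((fr.differentiable_rootEval α).continuous.comp
        (continuous_fst.comp continuous_snd)).neg)).norm.continuousAt
  have cz : ∀ j, ContinuousAt (fun x : fr.Params n m => ‖x.2.2.1 j‖) (q, a, z, t) := fun j => by
    fun_prop
  have ct : ∀ i, ContinuousAt (fun x : fr.Params n m => ‖x.2.2.2 i‖) (q, a, z, t) := fun i => by
    fun_prop
  have c1 : ContinuousAt (fun _ : fr.Params n m => (1 : ℝ)) (q, a, z, t) := continuousAt_const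
  have c0 : ContinuousAt (fun _ : fr.Params n m => (0 : ℝ)) (q, a, z, t) := continuousAt_const
  filter_upwards [c0.eventually_lt cq hq0, cq.eventually_lt c1 hq1,
    eventually_all.2 fun α => (cq.eventually_lt (ca α) (ha α).1).and ((ca α).eventually_lt c1 (ha α).2),
    eventually_all.2 fun j => (cq.eventually_lt (cz j) (hz j).1).and ((cz j).eventually_lt c1 (hz j).2),
    eventually_all.2 fun i => (cq.eventually_lt (ct i) (ht i).1).and ((ct i).eventually_lt c1 (ht i).2),
    eventually_all.2 fun j => eventually_all.2 fun j' => eventually_all.2 fun hj : j < j' =>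
      (cz j').eventually_lt (cz j) (hza hj),
    eventually_all.2 fun i => eventually_all.2 fun i' => eventually_all.2 fun hi : i < i' =>
      (ct i').eventually_lt (ct i) (hta hi),
    eventually_all.2 fun j => eventually_all.2 fun i => (ct i).eventually_lt (cz j) (htz j i)]
    with x g1 g2 g3 g4 g5 g6 g7 g8
  obtain ⟨q', a', z', t'⟩ := x
  exact ⟨g1, g2, g3, g4, g5, fun j j' hj => g6 j j' hj, fun i i' hi => g7 i i' hi, g8⟩

/-- The element H on which all simple roots take the value 1; simple coroots span the Cartan
subalgebra, so H has coordinates with respect to them. -/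
theorem exists_rootEval_eq_ht : ∃ a, ∀ α, fr.rootEval a α = (fr.ht α : ℂ) := by
  set H : 𝔥 := (Module.evalEquiv ℂ 𝔥).symm (fr.base.toWeightBasis.constr ℂ fun _ => (1 : ℂ))
  have hH : ∀ i : fr.base.support, (rootSystem 𝔥).root i.1 H = 1 := fun i => by
    rw [← fr.base.toWeightBasis_apply, Module.apply_evalEquiv_symm_apply, Module.Basis.constr_basis]
  have hH' : ∀ α : fr.PosRoot, (rootSystem 𝔥).root α.1 H = (fr.ht α : ℂ) := fun α => by
    obtain ⟨f, -, -, hf⟩ := fr.base.exists_root_eq_sum_int α.1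
    rw [ht, fr.base.height_eq_sum hf, hf, LinearMap.sum_apply, Int.cast_sum]
    refine Finset.sum_congr rfl fun j hj => ?_
    rw [LinearMap.smul_apply, hH ⟨j, hj⟩, zsmul_eq_mul, mul_one]
  refine ⟨fun i => fr.base.toCoweightBasis.repr H i, fun α => ?_⟩
  rw [← hH', rootEval, cartan]
  congr 1
  conv_rhs => rw [← fr.base.toCoweightBasis.sum_repr H]
  refine Finset.sum_congr rfl fun i _ => ?_
  rw [fr.base.toCoweightBasis_apply]

theorem exists_mem_traceRegion (n m : ℕ) {q : ℂ} (hq0 : 0 < ‖q‖) (hq1 : ‖q‖ < 1) :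
    ∃ a z t, (q, a, z, t) ∈ fr.traceRegion n m := by
  obtain ⟨a, ha⟩ := fr.exists_rootEval_eq_ht
  set r := Real.log ‖q‖ with hr
  have hr0 : r < 0 := Real.log_neg hq0 hq1
  have hexp : Real.exp r = ‖q‖ := Real.exp_log hq0
  set K : ℝ := 1 + ∑ α, (fr.ht α : ℝ) with hK
  have hht : ∀ α, (0 : ℝ) < fr.ht α := fun α => by exact_mod_cast fr.ht_pos α
  have hKα : ∀ α, (fr.ht α : ℝ) < K := fun α => by
    have := Finset.single_le_sum (f := fun α => (fr.ht α : ℝ)) (fun α _ => (hht α).le)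
      (Finset.mem_univ α)
    rw [hK]; linarith
  have hK0 : 0 < K := by
    have := Finset.sum_nonneg fun α (_ : α ∈ Finset.univ) => (hht α).le
    rw [hK]; linarith
  have key : ∀ s : ℝ, 0 < s → s < 1 → ‖q‖ < Real.exp (r * s) ∧ Real.exp (r * s) < 1 := by
    intro s hs0 hs1
    rw [← hexp, Real.exp_lt_exp, Real.exp_lt_one_iff]
    exact ⟨by nlinarith, by nlinarith⟩
  set N : ℝ := n + m + 1
  have hN : 0 < N := by positivity
  have hz : ∀ j : Fin n, 0 < ((j : ℝ) + 1) / N ∧ ((j : ℝ) + 1) / N < 1 := fun j => by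
    have : ((j : ℕ) : ℝ) + 1 ≤ n := by exact_mod_cast j.2
    refine ⟨by positivity, (div_lt_one hN).2 ?_⟩
    simp only [N]
    have : (0 : ℝ) ≤ m := Nat.cast_nonneg m
    linarith
  have ht : ∀ i : Fin m, 0 < ((n : ℝ) + i + 1) / N ∧ ((n : ℝ) + i + 1) / N < 1 := fun i => by
    have : ((i : ℕ) : ℝ) + 1 ≤ m := by exact_mod_cast i.2
    refine ⟨by positivity, (div_lt_one hN).2 ?_⟩
    simp only [N]
    linarith
  have hmono : ∀ s s' : ℝ, s < s' → Real.exp (r * (s' / N)) < Real.exp (r * (s / N)) := by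
    intro s s' h
    rw [Real.exp_lt_exp]
    exact mul_lt_mul_of_neg_left (div_lt_div_of_pos_right h hN) hr0
  have hnorm : ∀ s : ℝ, ‖Complex.exp ((r * s : ℝ) : ℂ)‖ = Real.exp (r * s) := fun s => by
    rw [Complex.norm_exp, Complex.ofReal_re]
  -- With this choice e^{-α(H)} = ‖q‖^(ht α / K), where K exceeds every height, and the n + m
  -- positions are the powers ‖q‖^(k / N), k = 1, ..., n + m, with N = n + m + 1, in decreasing
  -- order.
  refine ⟨(-(r / K : ℝ) : ℂ) • a, fun j => Complex.exp ((r * (((j : ℝ) + 1) / N) : ℝ) : ℂ),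
    fun i => Complex.exp ((r * (((n : ℝ) + i + 1) / N) : ℝ) : ℂ), hq0, hq1, fun α => ?_, fun j => ?_,
    fun i => ?_, fun j j' h => ?_, fun i i' h => ?_, fun j i => ?_⟩
  · have h1 : -fr.rootEval ((-(r / K : ℝ) : ℂ) • a) α = ((r * (fr.ht α / K) : ℝ) : ℂ) := by
      have h2 : fr.rootEval ((-(r / K : ℝ) : ℂ) • a) α = (-(r / K : ℝ) : ℂ) * fr.rootEval a α := by
        simp only [rootEval_eq, Finset.mul_sum, Pi.smul_apply, smul_eq_mul, mul_assoc]
      rw [h2, ha]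
      push_cast
      ring
    rw [h1, hnorm]
    exact key _ (div_pos (hht α) hK0) ((div_lt_one hK0).2 (hKα α))
  · rw [hnorm]
    exact key _ (hz j).1 (hz j).2
  · rw [hnorm]
    exact key _ (ht i).1 (ht i).2
  · simp only [hnorm]
    exact hmono _ _ (by have : (j : ℕ) < j' := h; gcongr)
  · simp only [hnorm]
    exact hmono _ _ (by have : (i : ℕ) < i' := h; gcongr)
  · simp only [hnorm]
    refine hmono _ _ ?_
    have : ((j : ℕ) : ℝ) + 1 ≤ n := by exact_mod_cast j.2
    have : (0 : ℝ) ≤ (i : ℕ) := Nat.cast_nonneg _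
    linarith

end RootFrame
end GhostSystem

namespace GhostSystem
open MvPolynomial Filter Topology
namespace RootFrame
open LieAlgebra LieAlgebra.IsKilling

variable {𝔤 : Type*} [LieRing 𝔤] [LieAlgebra ℂ 𝔤] [FiniteDimensional ℂ 𝔤] [LieAlgebra.IsSimple ℂ 𝔤]
  {𝔥 : LieSubalgebra ℂ 𝔤} [𝔥.IsCartanSubalgebra] (fr : RootFrame 𝔥) {n m : ℕ}

/-! ### The closed form of the correlators -/

theorem differentiableAt_fun_finset_prod {E κ : Type*} [NormedAddCommGroup E] [NormedSpace ℂ E]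
    {f : κ → E → ℂ} {x : E} {s : Finset κ} (h : ∀ i ∈ s, DifferentiableAt ℂ (f i) x) :
    DifferentiableAt ℂ (fun x => ∏ i ∈ s, f i x) x := by
  classical
  induction s using Finset.induction_on with
  | empty => simp
  | insert a s ha ih =>
    simp only [Finset.prod_insert ha]
    exact (h a (Finset.mem_insert_self a s)).fun_mul
      (ih fun i hi => h i (Finset.mem_insert_of_mem hi))

/-- The closed form of the one-loop correlator. -/
def wickCorrelator (P : Fin n → MvPolynomial fr.PosRoot ℂ) (α : Fin m → fr.PosRoot) :
    fr.Params n m → ℂ := fun x =>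
  ghostCorrelator P (fun i => fr.leftField (α i)) x.1
    (fun β => Complex.exp (-fr.rootEval x.2.1 β)) x.2.2.1 x.2.2.2

theorem exp_neg_mem_thetaRegion {q : ℂ} {a : fr.base.support → ℂ} {α : fr.PosRoot}
    (h : (q, Complex.exp (fr.rootEval a α)) ∈ thetaRegion) :
    (q, Complex.exp (-fr.rootEval a α)) ∈ thetaRegion := by
  rw [Complex.exp_neg]
  exact inv_mem_thetaRegion h

theorem partitionFunction_ne_zero {ι : Type*} [Fintype ι] {q : ℂ} {y : ι → ℂ}
    (hy : ∀ a, (q, y a) ∈ thetaRegion) : partitionFunction q y ≠ 0 :=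
  Finset.prod_ne_zero_iff.2 fun a _ => inv_ne_zero
    ((qPoch_mul_qPoch_ne_zero_iff (hy a).1 (hy a).2.1 (hy a).2.2.1).2 (hy a).2.2.2)

theorem differentiableAt_wickCorrelator (P : Fin n → MvPolynomial fr.PosRoot ℂ)
    (α : Fin m → fr.PosRoot) {x : fr.Params n m} (hx : x ∈ fr.regularRegion n m) :
    DifferentiableAt ℂ (fr.wickCorrelator P α) x := by
  classical
  obtain ⟨q, a, z, t⟩ := x
  obtain ⟨h1, h2, h3, h4, h5, h6, h7⟩ := fr.mem_regularRegion_iff.1 hx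
  have h1' := norm_pos_iff.1 h1
  have hy := fun β => fr.exp_neg_mem_thetaRegion (h3 β)
  set x₀ : fr.Params n m := (q, a, z, t)
  have dq : DifferentiableAt ℂ (fun x : fr.Params n m => x.1) x₀ := differentiableAt_fst
  have dy : ∀ β, DifferentiableAt ℂ
      (fun x : fr.Params n m => Complex.exp (-fr.rootEval x.2.1 β)) x₀ := fun β =>
    ((((fr.differentiable_rootEval β).comp (differentiable_fst.comp differentiable_snd)).neg).cexp)
      |>.differentiableAt
  have dz : ∀ j, DifferentiableAt ℂ (fun x : fr.Params n m => x.2.2.1 j) x₀ := fun j => by fun_prop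
  have dt : ∀ i, DifferentiableAt ℂ (fun x : fr.Params n m => x.2.2.2 i) x₀ := fun i => by fun_prop
  unfold wickCorrelator ghostCorrelator
  refine DifferentiableAt.fun_mul ?_ (DifferentiableAt.fun_sum fun b _ =>
    DifferentiableAt.fun_sum fun f _ => ?_)
  · unfold partitionFunction
    refine differentiableAt_fun_finset_prod fun β _ => DifferentiableAt.fun_inv ?_ ?_
    · refine DifferentiableAt.fun_mul ?_ ?_
      · exact (differentiableAt_qPoch h2 _).comp x₀ (dq.prodMk (dy β))
      · exact DifferentiableAt.comp (f := fun x : fr.Params n m =>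
          (x.1, x.1 / Complex.exp (-fr.rootEval x.2.1 β))) x₀ (differentiableAt_qPoch h2 _)
          (dq.prodMk (differentiableAt_fun_div dq (dy β) (Complex.exp_ne_zero _)))
    · exact (qPoch_mul_qPoch_ne_zero_iff h1' h2 (Complex.exp_ne_zero _)).2 (hy β).2.2.2
  -- The factor formed by the derivatives at 0 does not depend on the parameters. If it vanishes,
  -- the term is identically zero; in particular terms with a self-contraction, where the Kronecker
  -- function would be evaluated at its pole v = 1, drop out.
  · by_cases h0 : ∏ j, derivativeAtZero (Sum.elim P (fun i => fr.leftField (α i) (b i)) j)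
        (incidence b f j) = 0
    · simp only [h0, mul_zero]
      exact differentiableAt_const _
    · have hne := ne_own_of_prod_ne_zero (b := b) (own := Sum.inr)
        (Q := Sum.elim P fun i => fr.leftField (α i) (b i))
        (fun i => fr.pderiv_leftField_self (α i) (b i)) h0
      have hv : ∀ i, (q, Sum.elim z t (f i) / t i) ∈ thetaRegion := by
        intro i
        rcases hf : f i with j | i'
        · exact h6 j i
        · exact h7 i' i fun h => hne i (by rw [hf, h])
      have dx : ∀ i, DifferentiableAt ℂ
          (fun x : fr.Params n m => Sum.elim x.2.2.1 x.2.2.2 (f i) / x.2.2.2 i) x₀ := by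
        intro i
        refine differentiableAt_fun_div ?_ (dt i) (h5 i)
        rcases f i with j | i'
        · exact dz j
        · exact dt i'
      have dk : ∀ i, DifferentiableAt ℂ (fun x : fr.Params n m => kronecker x.1
          (Complex.exp (-fr.rootEval x.2.1 (b i)))
          (Sum.elim x.2.2.1 x.2.2.2 (f i) / x.2.2.2 i)) x₀ := fun i =>
        DifferentiableAt.comp (f := fun x : fr.Params n m =>
        (x.1, Complex.exp (-fr.rootEval x.2.1 (b i)), Sum.elim x.2.2.1 x.2.2.2 (f i) / x.2.2.2 i)) x₀
        (differentiableAt_kronecker h1' h2 (Complex.exp_ne_zero _) (hv i).2.2.1 (hy (b i)).2.2.2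
          (hv i).2.2.2) (dq.prodMk ((dy (b i)).prodMk (dx i)))
      have dp := differentiableAt_fun_finset_prod (s := Finset.univ) fun i _ =>
        ((dt i).fun_inv (h5 i)).fun_mul (dk i)
      exact dp.mul_const _

theorem isCorrelator_wickCorrelator (P : Fin n → MvPolynomial fr.PosRoot ℂ)
    (α : Fin m → fr.PosRoot) : fr.IsCorrelator P α (fr.wickCorrelator P α) := by
  refine ⟨fun x hx => (fr.differentiableAt_wickCorrelator P α hx).differentiableWithinAt,
    fun q a z t h => ?_⟩
  obtain ⟨hq0, hq1, ha, hz, ht, -, hta, htz⟩ := h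
  exact hasSum_traceTerm P (fun i b => fr.pderiv_leftField_self (α i) b)
    (isRadiallyOrdered hq0 hq1 ha hz ht hta htz)

/-! ### Uniqueness of the correlators -/

/-- The complex line through the points `(q, p.1)` and `(q, p.2)`. -/
def paramLine (q : ℂ) (x y : (fr.base.support → ℂ) × (Fin n → ℂ) × (Fin m → ℂ)) (s : ℂ) :
    fr.Params n m := (q, x + s • (y - x))

theorem differentiable_paramLine (q : ℂ) (x y : (fr.base.support → ℂ) × (Fin n → ℂ) × (Fin m → ℂ)) :
    Differentiable ℂ (fr.paramLine q x y) := by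
  unfold paramLine
  fun_prop

/-- For fixed q, each excluded condition is the vanishing of an entire function of s that is nonzero
at s = 0, and there are countably many conditions. -/
theorem countable_compl_paramLine_preimage {q : ℂ}
    {x : (fr.base.support → ℂ) × (Fin n → ℂ) × (Fin m → ℂ)} (hx : (q, x) ∈ fr.regularRegion n m)
    (y : (fr.base.support → ℂ) × (Fin n → ℂ) × (Fin m → ℂ)) :
    (fr.paramLine q x y ⁻¹' fr.regularRegion n m)ᶜ.Countable := by
  have h0 : fr.paramLine q x y 0 = (q, x) := by simp [paramLine]
  have hd := fr.differentiable_paramLine q x y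
  set φ := fr.paramLine q x y with hφ
  have hq : ∀ s, (φ s).1 = q := fun s => rfl
  obtain ⟨h1, h2, h3, h4, h5, h6, h7⟩ := hx
  have d3 : ∀ α, Differentiable ℂ fun s => Complex.exp (fr.rootEval (φ s).2.1 α) := fun α =>
    ((fr.differentiable_rootEval α).comp (differentiable_fst.comp (differentiable_snd.comp hd))).cexp
  have d4 : ∀ j, Differentiable ℂ fun s => (φ s).2.2.1 j := fun j => by fun_prop
  have d5 : ∀ i, Differentiable ℂ fun s => (φ s).2.2.2 i := fun i => by fun_prop
  have c3 : (⋃ (α) (k : ℤ), {s | Complex.exp (fr.rootEval (φ s).2.1 α) - q ^ k = 0}).Countable :=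
    Set.countable_iUnion fun α => Set.countable_iUnion fun k =>
      countable_zeros (z := 0) ((d3 α).sub_const _) (by rw [h0]; exact sub_ne_zero.2 (h3 α k))
  have c4 : (⋃ j, {s | (φ s).2.2.1 j = 0}).Countable :=
    Set.countable_iUnion fun j => countable_zeros (z := 0) (d4 j) (by rw [h0]; exact h4 j)
  have c5 : (⋃ i, {s | (φ s).2.2.2 i = 0}).Countable :=
    Set.countable_iUnion fun i => countable_zeros (z := 0) (d5 i) (by rw [h0]; exact h5 i)
  have c6 : (⋃ (j) (i) (k : ℤ), {s | (φ s).2.2.1 j - q ^ k * (φ s).2.2.2 i = 0}).Countable :=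
    Set.countable_iUnion fun j => Set.countable_iUnion fun i => Set.countable_iUnion fun k =>
      countable_zeros (z := 0) ((d4 j).sub ((d5 i).const_mul _))
        (by rw [h0]; exact sub_ne_zero.2 (h6 j i k))
  have c7 : (⋃ (i) (i') (_ : i ≠ i') (k : ℤ),
      {s | (φ s).2.2.2 i - q ^ k * (φ s).2.2.2 i' = 0}).Countable :=
    Set.countable_iUnion fun i => Set.countable_iUnion fun i' => Set.countable_iUnion fun hi =>
      Set.countable_iUnion fun k => countable_zeros (z := 0) ((d5 i).sub ((d5 i').const_mul _))
        (by rw [h0]; exact sub_ne_zero.2 (h7 i i' hi k))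
  refine ((((c3.union c4).union c5).union c6).union c7).mono fun s hs => ?_
  by_contra hc
  simp only [Set.mem_union, Set.mem_iUnion, Set.mem_ofPred_eq, not_or, not_exists, sub_eq_zero] at hc
  obtain ⟨⟨⟨⟨g3, g4⟩, g5⟩, g6⟩, g7⟩ := hc
  exact hs ⟨h1, h2, g3, g4, g5, g6, fun i i' hi k => g7 i i' hi k⟩

/-- Keeping q fixed avoids any discussion of the connectedness of the regular region. It requires,
for every q, a point of the region of convergence; near that point both functions are sums of the
same series. -/
theorem IsCorrelator.eqOn {P : Fin n → MvPolynomial fr.PosRoot ℂ} {α : Fin m → fr.PosRoot}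
    {F G : fr.Params n m → ℂ} (hF : fr.IsCorrelator P α F) (hG : fr.IsCorrelator P α G) :
    Set.EqOn F G (fr.regularRegion n m) := by
  rintro ⟨q, x⟩ hx
  obtain ⟨a, z, t, hy⟩ := fr.exists_mem_traceRegion n m hx.1 hx.2.1
  have hd := fr.differentiable_paramLine q x (a, z, t)
  have h0 : fr.paramLine q x (a, z, t) 0 = (q, x) := by simp [paramLine]
  have h1 : fr.paramLine q x (a, z, t) 1 = (q, a, z, t) := by simp [paramLine]
  have hd' : DifferentiableOn ℂ (fr.paramLine q x (a, z, t))
    (fr.paramLine q x (a, z, t) ⁻¹' fr.regularRegion n m) := hd.differentiableOn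
  have h := eqOn_of_countable_compl (f := F ∘ fr.paramLine q x (a, z, t))
    (g := G ∘ fr.paramLine q x (a, z, t)) (fr.isOpen_regularRegion.preimage hd.continuous)
    (fr.countable_compl_paramLine_preimage hx _) (hF.1.comp hd' fun s hs => hs)
    (hG.1.comp hd' fun s hs => hs) (s := 1)
    (by rw [Set.mem_preimage, h1]; exact fr.traceRegion_subset_regularRegion hy) ?_
  · have := h (show (0 : ℂ) ∈ _ by rw [Set.mem_preimage, h0]; exact hx)
    simpa only [Function.comp_apply, h0] using this
  · have : ∀ᶠ s in 𝓝 (1 : ℂ), fr.paramLine q x (a, z, t) s ∈ fr.traceRegion n m :=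
      hd.continuous.continuousAt.eventually_mem (by rw [h1]; exact fr.isOpen_traceRegion.mem_nhds hy)
    filter_upwards [this] with s hs
    exact (hF.2 _ _ _ _ hs).unique (hG.2 _ _ _ _ hs)

theorem isCorrelator_correlator (P : Fin n → MvPolynomial fr.PosRoot ℂ) (α : Fin m → fr.PosRoot) :
    fr.IsCorrelator P α (fr.correlator P α) :=
  Classical.epsilon_spec ⟨_, fr.isCorrelator_wickCorrelator P α⟩

theorem correlator_eq (P : Fin n → MvPolynomial fr.PosRoot ℂ) (α : Fin m → fr.PosRoot)
    {x : fr.Params n m} (hx : x ∈ fr.regularRegion n m) :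
    fr.correlator P α x = fr.wickCorrelator P α x :=
  IsCorrelator.eqOn fr (fr.isCorrelator_correlator P α) (fr.isCorrelator_wickCorrelator P α) hx

end RootFrame
end GhostSystem

namespace GhostSystem
open MvPolynomial Filter Topology

/-! ### Factorization of the sum over contractions -/

section Colouring

variable {n m : ℕ}

/-- All `i ∈ I j` are joined by `f` to `j` or to an element of `I j`. -/
def IsColoured (I : Fin n → Finset (Fin m)) (f : Fin m → Fin n ⊕ Fin m) : Prop :=
  ∀ j, ∀ i ∈ I j, f i = Sum.inl j ∨ ∃ i' ∈ I j, f i = Sum.inr i'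

/-- Following `f` from `i` one arrives at `j`. -/
inductive Reaches (f : Fin m → Fin n ⊕ Fin m) : Fin m → Fin n → Prop
  | base {i : Fin m} {j : Fin n} (h : f i = Sum.inl j) : Reaches f i j
  | step {i i' : Fin m} {j : Fin n} (h : f i = Sum.inr i') (h' : Reaches f i' j) : Reaches f i j

theorem mem_indexPartitions {I : Fin n → Finset (Fin m)} :
    I ∈ indexPartitions n m ↔ ∀ i, ∃! j, i ∈ I j := by
  simp [indexPartitions]

theorem Reaches.mem {f : Fin m → Fin n ⊕ Fin m} {I : Fin n → Finset (Fin m)}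
    (hI : I ∈ indexPartitions n m) (hc : IsColoured I f) {i : Fin m} {j : Fin n}
    (h : Reaches f i j) : i ∈ I j := by
  rw [mem_indexPartitions] at hI
  induction h with
  | @base i j h =>
    obtain ⟨j', hj', -⟩ := hI i
    rcases hc j' i hj' with h1 | ⟨i', -, h1⟩
    · rw [h] at h1
      rwa [Sum.inl.inj h1]
    · rw [h] at h1
      exact absurd h1 (by simp)
  | @step i i' j h _ ih =>
    obtain ⟨j', hj', -⟩ := hI i
    rcases hc j' i hj' with h1 | ⟨i'', hi'', h1⟩
    · rw [h] at h1
      exact absurd h1 (by simp)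
    · rw [h] at h1
      obtain rfl := Sum.inr.inj h1
      rwa [(hI i').unique ih hi'']

theorem Reaches.unique {f : Fin m → Fin n ⊕ Fin m} {i : Fin m} {j j' : Fin n}
    (h : Reaches f i j) (h' : Reaches f i j') : j = j' := by
  induction h with
  | base h =>
    cases h' with
    | base h1 => exact Sum.inl.inj (h.symm.trans h1)
    | step h1 _ => exact absurd (h.symm.trans h1) (by simp)
  | step h _ ih =>
    cases h' with
    | base h1 => exact absurd (h.symm.trans h1) (by simp)
    | step h1 h2 =>
      obtain rfl := Sum.inr.inj (h.symm.trans h1)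
      exact ih h2

/-- As h increases along f and `Fin m` is finite, every path of contractions ends at some P_j.
Compatibility with f forces I j to consist of all i whose path ends at j. -/
theorem existsUnique_isColoured {f : Fin m → Fin n ⊕ Fin m} (h : Fin m → ℤ)
    (hf : ∀ i i', f i = Sum.inr i' → h i < h i') :
    ∃! I, I ∈ indexPartitions n m ∧ IsColoured I f := by
  classical
  have hex : ∀ i, ∃ j, Reaches f i j := by
    have hwf : WellFounded fun i' i : Fin m => h i < h i' := by
      have : IsTrans (Fin m) fun i' i => h i < h i' := ⟨fun _ _ _ h1 h2 => lt_trans h2 h1⟩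
      have : Std.Irrefl fun i' i : Fin m => h i < h i' := ⟨fun _ => lt_irrefl _⟩
      exact Finite.wellFounded_of_trans_of_irrefl _
    intro i
    induction i using hwf.induction with
    | _ i ih =>
      rcases hfi : f i with j | i'
      · exact ⟨j, .base hfi⟩
      · obtain ⟨j, hj⟩ := ih i' (hf i i' hfi)
        exact ⟨j, .step hfi hj⟩
  refine ⟨fun j => {i | Reaches f i j}, ⟨?_, fun j i hi => ?_⟩, fun I hI => ?_⟩
  · rw [mem_indexPartitions]
    intro i
    obtain ⟨j, hj⟩ := hex i
    exact ⟨j, by simpa using hj, fun j' hj' => Reaches.unique (by simpa using hj') hj⟩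
  · have hi' : Reaches f i j := by simpa using hi
    cases hi' with
    | base h1 => exact Or.inl h1
    | step h1 h2 => exact Or.inr ⟨_, by simpa using h2, h1⟩
  · funext j
    ext i
    have hI1 := mem_indexPartitions.1 hI.1
    simp only [Finset.mem_filter_univ]
    refine ⟨fun hi => ?_, fun hi => hi.mem hI.1 hI.2⟩
    obtain ⟨j', hj'⟩ := hex i
    rwa [(hI1 i).unique hi (hj'.mem hI.1 hI.2)]

/-- The enumeration of the blocks of a decomposition. -/
def blockEquiv {I : Fin n → Finset (Fin m)} (hI : I ∈ indexPartitions n m) :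
    (Σ j, Fin (I j).card) ≃ Fin m :=
  Equiv.ofBijective (fun p => (I p.1).orderEmbOfFin rfl p.2) <| by
    rw [mem_indexPartitions] at hI
    constructor
    · rintro ⟨j, v⟩ ⟨j', v'⟩ h
      have h1 : (I j).orderEmbOfFin rfl v = (I j').orderEmbOfFin rfl v' := h
      obtain rfl : j = j' := (hI _).unique ((I j).orderEmbOfFin_mem rfl v)
        (h1 ▸ (I j').orderEmbOfFin_mem rfl v')
      rw [((I j).orderEmbOfFin rfl).injective h1]
    · intro i
      obtain ⟨j, hj, -⟩ := hI i
      have : i ∈ Set.range ((I j).orderEmbOfFin rfl) := by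
        rw [Finset.range_orderEmbOfFin]
        exact hj
      obtain ⟨v, hv⟩ := this
      exact ⟨⟨j, v⟩, hv⟩

theorem blockEquiv_apply {I : Fin n → Finset (Fin m)} (hI : I ∈ indexPartitions n m) (j : Fin n)
    (v : Fin (I j).card) : blockEquiv hI ⟨j, v⟩ = (I j).orderEmbOfFin rfl v := rfl

/-- The inclusion of the vertices of the block `I j`. -/
def blockVertex {I : Fin n → Finset (Fin m)} (hI : I ∈ indexPartitions n m) (j : Fin n) :
    Fin 1 ⊕ Fin (I j).card → Fin n ⊕ Fin m :=
  Sum.elim (fun _ => Sum.inl j) fun v => Sum.inr (blockEquiv hI ⟨j, v⟩)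

theorem blockVertex_injective {I : Fin n → Finset (Fin m)} (hI : I ∈ indexPartitions n m)
    (j : Fin n) : Function.Injective (blockVertex hI j) := by
  rintro (u | v) (u' | v') h
  · rw [Subsingleton.elim u u']
  · simp [blockVertex] at h
  · simp [blockVertex] at h
  · have h1 := (blockEquiv hI).injective (Sum.inr.inj h)
    rw [eq_of_heq (Sigma.mk.inj h1).2]

theorem blockVertex_ne {I : Fin n → Finset (Fin m)} (hI : I ∈ indexPartitions n m)
    {j j' : Fin n} (hj : j ≠ j') (u : Fin 1 ⊕ Fin (I j).card) (u' : Fin 1 ⊕ Fin (I j').card) :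
    blockVertex hI j u ≠ blockVertex hI j' u' := by
  intro h
  rcases u with u | v <;> rcases u' with u' | v'
  · exact hj (Sum.inl.inj h)
  · simp [blockVertex] at h
  · simp [blockVertex] at h
  · have h1 := (blockEquiv hI).injective (Sum.inr.inj h)
    exact hj (Sigma.mk.inj h1).1

variable {ι : Type*}

/-- The diagram on `n + m` vertices with given diagrams on the blocks. -/
def glue {I : Fin n → Finset (Fin m)} (hI : I ∈ indexPartitions n m)
    (κ : ∀ j, (Fin (I j).card → ι) × (Fin (I j).card → Fin 1 ⊕ Fin (I j).card)) :
    (Fin m → ι) × (Fin m → Fin n ⊕ Fin m) :=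
  (fun i => (κ ((blockEquiv hI).symm i).1).1 ((blockEquiv hI).symm i).2,
    fun i => blockVertex hI _ ((κ ((blockEquiv hI).symm i).1).2 ((blockEquiv hI).symm i).2))

/-! ### Assembling a diagram from diagrams on the blocks -/

section Glue

variable {I : Fin n → Finset (Fin m)} (hI : I ∈ indexPartitions n m)
    (κ : ∀ j, (Fin (I j).card → ι) × (Fin (I j).card → Fin 1 ⊕ Fin (I j).card))

theorem glue_fst (p : Σ j, Fin (I j).card) :
    (glue hI κ).1 (blockEquiv hI p) = (κ p.1).1 p.2 :=
  congrArg (fun x : Σ j, Fin (I j).card => (κ x.1).1 x.2) ((blockEquiv hI).symm_apply_apply p)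

theorem glue_snd (p : Σ j, Fin (I j).card) :
    (glue hI κ).2 (blockEquiv hI p) = blockVertex hI p.1 ((κ p.1).2 p.2) :=
  congrArg (fun x : Σ j, Fin (I j).card => blockVertex hI x.1 ((κ x.1).2 x.2))
    ((blockEquiv hI).symm_apply_apply p)

theorem glue_injective : Function.Injective (glue (ι := ι) hI) := by
  intro κ κ' h
  funext j
  refine Prod.ext (funext fun v => ?_) (funext fun v => blockVertex_injective hI j ?_)
  · rw [← glue_fst hI κ ⟨j, v⟩, ← glue_fst hI κ' ⟨j, v⟩, h]
  · rw [← glue_snd hI κ ⟨j, v⟩, ← glue_snd hI κ' ⟨j, v⟩, h]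

theorem isColoured_glue : IsColoured I (glue hI κ).2 := by
  intro j i hi
  have : i ∈ Set.range ((I j).orderEmbOfFin rfl) := by
    rw [Finset.range_orderEmbOfFin]
    exact hi
  obtain ⟨v, rfl⟩ := this
  rw [← blockEquiv_apply hI, glue_snd]
  rcases (κ j).2 v with u | v'
  · exact Or.inl rfl
  · exact Or.inr ⟨_, (I j).orderEmbOfFin_mem rfl v', rfl⟩

theorem exists_glue_eq {p : (Fin m → ι) × (Fin m → Fin n ⊕ Fin m)} (h : IsColoured I p.2) :
    ∃ κ, glue hI κ = p := by
  have : ∀ j (v : Fin (I j).card), ∃ u, blockVertex hI j u = p.2 (blockEquiv hI ⟨j, v⟩) := by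
    intro j v
    rcases h j _ ((I j).orderEmbOfFin_mem rfl v) with h1 | ⟨i', hi', h1⟩
    · exact ⟨Sum.inl 0, h1.symm⟩
    · have : i' ∈ Set.range ((I j).orderEmbOfFin rfl) := by
        rw [Finset.range_orderEmbOfFin]
        exact hi'
      obtain ⟨v', rfl⟩ := this
      exact ⟨Sum.inr v', h1.symm⟩
  choose u hu using this
  refine ⟨fun j => (fun v => p.1 (blockEquiv hI ⟨j, v⟩), u j), Prod.ext ?_ ?_⟩
  · refine funext fun i => ?_
    obtain ⟨x, rfl⟩ := (blockEquiv hI).surjective i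
    rw [glue_fst]
  · refine funext fun i => ?_
    obtain ⟨x, rfl⟩ := (blockEquiv hI).surjective i
    rw [glue_snd, hu]

/-- Only β's of the block j are contracted with vertices of that block, so the derivative taken at
such a vertex can be read off within the block. -/
theorem incidence_glue (j : Fin n) (u : Fin 1 ⊕ Fin (I j).card) :
    incidence (glue hI κ).1 (glue hI κ).2 (blockVertex hI j u) =
      incidence (κ j).1 (κ j).2 u := by
  rw [incidence, incidence, ← (blockEquiv hI).sum_comp, Fintype.sum_sigma,
    Finset.sum_eq_single_of_mem j (Finset.mem_univ j)]
  · refine Finset.sum_congr rfl fun v _ => ?_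
    rw [glue_fst, glue_snd]
    simp only [(blockVertex_injective hI j).eq_iff]
  · intro j' _ hj'
    refine Finset.sum_eq_zero fun v _ => ?_
    rw [glue_snd, if_neg (blockVertex_ne hI hj' _ _)]

/-- The contribution of a diagram to `ghostCorrelator`. -/
def wickTerm (P : Fin n → MvPolynomial ι ℂ) (S : Fin m → ι → MvPolynomial ι ℂ) (q : ℂ)
    (y : ι → ℂ) (z : Fin n → ℂ) (t : Fin m → ℂ) (p : (Fin m → ι) × (Fin m → Fin n ⊕ Fin m)) : ℂ :=
  (∏ i, (t i)⁻¹ * kronecker q (y (p.1 i)) (Sum.elim z t (p.2 i) / t i)) *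
      ∏ j, derivativeAtZero (Sum.elim P (fun i => S i (p.1 i)) j) (incidence p.1 p.2 j)

/-- Propagators and vertex factors both split over the blocks: an arrow never leaves its block, and
every vertex of the n + m lies in exactly one block. -/
theorem wickTerm_glue (P : Fin n → MvPolynomial ι ℂ) (S : Fin m → ι → MvPolynomial ι ℂ) (q : ℂ)
    (y : ι → ℂ) (z : Fin n → ℂ) (t : Fin m → ℂ) :
    wickTerm P S q y z t (glue hI κ) = ∏ j, wickTerm ![P j] (fun v => S ((I j).orderEmbOfFin rfl v))
      q y ![z j] (fun v => t ((I j).orderEmbOfFin rfl v)) (κ j) := by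
  unfold wickTerm
  refine (congrArg₂ (· * ·) ?_ ?_).trans Finset.prod_mul_distrib.symm
  · rw [← (blockEquiv hI).prod_comp, Fintype.prod_sigma]
    refine Finset.prod_congr rfl fun j _ => Finset.prod_congr rfl fun v _ => ?_
    rw [glue_fst, glue_snd]
    rcases (κ j).2 v with u | v' <;> simp [blockVertex, blockEquiv_apply]
  · simp only [Fintype.prod_sum_type, Finset.prod_mul_distrib]
    refine congrArg₂ (· * ·) ?_ ?_
    · refine Finset.prod_congr rfl fun j _ => ?_
      rw [Fin.prod_univ_one, ← incidence_glue hI κ]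
      simp [blockVertex]
    · rw [← (blockEquiv hI).prod_comp, Fintype.prod_sigma]
      refine Finset.prod_congr rfl fun j _ => Finset.prod_congr rfl fun v _ => ?_
      rw [← incidence_glue hI κ]
      simp only [Sum.elim_inr, glue_fst]
      rfl

end Glue

variable [Fintype ι]

theorem ghostCorrelator_eq (P : Fin n → MvPolynomial ι ℂ) (S : Fin m → ι → MvPolynomial ι ℂ) (q : ℂ)
    (y : ι → ℂ) (z : Fin n → ℂ) (t : Fin m → ℂ) :
    ghostCorrelator P S q y z t = partitionFunction q y * ∑ p, wickTerm P S q y z t p := by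
  rw [Fintype.sum_prod_type]
  rfl

open Classical in
theorem sum_wickTerm_isColoured {I : Fin n → Finset (Fin m)} (hI : I ∈ indexPartitions n m) (P : Fin n → MvPolynomial ι ℂ) (S : Fin m → ι → MvPolynomial ι ℂ)
    (q : ℂ) (y : ι → ℂ) (z : Fin n → ℂ) (t : Fin m → ℂ) :
    (∑ p : (Fin m → ι) × (Fin m → Fin n ⊕ Fin m),
      if IsColoured I p.2 then wickTerm P S q y z t p else 0) =
    ∏ j, ∑ p, wickTerm ![P j] (fun v => S ((I j).orderEmbOfFin rfl v))
      q y ![z j] (fun v => t ((I j).orderEmbOfFin rfl v)) p := by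
  rw [Finset.prod_univ_sum, Fintype.piFinset_univ]
  symm
  refine Finset.sum_of_injOn (glue hI) (glue_injective hI).injOn (fun _ _ => Finset.mem_univ _)
    (fun p _ hp => if_neg fun hc => hp ?_) fun κ _ => ?_
  · obtain ⟨κ, hκ⟩ := exists_glue_eq hI hc
    exact ⟨κ, Finset.mem_coe.2 (Finset.mem_univ _), hκ⟩
  · rw [if_pos (isColoured_glue hI κ), wickTerm_glue]

-- A contraction of i with the current i' differentiates S i' (p.1 i') in the variable p.1 i. For a
-- nonzero contribution that variable must occur there, hence has smaller height.
omit [Fintype ι] in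
theorem lt_of_wickTerm_ne_zero {P : Fin n → MvPolynomial ι ℂ} {S : Fin m → ι → MvPolynomial ι ℂ}
    {h : ι → ℤ} (hS : ∀ i b e b', coeff e (S i b) ≠ 0 → e b' ≠ 0 → h b' < h b) {q : ℂ}
    {y : ι → ℂ} {z : Fin n → ℂ} {t : Fin m → ℂ} {p : (Fin m → ι) × (Fin m → Fin n ⊕ Fin m)}
    (hp : wickTerm P S q y z t p ≠ 0) {i i' : Fin m} (hi : p.2 i = Sum.inr i') :
    h (p.1 i) < h (p.1 i') := by
  have h1 := Finset.prod_ne_zero_iff.1 (right_ne_zero_of_mul hp) (Sum.inr i') (Finset.mem_univ _)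
  refine hS i' (p.1 i') _ (p.1 i) (left_ne_zero_of_mul h1) ?_
  rw [incidence, Finsupp.finsetSum_apply]
  refine ne_of_gt (Finset.sum_pos' (fun _ _ => Nat.zero_le _) ⟨i, Finset.mem_univ _, ?_⟩)
  rw [if_pos hi]
  simp

theorem sum_wickTerm_eq (P : Fin n → MvPolynomial ι ℂ) (S : Fin m → ι → MvPolynomial ι ℂ)
    {h : ι → ℤ} (hS : ∀ i b e b', coeff e (S i b) ≠ 0 → e b' ≠ 0 → h b' < h b) (q : ℂ)
    (y : ι → ℂ) (z : Fin n → ℂ) (t : Fin m → ℂ) :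
    ∑ p, wickTerm P S q y z t p = ∑ I ∈ indexPartitions n m, ∏ j, ∑ p,
      wickTerm ![P j] (fun v => S ((I j).orderEmbOfFin rfl v)) q y ![z j]
        (fun v => t ((I j).orderEmbOfFin rfl v)) p := by
  classical
  -- Each block product is the sum over diagrams compatible with I. After exchanging the sums, every
  -- diagram with nonzero contribution is counted for exactly one I.
  rw [← Finset.sum_congr rfl fun I hI => sum_wickTerm_isColoured hI P S q y z t, Finset.sum_comm]
  refine Finset.sum_congr rfl fun p _ => ?_
  by_cases hp : wickTerm P S q y z t p = 0
  · simp [hp]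
  · obtain ⟨I, ⟨hI, hc⟩, hu⟩ := existsUnique_isColoured (fun i => h (p.1 i)) fun i i' hi =>
      lt_of_wickTerm_ne_zero hS hp hi
    rw [Finset.sum_eq_single_of_mem I hI, if_pos hc]
    exact fun I' hI' hne => if_neg fun hc' => hne (hu I' ⟨hI', hc'⟩)

end Colouring

/-! ### Factorization of the normalized correlators -/

namespace RootFrame
open LieAlgebra LieAlgebra.IsKilling

variable {𝔤 : Type*} [LieRing 𝔤] [LieAlgebra ℂ 𝔤] [FiniteDimensional ℂ 𝔤] [LieAlgebra.IsSimple ℂ 𝔤]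
  {𝔥 : LieSubalgebra ℂ 𝔤} [𝔥.IsCartanSubalgebra] (fr : RootFrame 𝔥) {n m : ℕ}

variable {q : ℂ} {a : fr.base.support → ℂ} {z : Fin n → ℂ} {t : Fin m → ℂ}

theorem character_eq (h : (q, a, z, t) ∈ fr.regularRegion n m) :
    fr.character q a = partitionFunction q fun β => Complex.exp (-fr.rootEval a β) := by
  have h0 : ((q, a, ![], ![]) : fr.Params 0 0) ∈ fr.regularRegion 0 0 :=
    ⟨h.1, h.2.1, h.2.2.1, fun j => j.elim0, fun i => i.elim0, fun j => j.elim0, fun i => i.elim0⟩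
  rw [character, fr.correlator_eq _ _ h0, wickCorrelator, ghostCorrelator_eq, Fintype.sum_prod_type,
    Fintype.sum_unique, Fintype.sum_unique, wickTerm]
  simp

theorem singleCorrelator_eq (h : (q, a, z, t) ∈ fr.regularRegion n m) (j : Fin n)
    (P : MvPolynomial fr.PosRoot ℂ) (α : Fin m → fr.PosRoot) (I : Finset (Fin m)) :
    fr.singleCorrelator P α I q a (z j) t =
      partitionFunction q (fun β => Complex.exp (-fr.rootEval a β)) * ∑ p, wickTerm ![P]
        (fun v => fr.leftField (α (I.orderEmbOfFin rfl v))) q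
        (fun β => Complex.exp (-fr.rootEval a β)) ![z j] (fun v => t (I.orderEmbOfFin rfl v)) p := by
  obtain ⟨h1, h2, h3, h4, h5, h6, h7⟩ := h
  -- Omitting insertions preserves the regularity conditions; the embedding of the block is
  -- injective, so distinct currents of the block stay distinct.
  have h0 : ((q, a, ![z j], fun v => t (I.orderEmbOfFin rfl v)) : fr.Params 1 I.card) ∈
      fr.regularRegion 1 I.card :=
    ⟨h1, h2, h3, fun k => by simpa using h4 j, fun v => h5 _, fun k v => by simpa using h6 j _,
      fun v v' hv => h7 _ _ fun h => hv ((I.orderEmbOfFin rfl).injective h)⟩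
  rw [singleCorrelator, fr.correlator_eq _ _ h0, wickCorrelator, ghostCorrelator_eq]

theorem correlator_div_character (h : (q, a, z, t) ∈ fr.regularRegion n m)
    (P : Fin n → MvPolynomial fr.PosRoot ℂ) (α : Fin m → fr.PosRoot) :
    fr.character q a ≠ 0 ∧ fr.correlator P α (q, a, z, t) / fr.character q a =
      ∑ I ∈ indexPartitions n m,
        ∏ j, fr.singleCorrelator (P j) α (I j) q a (z j) t / fr.character q a := by
  have hZ : fr.character q a ≠ 0 := by
    rw [fr.character_eq h]
    exact partitionFunction_ne_zero fun β =>
      fr.exp_neg_mem_thetaRegion ((fr.mem_regularRegion_iff.1 h).2.2.1 β)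
  refine ⟨hZ, ?_⟩
  simp only [fr.singleCorrelator_eq h]
  rw [fr.correlator_eq P α h, wickCorrelator, ghostCorrelator_eq]
  rw [fr.character_eq h] at hZ ⊢
  simp only [mul_div_cancel_left₀ _ hZ]
  exact sum_wickTerm_eq P _ (fun i b e b' => fr.ht_lt_of_coeff_leftField_ne_zero) q _ z t

end RootFrame

end GhostSystem

end

theorem mainTheorem7 {𝔤 : Type*} [LieRing 𝔤] [LieAlgebra ℂ 𝔤] [FiniteDimensional ℂ 𝔤]
    [LieAlgebra.IsSimple ℂ 𝔤] (𝔥 : LieSubalgebra ℂ 𝔤) [𝔥.IsCartanSubalgebra]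
    (fr : GhostSystem.RootFrame 𝔥) {n m : ℕ}
    (P : Fin n → MvPolynomial fr.PosRoot ℂ) (α : Fin m → fr.PosRoot) :
    fr.IsCorrelator P α (fr.correlator P α) ∧
    ∀ q a z t, (q, a, z, t) ∈ fr.regularRegion n m →
      fr.character q a ≠ 0 ∧
      fr.correlator P α (q, a, z, t) / fr.character q a =
        ∑ I ∈ GhostSystem.indexPartitions n m,
          ∏ j, fr.singleCorrelator (P j) α (I j) q a (z j) t / fr.character q a :=
  ⟨fr.isCorrelator_correlator P α, fun _ _ _ _ h => fr.correlator_div_character h P α⟩
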